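/- Theorem 3.6. Fix $d\ge 1$ and let $B(r)=\{x\in\mathbb R^d:|x|\le r\}$ be the closed Euclidean ball. All Gaussian fields are centred, and a Gaussian field $X$ on $\mathbb R^d$ is called isotropic if $\mathbb E[X(x)X(y)]$ depends only on $|x-y|$; a radial function is identified with its restriction to $[0,\infty)$. Let $f$ be an (almost surely) $C^1$-smooth isotropic Gaussian field on $\mathbb R^d$ with covariance $K(x-y)=\mathbb E[f(x)f(y)]$. Assume that $K$ is regularly varying with some index $\alpha\in[0,\infty)$, i.e. $K$ is continuous and $K(x)\sim x^{-\alpha}\ell(x)$ as $x\to\infty$, where $\ell$ is continuous, strictly positive and satisfies $\ell(ax)/\ell(x)\to1$ as $x\to\infty$ for every $a>0$. Assume that $f$ has a local-global decomposition $(f_L,g_L)_{L\ge1}$, i.e. for each $L\ge1$, $f_L$ and $g_L$ are isotropic Gaussian fields on a common probability space such that $f$ and $f_L+g_L$ are equal in law, $\mathbb E[f_L(0)f_L(x)]=0$ for all $|x|\ge L$, $g_L$ is (almost surely) $C^1$-smooth, and moreover $$\lim_{M\to\infty}\limsup_{L\to\infty}\sup_{|x|\ge ML}\Big|\frac{\mathbb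 E[g_L(0)g_L(x)]}{K(x)}-1\Big|=0,$$ $$\mathbb E[g_L(0)^2]=O(K(L)),\qquad \max_{1\le i\le d}\mathbb E[(\partial_i g_L(0))^2]=o(1)\qquad(L\to\infty),$$ and, if $|1/K(L)|=L^{o(1)}$ as $L\to\infty$, then also $\max_{1\le i\le d}\mathbb E[(\partial_i g_L(0))^2]=O(L^{-2}K(L))$. For a compact set $D\subset\mathbb R^d$ let $$\mathrm{Cap}_K(D)=\Big(\min_{\mu}\int_D\int_D K(x-y)\,d\mu(x)\,d\mu(y)\Big)^{-1}\in(0,\infty],$$ the minimum being over the Borel probability measures $\mu$ on $D$, with $\mathrm{Cap}_K(\emptyset)=0$. For a translate $D$ of a ball $B(r)$, let $\Gamma_s(D)$ be the closed ball of radius $s$ with the same centre as $D$. Let $u>0$ and let $s=s(L)\to\infty$ be such that $K(L)=o(K(s(L)))$ as $L\to\infty$. Then there exists a real-valued function $\gamma_{L,M}$ with $$\lim_{M\to\infty}\limsup_{L\to\infty}\gamma_{L,M}=0$$ such that, for every $L,M\ge1$ and every finite collection $(D_i)_{1\le i\le n}$ of translates of $B(L)$ whose pairwise distances are larger than $ML$,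 $$-\log\mathbb P\big[\{x:g_L(x)\ge u\}\cap D_i\ne\emptyset\text{ for every }i\big]\ \ge\ \frac{u^2\,\mathrm{Cap}_K\big(\bigcup_i\Gamma_{s(L)}(D_i)\big)(1-\gamma_{L,M})}{2},$$ where $-\log 0=+\infty$. -/

import Mathlib

open MeasureTheory ProbabilityTheory Filter Topology Asymptotics
open scoped ENNReal

/-- A slowly varying function at infinity: continuous and strictly positive on `(0, ∞)`, with
`ℓ (a x) / ℓ x → 1` as `x → ∞`, for every `a > 0`. -/
structure SlowlyVarying (ℓ : ℝ → ℝ) : Prop where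
  continuousOn : ContinuousOn ℓ (Set.Ioi 0)
  pos : ∀ x, 0 < x → 0 < ℓ x
  tendsto_ratio : ∀ a, 0 < a → Tendsto (fun x => ℓ (a * x) / ℓ x) atTop (𝓝 1)

/-- A function on `[0, ∞)` (the radial profile of a continuous isotropic function on `ℝ^d`) is
regularly varying at infinity with index `α` if it is asymptotic to `x ^ (-α) * ℓ x`, with `ℓ`
slowly varying. -/
def RegularlyVarying (k : ℝ → ℝ) (α : ℝ) : Prop :=
  ContinuousOn k (Set.Ici 0) ∧
    ∃ ℓ : ℝ → ℝ, SlowlyVarying ℓ ∧ k ~[atTop] fun x => x ^ (-α) * ℓ x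

/-- `X` is a centred isotropic Gaussian field on `ℝ^d` (indexed by points, defined on the
probability space `(Ω, P)`) whose covariance is `E[X x * X y] = k |x - y|`. -/
structure IsIsotropicGaussianField {d : ℕ} {Ω : Type*} [MeasurableSpace Ω]
    (X : EuclideanSpace ℝ (Fin d) → Ω → ℝ) (P : Measure Ω) (k : ℝ → ℝ) : Prop where
  gaussian : IsGaussianProcess X P
  centred : ∀ x, ∫ ω, X x ω ∂P = 0
  covariance : ∀ x y, ∫ ω, X x ω * X y ω ∂P = k ‖x - y‖

/-- Almost every realisation of the field is continuously differentiable. -/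
def IsC1Field {d : ℕ} {Ω : Type*} [MeasurableSpace Ω]
    (X : EuclideanSpace ℝ (Fin d) → Ω → ℝ) (P : Measure Ω) : Prop :=
  ∀ᵐ ω ∂P, ContDiff ℝ 1 (fun x => X x ω)

/-- Equality in law of two random fields, i.e. equality of all finite-dimensional laws. -/
def EqualInLaw {ι : Type*} {Ω Ω' : Type*} [MeasurableSpace Ω] [MeasurableSpace Ω']
    (X : ι → Ω → ℝ) (P : Measure Ω) (Y : ι → Ω' → ℝ) (Q : Measure Ω') : Prop :=
  ∀ I : Finset ι, IdentDistrib (fun ω => I.restrict (X · ω)) (fun ω => I.restrict (Y · ω)) P Q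

/-- The largest second moment at the origin of a first-order partial derivative of the field. -/
noncomputable def maxPartialVar {d : ℕ} {Ω : Type*} [MeasurableSpace Ω]
    (X : EuclideanSpace ℝ (Fin d) → Ω → ℝ) (P : Measure Ω) : ℝ :=
  ⨆ i : Fin d, ∫ ω, (fderiv ℝ (fun x => X x ω) 0 (EuclideanSpace.single i 1)) ^ 2 ∂P

/-- `(fL L, gL L)`, `L ≥ 1`, is a local-global decomposition of the field `f`, which has isotropic
covariance with radial profile `k`. The pair of index `L` lives on the probability space
`(Ω' L, Q L)`; values at `L < 1` are irrelevant. -/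
structure IsLocalGlobalDecomposition {d : ℕ} {Ω : Type*} [MeasurableSpace Ω]
    (f : EuclideanSpace ℝ (Fin d) → Ω → ℝ) (P : Measure Ω) (k : ℝ → ℝ)
    {Ω' : ℝ → Type*} [∀ L, MeasurableSpace (Ω' L)] (Q : ∀ L, Measure (Ω' L))
    (fL gL : ∀ L, EuclideanSpace ℝ (Fin d) → Ω' L → ℝ) : Prop where
  local_isotropic : ∀ L, 1 ≤ L → ∃ r : ℝ → ℝ, IsIsotropicGaussianField (fL L) (Q L) r
  global_isotropic : ∀ L, 1 ≤ L → ∃ r : ℝ → ℝ, IsIsotropicGaussianField (gL L) (Q L) r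
  sum_law : ∀ L, 1 ≤ L → EqualInLaw f P (fun x ω => fL L x ω + gL L x ω) (Q L)
  local_range : ∀ L, 1 ≤ L → ∀ x : EuclideanSpace ℝ (Fin d), L ≤ ‖x‖ →
    ∫ ω, fL L 0 ω * fL L x ω ∂(Q L) = 0
  global_C1 : ∀ L, 1 ≤ L → IsC1Field (gL L) (Q L)
  global_cov : Tendsto
    (fun M : ℝ => limsup
      (fun L : ℝ => ⨆ (x : EuclideanSpace ℝ (Fin d)) (_ : M * L ≤ ‖x‖),
        ENNReal.ofReal |(∫ ω, gL L 0 ω * gL L x ω ∂(Q L)) / k ‖x‖ - 1|) atTop)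
    atTop (𝓝 0)
  global_var : (fun L => ∫ ω, (gL L 0 ω) ^ 2 ∂(Q L)) =O[atTop] k
  global_deriv : Tendsto (fun L => maxPartialVar (gL L) (Q L)) atTop (𝓝 0)
  global_deriv_slow :
    (∃ e : ℝ → ℝ, Tendsto e atTop (𝓝 0) ∧ ∀ᶠ L in atTop, |1 / k L| = L ^ e L) →
      (fun L => maxPartialVar (gL L) (Q L)) =O[atTop] fun L => L ^ (-2 : ℝ) * k L

/-- The energy `∫∫ K(x, y) dμ(x) dμ(y)`. -/
noncomputable def kernelEnergy {E : Type*} [MeasurableSpace E] (K : E → E → ℝ) (μ : Measure E) :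
    ℝ :=
  ∫ x, ∫ y, K x y ∂μ ∂μ

/-- The capacity of `D` with respect to the kernel `K`, in `[0, ∞]`: the inverse of the minimal
energy of the Borel probability measures carried by `D` (and `0` if `D` is empty). -/
noncomputable def kernelCapacity {E : Type*} [MeasurableSpace E] (K : E → E → ℝ) (D : Set E) :
    ℝ≥0∞ :=
  (⨅ (μ : ProbabilityMeasure E) (_ : (μ : Measure E) Dᶜ = 0),
    ENNReal.ofReal (kernelEnergy K (μ : Measure E)))⁻¹

/-!
Why the bound holds. Let `μ` be any probability measure on the union of the small balls, with energy
`E`, and let `p i` be the mass that it gives to the ball of index `i`. If `gL` exceeds `u` somewhere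
in every `D i`, then the weighted sum `∑ p i * sup (gL over D i)` is at least `u`. Replacing each
supremum by the value at one reference point of a cube around `D i` leaves a centred Gaussian
variable of variance `∑ p i p j E[gL gL]`, plus a remainder made of suprema of increments. If that
variance is at most about `E` and the remainder is negligible, the probability is at most about
`exp (-u ^ 2 / (2 E))`; the infimum over `μ` turns this into the capacity
(`mul_kernelCapacity_le_neg_log`). No optimality of `μ` is used.

*The variance.* At distances much larger than `L` the covariance of `gL` is close to `k` and
insensitive to displacements of order `L`
(`IsLocalGlobalDecomposition.eventually_abs_profile_sub_le`), so the off-diagonal terms match the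
mutual energies of the restrictions of `μ` to the balls. The diagonal terms have size `k L`. They
must be small compared with the self-energies, about which only the mass of the ball is known: a
measure of mass `m` on a ball of large radius `ρ` has energy at least `c * k ρ * m ^ 2`
(`RegularlyVarying.exists_energy_ge`), and `k L = o(k (s L))`.

*The lower bound on energies.* It is proved in Fourier space, without Bochner's theorem: the Fourier
transform of `K` times a Gaussian is nonnegative (`IsPosDefFun.regSpectral_nonneg`). The function
`exp (-|z| ^ 2) * (1 - exp (-|z| ^ 2)) ^ N` is nonnegative, vanishes to high order at the origin,
and for odd `N` has a Fourier transform which is nonpositive far out. After scaling, this transform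
is dominated, up to a constant, by the squared modulus of that of a measure on the ball of radius
`ρ`, so the energy dominates the average of `K` against the scaled function
(`IsPosDefFun.integral_annularBump_le`), which has order `k ρ`.

*The remainder.* Suprema are replaced by smooth maxima on dyadic points. By the Maurey–Pisier
inequality (`hasSubgaussianMGF_of_variance_fderiv_le`) their weighted sum is sub-Gaussian with a
proxy controlled by the covariances of the increments between the cubes, which are `o(E)`
(`hasSubgaussianMGF_sum_logSumExp`). Its mean tends to `0` by chaining: the mean square increment is
bounded both by the variance and, through the derivative, by the squared distance; interpolating
between the two gives a Hölder bound which is small on a cube of side `2 L`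
(`IsLocalGlobalDecomposition.eventually_integral_sup'_sub_le`). The two sub-Gaussian parts are
added without independence (`IsIsotropicGaussianField.measure_forall_exists_ge_le`).

Finally `γ` is the smallest relative error for which the inequality holds, up to `1 / L`; the value
`1` is always admissible, and every positive value is admissible for large `M` and then large `L`
(`IsLocalGlobalDecomposition.eventually_exceedance_le`).
-/

/-! ### Regular variation -/

/-- Karamata's uniform convergence theorem in additive form, by Baire's theorem: for one of the
closed sets `{a | ∀ t ≥ n, |h (t + a) - h t| ≤ ε}` the interior is nonempty. -/
lemma exists_uniform_increment_le {h : ℝ → ℝ} (hc : Continuous h)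
    (hh : ∀ a, Tendsto (fun t => h (t + a) - h t) atTop (𝓝 0)) {ε : ℝ} (hε : 0 < ε) :
    ∃ T, ∀ t ≥ T, ∀ a ∈ Set.Icc (0 : ℝ) 1, |h (t + a) - h t| ≤ ε := by
  obtain ⟨δ, hδ, T₁, hT₁⟩ : ∃ δ > 0, ∃ T, ∀ t ≥ T, ∀ b : ℝ, |b| < δ →
      |h (t + b) - h t| ≤ ε / 2 := by
    let S : ℕ → Set ℝ := fun n => {a | ∀ t ≥ (n : ℝ), |h (t + a) - h t| ≤ ε / 4}
    have hS : ∀ n, IsClosed (S n) := fun n => by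
      simp only [S, Set.ofPred_forall]
      exact isClosed_iInter fun t => isClosed_iInter fun _ =>
        isClosed_le (by fun_prop) continuous_const
    have hU : ⋃ n, S n = Set.univ := by
      refine Set.eq_univ_of_forall fun a => ?_
      have h1 := (Metric.tendsto_nhds.1 (hh a)) (ε / 4) (by positivity)
      obtain ⟨T, hT⟩ := eventually_atTop.1 h1
      obtain ⟨n, hn⟩ := exists_nat_ge T
      refine Set.mem_iUnion.2 ⟨n, fun t ht => ?_⟩
      have := hT t (hn.trans ht)
      rw [Real.dist_eq, sub_zero] at this
      exact this.le
    obtain ⟨n, a₀, ha₀⟩ := nonempty_interior_of_iUnion_of_closed hS hU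
    obtain ⟨δ, hδ, hball⟩ := Metric.isOpen_iff.1 isOpen_interior a₀ ha₀
    refine ⟨δ, hδ, n + |a₀|, fun t ht b hb => ?_⟩
    have ht' : (n : ℝ) ≤ t - a₀ := by linarith [le_abs_self a₀]
    have e1 := interior_subset (hball (show a₀ + b ∈ Metric.ball a₀ δ by
      simpa [Real.dist_eq] using hb)) (t - a₀) ht'
    have e2 := interior_subset ha₀ (t - a₀) ht'
    rw [show t - a₀ + (a₀ + b) = t + b by ring] at e1
    rw [show t - a₀ + a₀ = t by ring] at e2
    rw [abs_le] at *
    constructor <;> linarith [e1.1, e1.2, e2.1, e2.2]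
  -- increments smaller than `δ` are uniformly controlled, and a mesh of width `δ / 2` reduces
  -- `[0, 1]` to finitely many increments
  obtain ⟨J, hJ⟩ := exists_nat_gt (2 / δ)
  have h2 : ∀ᶠ t in atTop, ∀ j ∈ Finset.range (J + 1),
      |h (t + j * (δ / 2)) - h t| ≤ ε / 2 := by
    rw [Filter.eventually_all_finset]
    intro j _
    filter_upwards [(Metric.tendsto_nhds.1 (hh (j * (δ / 2)))) (ε / 2) (by positivity)] with t ht
    rw [Real.dist_eq, sub_zero] at ht
    exact ht.le
  obtain ⟨T₂, hT₂⟩ := eventually_atTop.1 h2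
  refine ⟨max T₁ T₂, fun t ht a ha => ?_⟩
  set j := ⌊a / (δ / 2)⌋₊ with hj
  have hj1 : (j : ℝ) * (δ / 2) ≤ a := by
    have := Nat.floor_le (div_nonneg ha.1 (half_pos hδ).le)
    rwa [le_div_iff₀ (half_pos hδ)] at this
  have hj2 : a < (j + 1 : ℝ) * (δ / 2) := by
    have := Nat.lt_floor_add_one (a / (δ / 2))
    rwa [div_lt_iff₀ (half_pos hδ)] at this
  have hjJ : j ∈ Finset.range (J + 1) := by
    rw [Finset.mem_range]
    have h3 : (j : ℝ) ≤ J := by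
      have : a / (δ / 2) ≤ 2 / δ := by
        rw [div_le_div_iff₀ (half_pos hδ) hδ]; nlinarith [ha.2]
      exact (Nat.floor_le (div_nonneg ha.1 (half_pos hδ).le)).trans (this.trans hJ.le)
    have : j ≤ J := by exact_mod_cast h3
    omega
  have e1 := hT₂ t ((le_max_right _ _).trans ht) j hjJ
  have e2 := hT₁ (t + j * (δ / 2)) (by
    have : (0 : ℝ) ≤ j * (δ / 2) := by positivity
    linarith [le_max_left T₁ T₂]) (a - j * (δ / 2)) (by
      rw [abs_of_nonneg (by linarith)]; linarith)
  rw [show t + j * (δ / 2) + (a - j * (δ / 2)) = t + a by ring] at e2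
  rw [abs_le] at *
  constructor <;> linarith [e1.1, e1.2, e2.1, e2.2]

/-- Potter's bound in additive form, by iterating the uniform bound over unit steps. -/
lemma exists_increment_le_mul {h : ℝ → ℝ} (hc : Continuous h)
    (hh : ∀ a, Tendsto (fun t => h (t + a) - h t) atTop (𝓝 0)) {ε : ℝ} (hε : 0 < ε) :
    ∃ T, ∀ t ≥ T, ∀ a ≥ 0, |h (t + a) - h t| ≤ ε * (a + 1) := by
  obtain ⟨T, hT⟩ := exists_uniform_increment_le hc hh hε
  have key : ∀ n : ℕ, ∀ t ≥ T, ∀ a ∈ Set.Icc (n : ℝ) (n + 1), |h (t + a) - h t| ≤ ε * (n + 1) := by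
    intro n
    induction n with
    | zero =>
      intro t ht a ha
      simpa using hT t ht a (by simpa using ha)
    | succ n ih =>
      intro t ht a ha
      push_cast at ha ⊢
      have e1 := ih t ht (a - 1) ⟨by linarith [ha.1], by linarith [ha.2]⟩
      have hn : (0 : ℝ) ≤ n := n.cast_nonneg
      have e2 := hT (t + (a - 1)) (by linarith [ha.1]) 1 ⟨zero_le_one, le_rfl⟩
      rw [show t + (a - 1) + 1 = t + a by ring] at e2
      rw [abs_le] at *
      constructor <;> nlinarith [e1.1, e1.2, e2.1, e2.2]
  refine ⟨T, fun t ht a ha => ?_⟩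
  refine (key ⌊a⌋₊ t ht a ⟨Nat.floor_le ha, (Nat.lt_floor_add_one a).le⟩).trans ?_
  have := Nat.floor_le ha
  gcongr

/-- Potter's bound for the logarithm of a regularly varying function. -/
lemma RegularlyVarying.exists_abs_log_le {k : ℝ → ℝ} {α : ℝ} (hk : RegularlyVarying k α)
    {ε : ℝ} (hε : 0 < ε) :
    ∃ X > 0, ∀ x ≥ X, 0 < k x ∧ ∀ y ≥ x,
      |Real.log (k y) - Real.log (k x) + α * Real.log (y / x)| ≤ ε * (Real.log (y / x) + 1) := by
  obtain ⟨-, ℓ, hℓ, hkl⟩ := hk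
  set h : ℝ → ℝ := fun t => Real.log (ℓ (Real.exp t)) with hh
  have hc : Continuous h := by
    rw [continuous_iff_continuousAt]
    intro t
    have h1 : ContinuousAt ℓ (Real.exp t) :=
      hℓ.continuousOn.continuousAt (Ioi_mem_nhds (Real.exp_pos t))
    exact (h1.comp Real.continuous_exp.continuousAt).log (hℓ.pos _ (Real.exp_pos t)).ne'
  have hlim : ∀ a, Tendsto (fun t => h (t + a) - h t) atTop (𝓝 0) := by
    intro a
    have h1 := (hℓ.tendsto_ratio (Real.exp a) (Real.exp_pos a)).comp Real.tendsto_exp_atTop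
    have h2 := ((Real.continuousAt_log one_ne_zero).tendsto.comp h1)
    rw [Real.log_one] at h2
    refine h2.congr fun t => ?_
    simp only [Function.comp, hh]
    rw [Real.log_div (hℓ.pos _ (by positivity)).ne' (hℓ.pos _ (by positivity)).ne',
      ← Real.exp_add, add_comm a t]
  -- the factor `φ`, which tends to `1`, absorbs the passage from `k` to `x ^ (-α) * ℓ x`
  obtain ⟨T, hT⟩ := exists_increment_le_mul hc hlim (half_pos hε)
  obtain ⟨φ, hφ, hkφ⟩ := hkl.exists_eq_mul
  have hφ2 : ∀ᶠ x in atTop, 0 < φ x ∧ |Real.log (φ x)| ≤ ε / 4 := by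
    have h2 := ((Real.continuousAt_log one_ne_zero).tendsto.comp hφ)
    rw [Real.log_one] at h2
    filter_upwards [hφ.eventually (lt_mem_nhds zero_lt_one),
      (Metric.tendsto_nhds.1 h2) (ε / 4) (by positivity)] with x hx hx2
    rw [Real.dist_eq, sub_zero] at hx2
    exact ⟨hx, hx2.le⟩
  obtain ⟨X, hX⟩ := eventually_atTop.1 (hφ2.and hkφ)
  have main : ∀ x ≥ max X (Real.exp T), 0 < x ∧ 0 < k x ∧
      Real.log (k x) = Real.log (φ x) - α * Real.log x + h (Real.log x) := by
    intro x hx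
    obtain ⟨⟨h1, h2⟩, h3⟩ := hX x ((le_max_left _ _).trans hx)
    have hx0 : 0 < x := (Real.exp_pos T).trans_le ((le_max_right _ _).trans hx)
    have hl := hℓ.pos x hx0
    have hr : 0 < x ^ (-α) := Real.rpow_pos_of_pos hx0 _
    simp only [Pi.mul_apply] at h3
    refine ⟨hx0, by rw [h3]; positivity, ?_⟩
    rw [h3, Real.log_mul h1.ne' (by positivity), Real.log_mul hr.ne' hl.ne', Real.log_rpow hx0]
    simp only [hh, Real.exp_log hx0]
    ring
  refine ⟨max X (Real.exp T), lt_max_of_lt_right (Real.exp_pos T), fun x hx => ?_⟩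
  obtain ⟨hx0, hkx, hlx⟩ := main x hx
  refine ⟨hkx, fun y hy => ?_⟩
  obtain ⟨hy0, hky, hly⟩ := main y (hx.le.trans hy)
  have hT' : T ≤ Real.log x := (Real.le_log_iff_exp_le hx0).2 ((le_max_right _ _).trans hx)
  have ha : 0 ≤ Real.log y - Real.log x := sub_nonneg.2 (Real.log_le_log hx0 hy)
  have e1 := hT (Real.log x) hT' _ ha
  rw [add_sub_cancel] at e1
  have e2 := (hX x ((le_max_left _ _).trans hx)).1.2
  have e3 := (hX y ((le_max_left _ _).trans (hx.le.trans hy))).1.2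
  rw [Real.log_div hy0.ne' hx0.ne', hlx, hly]
  rw [abs_le] at *
  constructor <;> nlinarith [e1.1, e1.2, e2.1, e2.2, e3.1, e3.2]

lemma RegularlyVarying.exists_pos {k : ℝ → ℝ} {α : ℝ} (hk : RegularlyVarying k α) :
    ∃ X > 0, ∀ x ≥ X, 0 < k x := by
  obtain ⟨X, hX, h⟩ := hk.exists_abs_log_le one_pos
  exact ⟨X, hX, fun x hx => (h x hx).1⟩

/-- Potter's bounds: up to a power of arbitrarily small exponent, `k y / k x` behaves like
`(y / x) ^ (-α)` for `y ≥ x` large. -/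
lemma RegularlyVarying.exists_potter {k : ℝ → ℝ} {α : ℝ} (hk : RegularlyVarying k α)
    {θ : ℝ} (hθ : 0 < θ) :
    ∃ C > 0, ∃ X > 0, ∀ x ≥ X, 0 < k x ∧ ∀ y ≥ x, k y ≤ C * (y / x) ^ (-α + θ) * k x ∧
      k x ≤ C * (y / x) ^ (α + θ) * k y := by
  obtain ⟨X, hX, h⟩ := hk.exists_abs_log_le hθ
  refine ⟨Real.exp θ, Real.exp_pos _, X, hX, fun x hx => ⟨(h x hx).1, fun y hy => ?_⟩⟩
  have hx0 : 0 < x := hX.trans_le hx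
  have hy0 : 0 < y := hx0.trans_le hy
  have hr : 0 < y / x := by positivity
  have hkx := (h x hx).1
  have hky := (h y (hx.le.trans hy)).1
  have h1 := (h x hx).2 y hy
  rw [abs_le] at h1
  rw [Real.rpow_def_of_pos hr, Real.rpow_def_of_pos hr, ← Real.exp_add, ← Real.exp_add]
  constructor
  · rw [← Real.exp_log hky, ← Real.exp_log hkx, ← Real.exp_add, Real.exp_le_exp]
    nlinarith [h1.1, h1.2]
  · rw [← Real.exp_log hky, ← Real.exp_log hkx, ← Real.exp_add, Real.exp_le_exp]
    nlinarith [h1.1, h1.2]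

/-- Uniform convergence of `k y / k x` to `1` as `x → ∞` and `y / x → 1`. -/
lemma RegularlyVarying.exists_ratio_near_one {k : ℝ → ℝ} {α : ℝ} (hk : RegularlyVarying k α)
    {ε : ℝ} (hε : 0 < ε) :
    ∃ η ∈ Set.Ioo (0 : ℝ) 1, ∃ X > 0, ∀ x ≥ X, ∀ y, |y - x| ≤ η * x →
      |k y - k x| ≤ ε * k x := by
  obtain ⟨ρ, hρ, hexp⟩ : ∃ ρ > 0, ∀ v : ℝ, |v| ≤ ρ → |Real.exp v - 1| ≤ ε := by
    have h1 := Metric.continuousAt_iff.1 (Real.continuous_exp.continuousAt (x := 0)) ε hε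
    obtain ⟨ρ, hρ, h⟩ := h1
    refine ⟨ρ / 2, half_pos hρ, fun v hv => ?_⟩
    have := h (x := v) (by rw [Real.dist_eq, sub_zero]; linarith)
    rw [Real.exp_zero, Real.dist_eq] at this
    exact this.le
  -- the logarithm of the ratio is at most `|α| v + ρ / 4 (v + 1)` where `v = |log (y / x)|`
  obtain ⟨X, hX, h⟩ := hk.exists_abs_log_le (show 0 < ρ / 4 by positivity)
  set B := |α| + ρ / 4 with hB
  have hB0 : 0 < B := by positivity
  obtain ⟨η, hη, hη1, hlog⟩ : ∃ η > 0, η < 1 / 2 ∧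
      ∀ v : ℝ, |v - 1| ≤ η → |Real.log v| ≤ ρ / (4 * B) := by
    have h1 := Metric.continuousAt_iff.1 (Real.continuousAt_log one_ne_zero) (ρ / (4 * B))
      (by positivity)
    obtain ⟨η, hη, h⟩ := h1
    refine ⟨min (η / 2) (1 / 3), by positivity, (min_le_right _ _).trans_lt (by norm_num),
      fun v hv => ?_⟩
    have := h (x := v) (by
      rw [Real.dist_eq]; exact hv.trans_lt ((min_le_left _ _).trans_lt (by linarith)))
    rw [Real.log_one, Real.dist_eq, sub_zero] at this
    exact this.le
  have key : ∀ x ≥ X, ∀ y ≥ x, |Real.log (y / x)| ≤ ρ / (4 * B) →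
      |Real.log (k y) - Real.log (k x)| ≤ ρ := by
    intro x hx y hy hl
    have h1 := (h x hx).2 y hy
    have h2 : |α * Real.log (y / x)| + ρ / 4 * |Real.log (y / x)| ≤ ρ / 4 := by
      rw [abs_mul, ← add_mul]
      calc B * |Real.log (y / x)| ≤ B * (ρ / (4 * B)) := by gcongr
        _ = ρ / 4 := by field_simp
    have h3 := le_abs_self (Real.log (y / x))
    rw [abs_le] at h1 ⊢
    have h4 := neg_abs_le (α * Real.log (y / x))
    have h5 := le_abs_self (α * Real.log (y / x))
    have h6 := mul_le_mul_of_nonneg_left h3 (show 0 ≤ ρ / 4 by positivity)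
    constructor <;> linarith [h1.1, h1.2]
  refine ⟨η, ⟨hη, by linarith⟩, 2 * X, by positivity, fun x hx y hy => ?_⟩
  have hx0 : 0 < x := by linarith
  have hxX : X ≤ x := by linarith
  have hyl : x / 2 ≤ y := by
    have := (abs_le.1 hy).1
    nlinarith
  have hyX : X ≤ y := by linarith
  have hy0 : 0 < y := by linarith
  have hlog1 : |Real.log (y / x)| ≤ ρ / (4 * B) := hlog _ (by
    rw [div_sub_one hx0.ne', abs_div, abs_of_pos hx0, div_le_iff₀ hx0]; exact hy)
  have hkx := (h x hxX).1
  have hky := (h y hyX).1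
  have h7 : |Real.log (k y) - Real.log (k x)| ≤ ρ := by
    rcases le_total x y with hxy | hxy
    · exact key x hxX y hxy hlog1
    · rw [abs_sub_comm]
      refine key y hyX x hxy ?_
      rwa [← inv_div, Real.log_inv, abs_neg]
  have h8 := hexp _ h7
  rw [Real.exp_sub, Real.exp_log hky, Real.exp_log hkx, div_sub_one hkx.ne', abs_div,
    abs_of_pos hkx, div_le_iff₀ hkx] at h8
  exact h8

/-- A regularly varying function is bounded below by a multiple of its value at a comparable
point. -/
lemma RegularlyVarying.exists_comparable {k : ℝ → ℝ} {α : ℝ} (hk : RegularlyVarying k α)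
    (hα : 0 ≤ α) {A : ℝ} (hA : 1 ≤ A) :
    ∃ c > 0, ∃ X > 0, ∀ x ≥ X, ∀ y, x ≤ y → y ≤ A * x → c * k x ≤ k y := by
  obtain ⟨C, hC, X, hX, h⟩ := hk.exists_potter one_pos
  refine ⟨(C * A ^ (α + 1))⁻¹, by positivity, X, hX, fun x hx y hxy hyA => ?_⟩
  have hx0 : 0 < x := hX.trans_le hx
  have h1 := ((h x hx).2 y hxy).2
  have hky := (h y (hx.le.trans hxy)).1
  rw [inv_mul_le_iff₀ (by positivity)]
  have h2 : (y / x) ^ (α + 1) ≤ A ^ (α + 1) := by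
    refine Real.rpow_le_rpow (div_nonneg (hx0.le.trans hxy) hx0.le) ?_ (by linarith)
    rwa [div_le_iff₀ hx0]
  calc k x ≤ C * (y / x) ^ (α + 1) * k y := h1
    _ ≤ C * A ^ (α + 1) * k y := by gcongr

/-! ### Gaussian concentration -/

section MaureyPisier

variable {E : Type*} [NormedAddCommGroup E] [NormedSpace ℝ E] [MeasurableSpace E] [BorelSpace E]
  [SecondCountableTopology E] {ν : Measure E} [IsGaussian ν] {F : E → ℝ}

lemma lintegral_exp_dual_of_isGaussian [CompleteSpace E] (h0 : ν[id] = 0)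
    (L : StrongDual ℝ E) (t : ℝ) :
    ∫⁻ x, ENNReal.ofReal (Real.exp (t * L x)) ∂ν =
      ENNReal.ofReal (Real.exp (Var[L; ν] * t ^ 2 / 2)) := by
  have hL : ν[L] = 0 := by
    have := IsGaussian.integral_dual (μ := ν) L
    simp only [id_eq] at h0
    rw [this, h0, map_zero]
  have hmap := IsGaussian.map_eq_gaussianReal (μ := ν) L
  rw [hL] at hmap
  have h1 := mgf_gaussianReal hmap t
  have h2 : Integrable (fun x => Real.exp (t * L x)) ν := by
    have := integrable_exp_mul_gaussianReal (μ := 0) (v := Var[L; ν].toNNReal) t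
    rw [← hmap, integrable_map_measure (by fun_prop) (by fun_prop)] at this
    exact this
  rw [← ofReal_integral_eq_lintegral_ofReal h2 (ae_of_all _ fun _ => (Real.exp_pos _).le)]
  rw [mgf] at h1
  rw [h1, Real.coe_toNNReal _ (variance_nonneg _ _)]
  simp

lemma integrable_exp_of_norm_fderiv_le [CompleteSpace E] (hF : ContDiff ℝ 1 F) {C : ℝ}
    (hC : ∀ x, ‖fderiv ℝ F x‖ ≤ C) (t : ℝ) : Integrable (fun x => Real.exp (t * F x)) ν := by
  obtain ⟨c, hc, hint⟩ := IsGaussian.exists_integrable_exp_sq ν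
  have hcont := hF.continuous
  refine (hint.const_mul (Real.exp (|t| * |F 0| + (|t| * C) ^ 2 / (4 * c)))).mono'
    (by fun_prop) (ae_of_all _ fun x => ?_)
  rw [Real.norm_eq_abs, Real.abs_exp, ← Real.exp_add, Real.exp_le_exp]
  have h1 : ‖F x - F 0‖ ≤ C * ‖x - 0‖ :=
    Convex.norm_image_sub_le_of_norm_fderiv_le (s := Set.univ)
      (fun y _ => (hF.differentiable one_ne_zero).differentiableAt) (fun y _ => hC y)
      convex_univ trivial trivial
  rw [sub_zero, Real.norm_eq_abs] at h1
  have h2 : |F x| ≤ |F 0| + C * ‖x‖ := by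
    have := abs_add_le (F x - F 0) (F 0)
    rw [sub_add_cancel] at this
    linarith
  have h3 : t * F x ≤ |t| * |F 0| + |t| * C * ‖x‖ := by
    calc t * F x ≤ |t| * |F x| := by rw [← abs_mul]; exact le_abs_self _
      _ ≤ |t| * (|F 0| + C * ‖x‖) := by gcongr
      _ = _ := by ring
  have h4 : |t| * C * ‖x‖ ≤ (|t| * C) ^ 2 / (4 * c) + c * ‖x‖ ^ 2 := by
    have h5 : 0 ≤ (|t| * C / (2 * √c) - √c * ‖x‖) ^ 2 := sq_nonneg _
    have h6 : √c ^ 2 = c := Real.sq_sqrt hc.le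
    have h7 : (0 : ℝ) < √c := Real.sqrt_pos.2 hc
    have h8 : (|t| * C / (2 * √c) - √c * ‖x‖) ^ 2
        = (|t| * C) ^ 2 / (4 * c) - |t| * C * ‖x‖ + c * ‖x‖ ^ 2 := by
      conv_rhs => rw [← h6]
      field_simp
      ring
    linarith
  linarith

/-- The path `θ ↦ cos θ x + sin θ y` joins `x` to `y`; Jensen's inequality over the path. -/
lemma exp_sub_le_average_rotation (hF : ContDiff ℝ 1 F) (t : ℝ) (q : E × E) :
    ENNReal.ofReal (Real.exp (t * (F q.2 - F q.1))) ≤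
      ∫⁻ θ in Set.Ioc 0 (Real.pi / 2), ENNReal.ofReal (2 / Real.pi) * ENNReal.ofReal
        (Real.exp (t * (Real.pi / 2) * fderiv ℝ F (ContinuousLinearMap.rotation θ q).1
          (ContinuousLinearMap.rotation θ q).2)) := by
  have hpi := Real.pi_pos
  obtain ⟨x, y⟩ := q
  set g : ℝ → ℝ := fun θ => fderiv ℝ F (ContinuousLinearMap.rotation θ (x, y)).1
          (ContinuousLinearMap.rotation θ (x, y)).2 with hg
  have hcd := hF.continuous_fderiv one_ne_zero
  have hgc : Continuous g := by
    simp only [hg, ContinuousLinearMap.rotation_apply]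
    exact (hcd.comp (by fun_prop)).clm_apply (by fun_prop)
  have hderiv : ∀ θ : ℝ, HasDerivAt (fun θ : ℝ => F (Real.cos θ • x + Real.sin θ • y)) (g θ) θ := by
    intro θ
    have h1 : HasDerivAt (fun θ : ℝ => Real.cos θ • x + Real.sin θ • y)
        (-Real.sin θ • x + Real.cos θ • y) θ :=
      ((Real.hasDerivAt_cos θ).smul_const x).add ((Real.hasDerivAt_sin θ).smul_const y)
    exact ((hF.differentiable one_ne_zero).differentiableAt.hasFDerivAt).comp_hasDerivAt θ h1
  have hint : ∫ θ in (0 : ℝ)..(Real.pi / 2), g θ = F y - F x := by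
    rw [intervalIntegral.integral_eq_sub_of_hasDerivAt (fun θ _ => hderiv θ)
      (hgc.intervalIntegrable _ _)]
    simp
  have hIoc : volume.real (Set.Ioc 0 (Real.pi / 2)) = Real.pi / 2 := by
    rw [Real.volume_real_Ioc_of_le (by positivity), sub_zero]
  have hne : volume (Set.Ioc 0 (Real.pi / 2)) ≠ 0 := by
    rw [Real.volume_Ioc]; simp [hpi]
  have hfin : volume (Set.Ioc 0 (Real.pi / 2)) ≠ ∞ := by
    rw [Real.volume_Ioc]; simp
  have hi1 : IntegrableOn (fun θ => t * (Real.pi / 2) * g θ) (Set.Ioc 0 (Real.pi / 2)) :=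
    ((Continuous.integrableOn_Icc (by fun_prop)).mono_set Set.Ioc_subset_Icc_self)
  have hi2 : IntegrableOn (fun θ => Real.exp (t * (Real.pi / 2) * g θ)) (Set.Ioc 0 (Real.pi / 2)) :=
    ((Continuous.integrableOn_Icc (by fun_prop)).mono_set Set.Ioc_subset_Icc_self)
  have hJ := convexOn_exp.set_average_mem_epigraph Real.continuous_exp.continuousOn isClosed_univ
    hne hfin (ae_of_all _ fun _ => trivial) hi1 hi2
  have hJ2 := hJ.2
  simp only [setAverage_eq, hIoc, smul_eq_mul] at hJ2
  rw [integral_const_mul, ← intervalIntegral.integral_of_le (by positivity), hint] at hJ2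
  rw [show (Real.pi / 2)⁻¹ * (t * (Real.pi / 2) * (F y - F x)) = t * (F y - F x) by
    field_simp] at hJ2
  rw [lintegral_const_mul _ (by fun_prop), ← ofReal_integral_eq_lintegral_ofReal hi2
    (ae_of_all _ fun _ => (Real.exp_pos _).le), ← ENNReal.ofReal_mul (by positivity)]
  refine ENNReal.ofReal_le_ofReal (hJ2.trans_eq ?_)
  simp

/-- Exponential moment of the difference of two independent copies. -/
lemma lintegral_exp_sub_le_of_isGaussian [CompleteSpace E] (h0 : ν[id] = 0)
    (hF : ContDiff ℝ 1 F) {V : ℝ}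
    (hV : ∀ x, Var[fderiv ℝ F x; ν] ≤ V) (t : ℝ) :
    ∫⁻ q, ENNReal.ofReal (Real.exp (t * (F q.2 - F q.1))) ∂(ν.prod ν) ≤
      ENNReal.ofReal (Real.exp (Real.pi ^ 2 / 4 * V * t ^ 2 / 2)) := by
  have hpi := Real.pi_pos
  set Φ : E × E → ℝ≥0∞ := fun q => ENNReal.ofReal
    (Real.exp (t * (Real.pi / 2) * fderiv ℝ F q.1 q.2)) with hΦ
  have hcd := hF.continuous_fderiv one_ne_zero
  have hΦm : Measurable Φ := by
    have : Continuous fun q : E × E => fderiv ℝ F q.1 q.2 :=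
      (hcd.comp continuous_fst).clm_apply continuous_snd
    exact (ENNReal.continuous_ofReal.comp (by fun_prop)).measurable
  have hjoint : Measurable fun r : (E × E) × ℝ =>
      Φ (ContinuousLinearMap.rotation r.2 r.1) := by
    refine hΦm.comp (Continuous.measurable ?_)
    simp only [ContinuousLinearMap.rotation_apply]
    fun_prop
  have hΦint : ∫⁻ q, Φ q ∂(ν.prod ν) ≤
      ENNReal.ofReal (Real.exp (Real.pi ^ 2 / 4 * V * t ^ 2 / 2)) := by
    rw [lintegral_prod _ hΦm.aemeasurable]
    calc ∫⁻ x, ∫⁻ y, Φ (x, y) ∂ν ∂ν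
        ≤ ∫⁻ _, ENNReal.ofReal (Real.exp (Real.pi ^ 2 / 4 * V * t ^ 2 / 2)) ∂ν := by
          refine lintegral_mono fun x => ?_
          simp only [hΦ]
          rw [lintegral_exp_dual_of_isGaussian h0]
          refine ENNReal.ofReal_le_ofReal (Real.exp_le_exp.2 ?_)
          calc Var[fderiv ℝ F x; ν] * (t * (Real.pi / 2)) ^ 2 / 2
              ≤ V * (t * (Real.pi / 2)) ^ 2 / 2 := by gcongr; exact hV x
            _ = _ := by ring
      _ = _ := by simp
  calc ∫⁻ q, ENNReal.ofReal (Real.exp (t * (F q.2 - F q.1))) ∂(ν.prod ν)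
      ≤ ∫⁻ q, (∫⁻ θ in Set.Ioc 0 (Real.pi / 2), ENNReal.ofReal (2 / Real.pi) *
          Φ (ContinuousLinearMap.rotation θ q)) ∂(ν.prod ν) :=
        lintegral_mono fun q => exp_sub_le_average_rotation hF t q
    _ = ∫⁻ θ in Set.Ioc 0 (Real.pi / 2), ∫⁻ q, ENNReal.ofReal (2 / Real.pi) *
          Φ (ContinuousLinearMap.rotation θ q) ∂(ν.prod ν) :=
        lintegral_lintegral_swap (hjoint.const_mul _).aemeasurable
    -- the pair of independent copies is invariant under rotations
    _ = ∫⁻ _ in Set.Ioc 0 (Real.pi / 2), ENNReal.ofReal (2 / Real.pi) *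
          ∫⁻ q, Φ q ∂(ν.prod ν) := by
        refine lintegral_congr fun θ => ?_
        have hΦθ : Measurable fun q => Φ (ContinuousLinearMap.rotation θ q) :=
          hΦm.comp (ContinuousLinearMap.measurable _)
        rw [lintegral_const_mul _ hΦθ]
        congr 1
        conv_rhs => rw [← IsGaussian.map_rotation_eq_self h0 θ]
        rw [lintegral_map hΦm (ContinuousLinearMap.measurable _)]
    _ = ∫⁻ q, Φ q ∂(ν.prod ν) := by
        rw [setLIntegral_const, Real.volume_Ioc, mul_right_comm,
          ← ENNReal.ofReal_mul (by positivity),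
          show 2 / Real.pi * (Real.pi / 2 - 0) = 1 by field_simp; ring]
        simp
    _ ≤ _ := hΦint

/-- The Maurey–Pisier concentration inequality: a `C¹` Lipschitz function of a centred Gaussian
vector, whose differential at each point has variance at most `V`, is sub-Gaussian. -/
theorem hasSubgaussianMGF_of_variance_fderiv_le [CompleteSpace E] (h0 : ν[id] = 0)
    (hF : ContDiff ℝ 1 F)
    {C : ℝ} (hC : ∀ x, ‖fderiv ℝ F x‖ ≤ C) {V : NNReal} (hV : ∀ x, Var[fderiv ℝ F x; ν] ≤ V) :
    HasSubgaussianMGF (fun x => F x - ∫ y, F y ∂ν) (Real.toNNReal (Real.pi ^ 2 / 4) * V) ν := by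
  have hexp := fun t => integrable_exp_of_norm_fderiv_le (ν := ν) hF hC t
  set m := ∫ y, F y ∂ν
  have hFi : Integrable F ν :=
    integrable_of_mem_interior_integrableExpSet (by
      rw [show integrableExpSet F ν = Set.univ from Set.eq_univ_of_forall hexp]; simp)
  have hsplit : ∀ t, (fun x => Real.exp (t * (F x - m)))
      = fun x => Real.exp (-(t * m)) * Real.exp (t * F x) := fun t => by
    ext x; rw [← Real.exp_add]; ring_nf
  refine ⟨fun t => by rw [hsplit]; exact (hexp t).const_mul _, fun t => ?_⟩
  rw [mgf, hsplit, integral_const_mul, NNReal.coe_mul, Real.coe_toNNReal _ (by positivity)]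
  have h1 := lintegral_exp_sub_le_of_isGaussian h0 hF hV t
  have hprod : (fun q : E × E => Real.exp (t * (F q.2 - F q.1)))
      = fun q => Real.exp (-t * F q.1) * Real.exp (t * F q.2) := by
    ext q; rw [← Real.exp_add]; ring_nf
  have hint2 : Integrable (fun q : E × E => Real.exp (t * (F q.2 - F q.1))) (ν.prod ν) := by
    rw [hprod]; exact (hexp (-t)).mul_prod (hexp t)
  rw [← ofReal_integral_eq_lintegral_ofReal hint2 (ae_of_all _ fun _ => (Real.exp_pos _).le),
    ENNReal.ofReal_le_ofReal_iff (Real.exp_pos _).le, hprod, integral_prod_mul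
      (fun x => Real.exp (-t * F x)) (fun x => Real.exp (t * F x))] at h1
  -- Jensen's inequality replaces one of the two copies by its mean
  have hJ : Real.exp (-(t * m)) ≤ ∫ x, Real.exp (-t * F x) ∂ν := by
    have := convexOn_exp.map_integral_le Real.continuous_exp.continuousOn isClosed_univ
      (ae_of_all _ fun _ => trivial) (hFi.const_mul (-t)) (hexp (-t))
    rw [integral_const_mul] at this
    simpa using this
  refine le_trans ?_ h1
  exact mul_le_mul_of_nonneg_right hJ (integral_nonneg fun _ => (Real.exp_pos _).le)

end MaureyPisier

/-! ### Maxima of Gaussian vectors -/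

/-- The smooth maximum `β⁻¹ log ∑ exp (β y)` of a finite family of reals. -/
noncomputable def logSumExp {κ : Type*} [Fintype κ] (β : ℝ) (y : κ → ℝ) : ℝ :=
  β⁻¹ * Real.log (∑ z, Real.exp (β * y z))

section LogSumExp

variable {ι κ : Type*} [Fintype ι] [Fintype κ]

lemma sum_exp_pos [Nonempty κ] (y : κ → ℝ) : 0 < ∑ z, Real.exp (y z) :=
  Finset.sum_pos (fun _ _ => Real.exp_pos _) Finset.univ_nonempty

lemma le_logSumExp {β : ℝ} (hβ : 0 < β) (y : κ → ℝ) (z : κ) : y z ≤ logSumExp β y := by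
  rw [logSumExp, le_inv_mul_iff₀ hβ]
  have : Nonempty κ := ⟨z⟩
  rw [Real.le_log_iff_exp_le (sum_exp_pos _)]
  exact Finset.single_le_sum (f := fun z => Real.exp (β * y z)) (fun _ _ => (Real.exp_pos _).le)
    (Finset.mem_univ z)

lemma logSumExp_le [Nonempty κ] {β : ℝ} (hβ : 0 < β) {y : κ → ℝ} {b : ℝ} (hb : ∀ z, y z ≤ b) :
    logSumExp β y ≤ b + Real.log (Fintype.card κ) / β := by
  have hcard : (0 : ℝ) < Fintype.card κ := by exact_mod_cast Fintype.card_pos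
  have h1 : Real.log (∑ z, Real.exp (β * y z)) ≤ Real.log (Fintype.card κ) + β * b := by
    rw [← Real.log_exp (β * b), ← Real.log_mul hcard.ne' (Real.exp_pos _).ne']
    refine Real.log_le_log (sum_exp_pos _) ?_
    calc ∑ z, Real.exp (β * y z) ≤ ∑ _z : κ, Real.exp (β * b) := by
          gcongr with z; exact hb z
      _ = _ := by simp
  calc logSumExp β y ≤ β⁻¹ * (Real.log (Fintype.card κ) + β * b) := by
        unfold logSumExp; gcongr
    _ = _ := by field_simp; ring

/-- The weights of the differential of `logSumExp` form a probability vector. -/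
lemma hasFDerivAt_sum_logSumExp [Nonempty κ] {β : ℝ} (hβ : 0 < β) (p : ι → ℝ) (y : ι × κ → ℝ) :
    HasFDerivAt (fun y : ι × κ → ℝ => ∑ i, p i * logSumExp β (fun z => y (i, z)))
      (∑ j : ι × κ, (p j.1 * (Real.exp (β * y j) / ∑ z, Real.exp (β * y (j.1, z)))) •
        (ContinuousLinearMap.proj j : (ι × κ → ℝ) →L[ℝ] ℝ)) y := by
  have h1 : ∀ j : ι × κ, HasFDerivAt (fun y : ι × κ → ℝ => y j)
      (ContinuousLinearMap.proj j : (ι × κ → ℝ) →L[ℝ] ℝ) y := fun j =>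
    (ContinuousLinearMap.proj (R := ℝ) (φ := fun _ : ι × κ => ℝ) j).hasFDerivAt
  have h2 : ∀ i, HasFDerivAt (fun y : ι × κ → ℝ => logSumExp β (fun z => y (i, z)))
      (β⁻¹ • (∑ z, Real.exp (β * y (i, z)))⁻¹ • ∑ z, Real.exp (β * y (i, z)) • β •
        (ContinuousLinearMap.proj (i, z) : (ι × κ → ℝ) →L[ℝ] ℝ)) y := fun i =>
    ((HasFDerivAt.fun_sum fun z _ => ((h1 (i, z)).const_mul β).exp).log
      (sum_exp_pos _).ne').const_mul β⁻¹
  refine (HasFDerivAt.fun_sum fun i _ => (h2 i).const_mul (p i)).congr_fderiv ?_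
  rw [Fintype.sum_prod_type]
  refine Finset.sum_congr rfl fun i _ => ?_
  rw [Finset.smul_sum, Finset.smul_sum, Finset.smul_sum]
  refine Finset.sum_congr rfl fun z _ => ?_
  simp only [smul_smul]
  congr 1
  field_simp

lemma contDiff_sum_logSumExp [Nonempty κ] (β : ℝ) (p : ι → ℝ) :
    ContDiff ℝ 1 (fun y : ι × κ → ℝ => ∑ i, p i * logSumExp β (fun z => y (i, z))) := by
  refine ContDiff.sum fun i _ => contDiff_const.mul (contDiff_const.mul (ContDiff.log ?_ ?_))
  · fun_prop
  · exact fun y => (sum_exp_pos _).ne'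

end LogSumExp

section

variable {Ω : Type*} [MeasurableSpace Ω] {Q : Measure Ω}

lemma ProbabilityTheory.HasGaussianLaw.hasSubgaussianMGF {X : Ω → ℝ} (hX : HasGaussianLaw X Q)
    (h0 : ∫ ω, X ω ∂Q = 0)
    {V : NNReal} (hV : ∫ ω, X ω ^ 2 ∂Q ≤ V) : HasSubgaussianMGF X V Q := by
  have hmap := hX.map_eq_gaussianReal
  rw [h0] at hmap
  have := hX.isProbabilityMeasure
  have hvar : Var[X; Q] ≤ V := by
    rw [variance_of_integral_eq_zero hX.aemeasurable h0]; exact hV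
  refine ⟨fun t => ?_, fun t => ?_⟩
  · have := integrable_exp_mul_gaussianReal (μ := 0) (v := Var[X; Q].toNNReal) t
    rwa [← hmap, integrable_map_measure (by fun_prop) hX.aemeasurable] at this
  · rw [mgf_gaussianReal hmap, Real.coe_toNNReal _ (variance_nonneg _ _), zero_mul, zero_add]
    gcongr

lemma integral_sq_sum_le {J : Type*} [Fintype J] {Y : J → Ω → ℝ}
    (hY : ∀ j, MemLp (Y j) 2 Q) {a : J → ℝ} (ha : ∀ j, 0 ≤ a j) {b : J → J → ℝ}
    (hb : ∀ j j', ∫ ω, Y j ω * Y j' ω ∂Q ≤ b j j') :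
    ∫ ω, (∑ j, a j * Y j ω) ^ 2 ∂Q ≤ ∑ j, ∑ j', a j * a j' * b j j' := by
  have h1 : ∀ j j', Integrable (fun ω => (a j * Y j ω) * (a j' * Y j' ω)) Q := fun j j' =>
    ((hY j).const_mul (a j)).integrable_mul ((hY j').const_mul (a j'))
  simp_rw [sq, Finset.sum_mul_sum]
  rw [integral_finsetSum _ fun j _ => integrable_finsetSum _ fun j' _ => h1 j j']
  refine Finset.sum_le_sum fun j _ => ?_
  rw [integral_finsetSum _ fun j' _ => h1 j j']
  refine Finset.sum_le_sum fun j' _ => ?_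
  calc ∫ ω, a j * Y j ω * (a j' * Y j' ω) ∂Q = a j * a j' * ∫ ω, Y j ω * Y j' ω ∂Q := by
        rw [← integral_const_mul]; congr 1; ext ω; ring
    _ ≤ _ := mul_le_mul_of_nonneg_left (hb j j') (mul_nonneg (ha j) (ha j'))

/-- Concentration of a weighted sum of smooth maxima of Gaussian vectors: the variance proxy only
involves the covariances of the coordinates. -/
theorem hasSubgaussianMGF_sum_logSumExp {ι κ : Type*} [Fintype ι] [Fintype κ] [Nonempty κ]
    {Y : ι × κ → Ω → ℝ} (hY : HasGaussianLaw (fun ω j => Y j ω) Q)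
    (h0 : ∀ j, ∫ ω, Y j ω ∂Q = 0) {p : ι → ℝ} (hp : ∀ i, 0 ≤ p i) {b : ι → ι → ℝ}
    (hb : ∀ j j', ∫ ω, Y j ω * Y j' ω ∂Q ≤ b j.1 j'.1) {β : ℝ} (hβ : 0 < β) :
    HasSubgaussianMGF (fun ω => ∑ i, p i * logSumExp β (fun z => Y (i, z) ω) -
        ∫ ω', ∑ i, p i * logSumExp β (fun z => Y (i, z) ω') ∂Q)
      (Real.toNNReal (Real.pi ^ 2 / 4) * Real.toNNReal (∑ i, ∑ i', p i * p i' * b i i')) Q := by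
  set F : (ι × κ → ℝ) → ℝ := fun y => ∑ i, p i * logSumExp β (fun z => y (i, z)) with hF
  have hYm := hY.aemeasurable
  have := hY.isGaussian_map
  have hFd : ContDiff ℝ 1 F := contDiff_sum_logSumExp β p
  have hY1 : ∀ j, HasGaussianLaw (Y j) Q := fun j => hY.eval j
  have hid : (Q.map fun ω j => Y j ω)[id] = 0 := by
    rw [integral_map hYm (by fun_prop)]
    ext j
    simp only [id]
    rw [eval_integral (fun j => (hY1 j).integrable)]
    simpa using h0 j
  have hw : ∀ (y : ι × κ → ℝ) (j : ι × κ),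
      0 ≤ Real.exp (β * y j) / ∑ z, Real.exp (β * y (j.1, z)) := fun y j =>
    div_nonneg (Real.exp_pos _).le (sum_exp_pos _).le
  have hw1 : ∀ (y : ι × κ → ℝ) (i : ι),
      ∑ z, Real.exp (β * y (i, z)) / ∑ z, Real.exp (β * y (i, z)) = 1 := fun y i => by
    rw [← Finset.sum_div, div_self (sum_exp_pos _).ne']
  have key := hasSubgaussianMGF_of_variance_fderiv_le (C := ∑ i, p i)
    (V := Real.toNNReal (∑ i, ∑ i', p i * p i' * b i i')) hid hFd ?_ ?_
  · have h2 := HasSubgaussianMGF.of_map hYm key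
    rw [integral_map hYm hFd.continuous.aestronglyMeasurable] at h2
    exact h2
  · intro y
    rw [(hasFDerivAt_sum_logSumExp hβ p y).fderiv]
    refine ContinuousLinearMap.opNorm_le_bound _ (Finset.sum_nonneg fun i _ => hp i) fun v => ?_
    simp only [FunLike.coe_sum, Finset.sum_apply, FunLike.coe_smul,
      Pi.smul_apply, ContinuousLinearMap.proj_apply, smul_eq_mul]
    refine (norm_sum_le _ _).trans ?_
    calc ∑ j : ι × κ, ‖p j.1 * (Real.exp (β * y j) / ∑ z, Real.exp (β * y (j.1, z))) * v j‖
        ≤ ∑ j : ι × κ, p j.1 * (Real.exp (β * y j) / ∑ z, Real.exp (β * y (j.1, z))) * ‖v‖ := by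
          refine Finset.sum_le_sum fun j _ => ?_
          rw [norm_mul, Real.norm_of_nonneg (mul_nonneg (hp _) (hw y j))]
          exact mul_le_mul_of_nonneg_left (norm_le_pi_norm v j) (mul_nonneg (hp _) (hw y j))
      _ = (∑ i, p i) * ‖v‖ := by
          rw [Fintype.sum_prod_type, Finset.sum_mul]
          refine Finset.sum_congr rfl fun i _ => ?_
          simp only
          rw [← Finset.sum_mul, ← Finset.mul_sum, hw1, mul_one]
  · intro y
    rw [(hasFDerivAt_sum_logSumExp hβ p y).fderiv]
    refine le_trans ?_ (Real.le_coe_toNNReal _)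
    set a : ι × κ → ℝ := fun j => p j.1 * (Real.exp (β * y j) / ∑ z, Real.exp (β * y (j.1, z)))
    set L : (ι × κ → ℝ) →L[ℝ] ℝ := ∑ j, a j • ContinuousLinearMap.proj j with hL
    have hLv : ∀ v, L v = ∑ j, a j * v j := fun v => by simp [hL]
    rw [variance_map (by fun_prop) hYm]
    have h3 : (⇑L ∘ fun ω j => Y j ω) = fun ω => ∑ j, a j * Y j ω := by
      ext ω; simp [hLv]
    rw [h3, variance_of_integral_eq_zero]
    · refine (integral_sq_sum_le (fun j => (hY1 j).memLp_two)
        (fun j => mul_nonneg (hp _) (hw y j)) hb).trans_eq ?_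
      rw [Fintype.sum_prod_type]
      refine Finset.sum_congr rfl fun i _ => ?_
      rw [Finset.sum_comm, Fintype.sum_prod_type]
      refine Finset.sum_congr rfl fun i' _ => ?_
      simp only
      calc ∑ z', ∑ z, p i * (Real.exp (β * y (i, z)) / ∑ z, Real.exp (β * y (i, z))) *
            (p i' * (Real.exp (β * y (i', z')) / ∑ z, Real.exp (β * y (i', z)))) * b i i'
          = ∑ z', (Real.exp (β * y (i', z')) / ∑ z, Real.exp (β * y (i', z))) *
            ∑ z, (Real.exp (β * y (i, z)) / ∑ z, Real.exp (β * y (i, z))) *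
              (p i * p i' * b i i') := by
            refine Finset.sum_congr rfl fun z' _ => ?_
            rw [Finset.mul_sum]
            refine Finset.sum_congr rfl fun z _ => by ring
        _ = _ := by
            rw [← Finset.sum_mul, ← Finset.sum_mul, hw1, hw1]; ring
    · have h4 : ∀ j, AEMeasurable (Y j) Q := fun j => (hY1 j).aemeasurable
      fun_prop
    · rw [integral_finsetSum _ fun j _ => ((hY1 j).integrable).const_mul _]
      simp [integral_const_mul, h0]

/-- Maximal inequality for sub-Gaussian random variables. -/
lemma integral_sup'_le {J : Type*} [Fintype J] [Nonempty J] [IsProbabilityMeasure Q]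
    {X : J → Ω → ℝ} {σ : NNReal} (hσ : 0 < σ) (hX : ∀ j, HasSubgaussianMGF (X j) (σ ^ 2) Q) :
    Integrable (fun ω => Finset.univ.sup' Finset.univ_nonempty fun j => X j ω) Q ∧
    ∫ ω, Finset.univ.sup' Finset.univ_nonempty (fun j => X j ω) ∂Q ≤
      σ * (Real.log (Fintype.card J) + 1 / 2) := by
  set M : Ω → ℝ := fun ω => Finset.univ.sup' Finset.univ_nonempty fun j => X j ω with hM
  have hMm : AEStronglyMeasurable M Q := by
    have : AEMeasurable (Finset.univ.sup' Finset.univ_nonempty X) Q :=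
      Finset.sup'_induction Finset.univ_nonempty X (p := fun f => AEMeasurable f Q)
        (fun _ hf _ hg => hf.sup hg) fun j _ => (hX j).aemeasurable
    refine (this.congr (ae_of_all _ fun ω => ?_)).aestronglyMeasurable
    simp [hM, Finset.sup'_apply]
  have hMi : Integrable M Q := by
    refine (integrable_finsetSum Finset.univ fun j _ => (hX j).integrable.norm).mono' hMm
      (ae_of_all _ fun ω => ?_)
    obtain ⟨j, _, hj⟩ := Finset.exists_mem_eq_sup' Finset.univ_nonempty fun j => X j ω
    simp only [hM, hj]
    exact Finset.single_le_sum (f := fun j => ‖X j ω‖) (fun _ _ => norm_nonneg _)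
      (Finset.mem_univ j)
  refine ⟨hMi, ?_⟩
  have hσ' : (0 : ℝ) < σ := hσ
  -- the exponential moment method at the parameter `1 / σ`
  set t : ℝ := (σ : ℝ)⁻¹ with ht
  have ht0 : 0 < t := inv_pos.2 hσ'
  have hle : ∀ ω, Real.exp (t * M ω) ≤ ∑ j, Real.exp (t * X j ω) := fun ω => by
    obtain ⟨j, _, hj⟩ := Finset.exists_mem_eq_sup' Finset.univ_nonempty fun j => X j ω
    simp only [hM, hj]
    exact Finset.single_le_sum (f := fun j => Real.exp (t * X j ω))
      (fun _ _ => (Real.exp_pos _).le) (Finset.mem_univ j)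
  have hsum : Integrable (fun ω => ∑ j, Real.exp (t * X j ω)) Q :=
    integrable_finsetSum _ fun j _ => (hX j).integrable_exp_mul t
  have hexp : Integrable (fun ω => Real.exp (t * M ω)) Q :=
    hsum.mono' (Real.continuous_exp.comp_aestronglyMeasurable (hMm.const_mul t))
      (ae_of_all _ fun ω => by
        rw [Real.norm_of_nonneg (Real.exp_pos _).le]; exact hle ω)
  have hJ : Real.exp (t * ∫ ω, M ω ∂Q) ≤ ∫ ω, Real.exp (t * M ω) ∂Q := by
    have := convexOn_exp.map_integral_le Real.continuous_exp.continuousOn isClosed_univ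
      (ae_of_all _ fun _ => trivial) (hMi.const_mul t) hexp
    rwa [integral_const_mul] at this
  have hcard : (0 : ℝ) < Fintype.card J := by exact_mod_cast Fintype.card_pos
  have hb : Real.exp (t * ∫ ω, M ω ∂Q) ≤ Real.exp (Real.log (Fintype.card J) + 1 / 2) := by
    calc Real.exp (t * ∫ ω, M ω ∂Q) ≤ ∫ ω, ∑ j, Real.exp (t * X j ω) ∂Q :=
          hJ.trans (integral_mono hexp hsum hle)
      _ = ∑ j, mgf (X j) Q t := by
          rw [integral_finsetSum _ fun j _ => (hX j).integrable_exp_mul t]; rfl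
      _ ≤ ∑ _j : J, Real.exp (1 / 2) := by
          refine Finset.sum_le_sum fun j _ => ((hX j).mgf_le t).trans_eq ?_
          congr 1
          rw [ht]; push_cast; field_simp
      _ = _ := by rw [Real.exp_add, Real.exp_log hcard]; simp
  rw [Real.exp_le_exp, ht, inv_mul_le_iff₀ hσ'] at hb
  exact hb

end

/-! ### Increments of an isotropic field -/

section

variable {Ω : Type*} [MeasurableSpace Ω] {Q : Measure Ω}

lemma ProbabilityTheory.HasGaussianLaw.integral_cos {X : Ω → ℝ} (hX : HasGaussianLaw X Q)
    (h0 : ∫ ω, X ω ∂Q = 0) (t : ℝ) :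
    ∫ ω, Real.cos (t * X ω) ∂Q = Real.exp (-(t ^ 2 * ∫ ω, X ω ^ 2 ∂Q) / 2) := by
  have := hX.isProbabilityMeasure
  have hmap := hX.map_eq_gaussianReal
  have h1 := charFun_gaussianReal (μ := 0) (v := Var[X; Q].toNNReal) t
  rw [h0] at hmap
  rw [← hmap, charFun_apply_real, integral_map hX.aemeasurable (by fun_prop)] at h1
  have hint : Integrable (fun ω => Complex.exp (t * X ω * Complex.I)) Q := by
    refine Integrable.mono' (integrable_const (1 : ℝ)) ?_ (ae_of_all _ fun ω => ?_)
    · have := hX.aemeasurable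
      exact (by fun_prop : AEMeasurable _ Q).aestronglyMeasurable
    · rw [← Complex.ofReal_mul, Complex.norm_exp_ofReal_mul_I]
  have h2 := congrArg Complex.re h1
  have h3 : ∀ ω, Real.cos (t * X ω) = RCLike.re (Complex.exp (t * X ω * Complex.I)) := fun ω => by
    rw [← Complex.ofReal_mul]; exact (Complex.exp_ofReal_mul_I_re _).symm
  simp_rw [h3]
  rw [integral_re hint]
  refine h2.trans ?_
  rw [Real.coe_toNNReal _ (variance_nonneg _ _), variance_of_integral_eq_zero hX.aemeasurable h0]
  rw [show ((t : ℂ) * ((0 : ℝ) : ℂ) * Complex.I - ((∫ ω, X ω ^ 2 ∂Q : ℝ) : ℂ) * (t : ℂ) ^ 2 / 2)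
    = ((-(t ^ 2 * ∫ ω, X ω ^ 2 ∂Q) / 2 : ℝ) : ℂ) by push_cast; ring]
  exact Complex.exp_ofReal_re _

/-- Variances of centred Gaussian variables are upper semicontinuous along almost sure limits.
The variances are read off from the characteristic functions. -/
lemma le_integral_sq_of_tendsto {Z : ℕ → Ω → ℝ} {Y : Ω → ℝ} (hZ : ∀ n, HasGaussianLaw (Z n) Q)
    (h0 : ∀ n, ∫ ω, Z n ω ∂Q = 0) (hlim : ∀ᵐ ω ∂Q, Tendsto (fun n => Z n ω) atTop (𝓝 (Y ω)))
    {c : ℝ} (hc : ∀ n, c ≤ ∫ ω, Z n ω ^ 2 ∂Q) : c ≤ ∫ ω, Y ω ^ 2 ∂Q := by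
  have := (hZ 0).isProbabilityMeasure
  have hYm : AEMeasurable Y Q :=
    aemeasurable_of_tendsto_metrizable_ae' (fun n => (hZ n).aemeasurable) hlim
  have hcos : ∀ t : ℝ, Tendsto (fun n => ∫ ω, Real.cos (t * Z n ω) ∂Q) atTop
      (𝓝 (∫ ω, Real.cos (t * Y ω) ∂Q)) := fun t => by
    refine tendsto_integral_of_dominated_convergence (fun _ => 1) (fun n => ?_)
      (integrable_const _) (fun n => ae_of_all _ fun ω => Real.abs_cos_le_one _) ?_
    · have := (hZ n).aemeasurable
      exact (by fun_prop : AEMeasurable _ Q).aestronglyMeasurable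
    · filter_upwards [hlim] with ω hω
      exact (Real.continuous_cos.tendsto _).comp (hω.const_mul t)
  simp_rw [fun n => (hZ n).integral_cos (h0 n)] at hcos
  -- near `t = 0` the limit characteristic function is positive, so the variances are bounded
  have hcos0 : Tendsto (fun m : ℕ => ∫ ω, Real.cos ((1 / (m + 1 : ℝ)) * Y ω) ∂Q) atTop (𝓝 1) := by
    have : Tendsto (fun m : ℕ => ∫ ω, Real.cos ((1 / (m + 1 : ℝ)) * Y ω) ∂Q) atTop
        (𝓝 (∫ _ω, (1 : ℝ) ∂Q)) := by
      refine tendsto_integral_of_dominated_convergence (fun _ => 1) (fun n => ?_)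
        (integrable_const _) (fun n => ae_of_all _ fun ω => Real.abs_cos_le_one _)
        (ae_of_all _ fun ω => ?_)
      · exact (by fun_prop : AEMeasurable _ Q).aestronglyMeasurable
      · have h1 := (tendsto_one_div_add_atTop_nhds_zero_nat (𝕜 := ℝ)).mul_const (Y ω)
        rw [zero_mul] at h1
        have h2 := (Real.continuous_cos.tendsto _).comp h1
        simpa [Function.comp_def] using h2
    simpa using this
  obtain ⟨m, hm⟩ := (hcos0.eventually (lt_mem_nhds (show (1 / 2 : ℝ) < 1 by norm_num))).exists
  set t₀ : ℝ := 1 / (m + 1 : ℝ) with ht₀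
  have ht₀pos : 0 < t₀ := by positivity
  have hbdd : ∀ᶠ n in atTop, ∫ ω, Z n ω ^ 2 ∂Q ≤ 2 * Real.log 2 / t₀ ^ 2 := by
    filter_upwards [(hcos t₀).eventually (lt_mem_nhds hm)] with n hn
    rw [show (1 / 2 : ℝ) = Real.exp (-Real.log 2) by
      rw [Real.exp_neg, Real.exp_log two_pos]; norm_num, Real.exp_lt_exp] at hn
    rw [le_div_iff₀ (by positivity)]
    linarith
  have hYint : Integrable (fun ω => Y ω ^ 2) Q := by
    refine ⟨(hYm.pow_const 2).aestronglyMeasurable, ?_⟩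
    rw [hasFiniteIntegral_iff_ofReal (ae_of_all _ fun ω => sq_nonneg _)]
    calc ∫⁻ ω, ENNReal.ofReal (Y ω ^ 2) ∂Q
        ≤ ∫⁻ ω, liminf (fun n => ENNReal.ofReal (Z n ω ^ 2)) atTop ∂Q := by
          refine lintegral_mono_ae ?_
          filter_upwards [hlim] with ω hω
          exact (((ENNReal.continuous_ofReal.tendsto _).comp (hω.pow 2)).liminf_eq).ge
      _ ≤ liminf (fun n => ∫⁻ ω, ENNReal.ofReal (Z n ω ^ 2) ∂Q) atTop :=
          lintegral_liminf_le' fun n => ((hZ n).aemeasurable.pow_const 2).ennreal_ofReal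
      _ ≤ ENNReal.ofReal (2 * Real.log 2 / t₀ ^ 2) := by
          refine liminf_le_of_frequently_le' (Eventually.frequently ?_)
          filter_upwards [hbdd] with n hn
          rw [← ofReal_integral_eq_lintegral_ofReal ((hZ n).memLp_two.integrable_sq)
            (ae_of_all _ fun ω => sq_nonneg _)]
          exact ENNReal.ofReal_le_ofReal hn
      _ < ∞ := ENNReal.ofReal_lt_top
  set V := ∫ ω, Y ω ^ 2 ∂Q with hV
  have hle : ∀ t : ℝ, 1 - t ^ 2 / 2 * V ≤ Real.exp (-(t ^ 2 * c) / 2) := by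
    intro t
    have h1 : ∫ ω, Real.cos (t * Y ω) ∂Q ≤ Real.exp (-(t ^ 2 * c) / 2) :=
      le_of_tendsto' (hcos t) fun n => by
        have := hc n
        gcongr
    refine le_trans ?_ h1
    have h2 : ∫ ω, (1 - t ^ 2 / 2 * Y ω ^ 2) ∂Q = 1 - t ^ 2 / 2 * V := by
      rw [integral_sub (integrable_const _) (hYint.const_mul _), integral_const_mul]
      simp [hV]
    rw [← h2]
    refine integral_mono ((integrable_const _).sub (hYint.const_mul _)) ?_ fun ω => ?_
    · refine Integrable.mono' (integrable_const (1 : ℝ))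
        (by fun_prop : AEMeasurable _ Q).aestronglyMeasurable
        (ae_of_all _ fun ω => Real.abs_cos_le_one _)
    · have := Real.one_sub_sq_div_two_le_cos (x := t * Y ω)
      simp only
      nlinarith
  by_contra hcV
  push Not at hcV
  have hV0 : 0 ≤ V := integral_nonneg fun ω => sq_nonneg _
  have hc0 : 0 < c := hV0.trans_lt hcV
  have hden : 0 < V * c + 1 := by positivity
  set t := √((c - V) / (V * c + 1)) with ht
  have ht2 : t ^ 2 = (c - V) / (V * c + 1) := Real.sq_sqrt (div_nonneg (by linarith) hden.le)
  have ht2pos : 0 < t ^ 2 := by rw [ht2]; exact div_pos (by linarith) hden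
  -- `exp (-x) ≤ 1 / (1 + x)` turns the bound into `(1 - t²V/2)(1 + t²c/2) ≤ 1`
  have h5 : Real.exp (-(t ^ 2 * c) / 2) * (1 + t ^ 2 * c / 2) ≤ 1 := by
    have h6 := Real.add_one_le_exp (t ^ 2 * c / 2)
    calc Real.exp (-(t ^ 2 * c) / 2) * (1 + t ^ 2 * c / 2)
        ≤ Real.exp (-(t ^ 2 * c) / 2) * Real.exp (t ^ 2 * c / 2) := by gcongr; linarith
      _ = 1 := by rw [← Real.exp_add]; simp [neg_div]
  have h6 : (1 - t ^ 2 / 2 * V) * (1 + t ^ 2 * c / 2) ≤ 1 :=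
    (mul_le_mul_of_nonneg_right (hle t) (by positivity)).trans h5
  have h7 : t ^ 2 * (c - V - t ^ 2 / 2 * V * c) ≤ 0 := by nlinarith
  have h8 : c - V - t ^ 2 / 2 * V * c ≤ 0 := by
    by_contra h9
    push Not at h9
    nlinarith [mul_pos ht2pos h9]
  have h10 : t ^ 2 * (V * c + 1) = c - V := by rw [ht2]; field_simp
  nlinarith

section IsotropicField

variable {d : ℕ} {X : EuclideanSpace ℝ (Fin d) → Ω → ℝ} {r : ℝ → ℝ}

lemma IsIsotropicGaussianField.memLp (hX : IsIsotropicGaussianField X Q r)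
    (x : EuclideanSpace ℝ (Fin d)) : MemLp (X x) 2 Q :=
  (hX.gaussian.hasGaussianLaw_eval x).memLp_two

lemma IsIsotropicGaussianField.integral_sq (hX : IsIsotropicGaussianField X Q r)
    (x : EuclideanSpace ℝ (Fin d)) : ∫ ω, X x ω ^ 2 ∂Q = r 0 := by
  simp_rw [sq, hX.covariance, sub_self, norm_zero]

lemma IsIsotropicGaussianField.integral_sub_mul_sub (hX : IsIsotropicGaussianField X Q r)
    (x y z w : EuclideanSpace ℝ (Fin d)) : ∫ ω, (X x ω - X y ω) * (X z ω - X w ω) ∂Q =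
      r ‖x - z‖ - r ‖x - w‖ - r ‖y - z‖ + r ‖y - w‖ := by
  have h : ∀ a b, Integrable (fun ω => X a ω * X b ω) Q := fun a b =>
    (hX.memLp a).integrable_mul (hX.memLp b)
  calc ∫ ω, (X x ω - X y ω) * (X z ω - X w ω) ∂Q
      = ∫ ω, (X x ω * X z ω - X x ω * X w ω - X y ω * X z ω + X y ω * X w ω) ∂Q := by
        congr 1; ext ω; ring
    _ = _ := by
        have h1 := (h x z).sub (h x w)
        have h2 := h1.sub (h y z)
        simp only [Pi.sub_def] at h1 h2
        rw [integral_add h2 (h y w), integral_sub h1 (h y z), integral_sub (h x z) (h x w)]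
        simp_rw [hX.covariance]

lemma IsIsotropicGaussianField.integral_sub_sq (hX : IsIsotropicGaussianField X Q r)
    (x y : EuclideanSpace ℝ (Fin d)) :
    ∫ ω, (X x ω - X y ω) ^ 2 ∂Q = 2 * (r 0 - r ‖x - y‖) := by
  simp_rw [sq, hX.integral_sub_mul_sub, sub_self, norm_zero, norm_sub_rev y x]
  ring

lemma IsIsotropicGaussianField.integral_sub_eq_zero (hX : IsIsotropicGaussianField X Q r)
    (x y : EuclideanSpace ℝ (Fin d)) : ∫ ω, (X x ω - X y ω) ∂Q = 0 := by
  have := hX.gaussian.isProbabilityMeasure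
  rw [integral_sub ((hX.memLp x).integrable one_le_two) ((hX.memLp y).integrable one_le_two),
    hX.centred, hX.centred, sub_zero]

/-- The mean square increment over a segment is at most the mean square of the directional
derivative times the squared length. -/
lemma IsIsotropicGaussianField.increment_le (hd : 1 ≤ d) (hX : IsIsotropicGaussianField X Q r)
    (hC1 : IsC1Field X Q) (x y : EuclideanSpace ℝ (Fin d)) :
    2 * (r 0 - r ‖x - y‖) ≤ maxPartialVar X Q * ‖x - y‖ ^ 2 := by
  have := hX.gaussian.isProbabilityMeasure
  set e : EuclideanSpace ℝ (Fin d) := EuclideanSpace.single ⟨0, hd⟩ 1 with he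
  have hnorm : ‖e‖ = 1 := by simp [he]
  set h := ‖x - y‖ with hh
  rcases (norm_nonneg (x - y)).eq_or_lt with h0 | h0
  · rw [hh, ← h0]; simp
  have hray : ∀ a b : ℝ, ‖a • e - b • e‖ = |a - b| := fun a b => by
    rw [← sub_smul, norm_smul, hnorm, mul_one, Real.norm_eq_abs]
  -- difference quotients along the mesh `h / (n + 1)`
  set t : ℕ → ℝ := fun n => h / (n + 1) with ht
  have htpos : ∀ n, 0 < t n := fun n => by positivity
  have htlim : Tendsto t atTop (𝓝 0) := by
    have := (tendsto_one_div_add_atTop_nhds_zero_nat (𝕜 := ℝ)).const_mul h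
    simpa [ht, div_eq_mul_inv] using this
  -- the increment over `h` is a sum of `n + 1` increments over `t n`; Cauchy–Schwarz
  have hsub : ∀ n, 2 * (r 0 - r h) / h ^ 2 ≤ 2 * (r 0 - r (t n)) / (t n) ^ 2 := by
    intro n
    have h1 : ∀ ω, (X ((h : ℝ) • e) ω - X 0 ω) ^ 2 ≤
        (n + 1 : ℝ) * ∑ j ∈ Finset.range (n + 1),
          (X (((j + 1 : ℕ) * t n) • e) ω - X ((j * t n) • e) ω) ^ 2 := by
      intro ω
      have h2 := Finset.sum_range_sub (fun j : ℕ => X ((j * t n) • e) ω) (n + 1)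
      have h3 : ((n + 1 : ℕ) : ℝ) * t n = h := by
        simp only [ht]; push_cast; field_simp
      simp only [h3, Nat.cast_zero, zero_mul, zero_smul] at h2
      rw [← h2]
      have := sq_sum_le_card_mul_sum_sq (s := Finset.range (n + 1))
        (f := fun j : ℕ => X (((j + 1 : ℕ) * t n) • e) ω - X ((j * t n) • e) ω)
      simpa using this
    have hint : ∀ a b, Integrable (fun ω => (X a ω - X b ω) ^ 2) Q := fun a b =>
      ((hX.memLp a).sub (hX.memLp b)).integrable_sq
    have h4 := integral_mono (hint _ _)
      ((integrable_finsetSum _ fun j _ => hint _ _).const_mul _) h1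
    rw [hX.integral_sub_sq, integral_const_mul, integral_finsetSum _ fun j _ => hint _ _] at h4
    simp_rw [hX.integral_sub_sq, hray] at h4
    have h5 : ∀ j : ℕ, |((j + 1 : ℕ) : ℝ) * t n - j * t n| = t n := fun j => by
      rw [← sub_mul]; push_cast; rw [add_sub_cancel_left, one_mul, abs_of_pos (htpos n)]
    simp_rw [h5] at h4
    rw [sub_zero, norm_smul, hnorm, mul_one, Real.norm_of_nonneg h0.le] at h4
    simp only [Finset.sum_const, Finset.card_range, nsmul_eq_mul] at h4
    rw [div_le_div_iff₀ (by positivity) (by have := htpos n; positivity)]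
    have h6 : h = (n + 1) * t n := by simp only [ht]; field_simp
    have h7 : h ^ 2 = (n + 1) ^ 2 * t n ^ 2 := by rw [← mul_pow, ← h6]
    rw [h7]
    push_cast at h4
    have h8 := mul_le_mul_of_nonneg_right h4 (sq_nonneg (t n))
    linarith
  set Z : ℕ → Ω → ℝ := fun n ω => (t n)⁻¹ * (X (t n • e) ω - X 0 ω) with hZ
  have hZg : ∀ n, HasGaussianLaw (Z n) Q := fun n =>
    (hX.gaussian.hasGaussianLaw_fun_sub (s := t n • e) (t := 0)).fun_smul (t n)⁻¹
  have key := le_integral_sq_of_tendsto (Q := Q) (Z := Z)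
    (Y := fun ω => fderiv ℝ (fun x => X x ω) 0 e) (c := 2 * (r 0 - r h) / h ^ 2) hZg
    (fun n => by simp only [hZ]; rw [integral_const_mul, hX.integral_sub_eq_zero, mul_zero]) ?_
    fun n => by
      refine (hsub n).trans_eq ?_
      simp only [hZ, mul_pow]
      rw [integral_const_mul, hX.integral_sub_sq, sub_zero, norm_smul, hnorm, mul_one,
        Real.norm_of_nonneg (htpos n).le]
      field_simp
  · have h2 : ∫ ω, (fderiv ℝ (fun x => X x ω) 0 e) ^ 2 ∂Q ≤ maxPartialVar X Q :=
      le_ciSup (f := fun i : Fin d =>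
        ∫ ω, (fderiv ℝ (fun x => X x ω) 0 (EuclideanSpace.single i 1)) ^ 2 ∂Q)
        (Set.finite_range _).bddAbove ⟨0, hd⟩
    have h3 := key.trans h2
    rwa [div_le_iff₀ (by positivity)] at h3
  · filter_upwards [hC1] with ω hω
    have h1 : HasFDerivAt (fun x => X x ω) (fderiv ℝ (fun x => X x ω) 0) 0 :=
      (hω.differentiable one_ne_zero).differentiableAt.hasFDerivAt
    have h2 := (h1.lim_real e).comp (tendsto_inv_nhdsGT_zero.comp (tendsto_nhdsWithin_iff.2
        ⟨htlim, Eventually.of_forall htpos⟩))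
    simpa [hZ, Function.comp_def] using h2

end IsotropicField

end

/-! ### Chaining on a cube -/

section Cube

variable {d : ℕ}

/-- The dyadic point of index `z` and level `m` in the cube with lower corner `a` and side `ρ`. -/
noncomputable def cubePoint (a : EuclideanSpace ℝ (Fin d)) (ρ : ℝ) (m : ℕ)
    (z : Fin d → Fin (2 ^ m)) : EuclideanSpace ℝ (Fin d) :=
  a + WithLp.toLp 2 fun i => ρ * ((z i : ℕ) / 2 ^ m : ℝ)

/-- The index at level `m` of the dyadic cube containing a point of level `m + 1`. -/
def cubeParent {m : ℕ} (z : Fin d → Fin (2 ^ (m + 1))) : Fin d → Fin (2 ^ m) := fun i =>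
  ⟨z i / 2, by
    have h := (z i).2
    have h2 : 2 ^ (m + 1) = 2 ^ m * 2 := pow_succ 2 m
    omega⟩

lemma EuclideanSpace.norm_le_sqrt_mul {v : EuclideanSpace ℝ (Fin d)} {B : ℝ} (hB : 0 ≤ B)
    (h : ∀ i, |v i| ≤ B) : ‖v‖ ≤ √d * B := by
  rw [EuclideanSpace.norm_eq, ← Real.sqrt_sq hB, ← Real.sqrt_mul (Nat.cast_nonneg d)]
  refine Real.sqrt_le_sqrt ?_
  calc ∑ i, ‖v i‖ ^ 2 ≤ ∑ _i : Fin d, B ^ 2 := by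
        gcongr with i; rw [Real.norm_eq_abs]; exact h i
    _ = d * B ^ 2 := by simp

lemma cubePoint_zero (a : EuclideanSpace ℝ (Fin d)) (ρ : ℝ) (z : Fin d → Fin (2 ^ 0)) :
    cubePoint a ρ 0 z = a := by
  ext i
  simp [cubePoint]

lemma norm_cubePoint_sub_le (a : EuclideanSpace ℝ (Fin d)) {ρ : ℝ} (hρ : 0 ≤ ρ) (m : ℕ)
    (z : Fin d → Fin (2 ^ m)) : ‖cubePoint a ρ m z - a‖ ≤ √d * ρ := by
  refine EuclideanSpace.norm_le_sqrt_mul hρ fun i => ?_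
  have h1 : ((z i : ℕ) : ℝ) ≤ 2 ^ m := by exact_mod_cast (z i).2.le
  have h2 : ((z i : ℕ) / 2 ^ m : ℝ) ≤ 1 := by rwa [div_le_one (by positivity)]
  simp only [cubePoint, add_sub_cancel_left]
  rw [abs_of_nonneg (by positivity)]
  exact mul_le_of_le_one_right hρ h2

lemma norm_cubePoint_sub_cubeParent_le (a : EuclideanSpace ℝ (Fin d)) {ρ : ℝ} (hρ : 0 ≤ ρ) (m : ℕ)
    (z : Fin d → Fin (2 ^ (m + 1))) :
    ‖cubePoint a ρ (m + 1) z - cubePoint a ρ m (cubeParent z)‖ ≤ √d * (ρ / 2 ^ (m + 1)) := by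
  refine EuclideanSpace.norm_le_sqrt_mul (by positivity) fun i => ?_
  have h1 : (z i : ℕ) = 2 * ((z i : ℕ) / 2) + (z i : ℕ) % 2 := (Nat.div_add_mod _ _).symm
  have h2 : (((z i : ℕ) % 2 : ℕ) : ℝ) ≤ 1 := by
    have : (z i : ℕ) % 2 ≤ 1 := by omega
    exact_mod_cast this
  have h3 : ((z i : ℕ) : ℝ) = 2 * (((z i : ℕ) / 2 : ℕ) : ℝ) + (((z i : ℕ) % 2 : ℕ) : ℝ) := by
    exact_mod_cast h1
  have h4 : (cubePoint a ρ (m + 1) z - cubePoint a ρ m (cubeParent z)) i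
      = ρ / 2 ^ (m + 1) * (((z i : ℕ) % 2 : ℕ) : ℝ) := by
    simp only [cubePoint, cubeParent, add_sub_add_left_eq_sub, PiLp.sub_apply]
    rw [h3]
    field_simp
    ring
  rw [h4, abs_of_nonneg (by positivity)]
  exact mul_le_of_le_one_right (by positivity) h2

lemma exists_cubePoint_near {a x : EuclideanSpace ℝ (Fin d)} {ρ : ℝ} (hρ : 0 < ρ)
    (h : ∀ i, a i ≤ x i ∧ x i ≤ a i + ρ) (m : ℕ) :
    ∃ z, ‖x - cubePoint a ρ m z‖ ≤ √d * (ρ / 2 ^ m) := by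
  have h2m : 0 < 2 ^ m := by positivity
  refine ⟨fun i => ⟨min ⌊(x i - a i) / ρ * 2 ^ m⌋₊ (2 ^ m - 1), by omega⟩,
    EuclideanSpace.norm_le_sqrt_mul (by positivity) fun i => ?_⟩
  set v := (x i - a i) / ρ * 2 ^ m with hv
  have hv0 : 0 ≤ v := by
    have := (h i).1
    exact mul_nonneg (div_nonneg (by linarith) hρ.le) (by positivity)
  have hv1 : v ≤ 2 ^ m := by
    refine mul_le_of_le_one_left (by positivity) ?_
    rw [div_le_one hρ]; linarith [(h i).2]
  have hx : x i - a i = ρ / 2 ^ m * v := by rw [hv]; field_simp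
  have h4 : (x - cubePoint a ρ m fun i => ⟨min ⌊(x i - a i) / ρ * 2 ^ m⌋₊ (2 ^ m - 1), by omega⟩) i
      = ρ / 2 ^ m * (v - (min ⌊v⌋₊ (2 ^ m - 1) : ℕ)) := by
    rw [mul_sub, ← hx]
    simp only [cubePoint, PiLp.sub_apply, PiLp.add_apply, ← hv]
    ring
  rw [h4, abs_mul, abs_of_nonneg (by positivity)]
  refine mul_le_of_le_one_right (by positivity) ?_
  have hf := Nat.floor_le hv0
  have hf2 := Nat.lt_floor_add_one v
  rcases le_total ⌊v⌋₊ (2 ^ m - 1) with h5 | h5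
  · rw [min_eq_left h5, abs_of_nonneg (by linarith)]; linarith
  · rw [min_eq_right h5, abs_le]
    have h6 : ((2 ^ m - 1 : ℕ) : ℝ) ≤ ⌊v⌋₊ := by exact_mod_cast h5
    have h7 : ((2 ^ m - 1 : ℕ) : ℝ) = 2 ^ m - 1 := by
      rw [Nat.cast_sub h2m]; simp
    constructor <;> linarith

/-- Chaining bound for the expected maximum of a field over the dyadic points of a cube, when the
standard deviations of the increments are `θ`-Hölder. -/
theorem exists_chaining_const (d : ℕ) {θ : ℝ} (hθ : 0 < θ) :
    ∃ S > 0, ∀ {Ω : Type*} [MeasurableSpace Ω] {Q : Measure Ω}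
      {X : EuclideanSpace ℝ (Fin d) → Ω → ℝ} {r : ℝ → ℝ}, IsIsotropicGaussianField X Q r →
      ∀ A > 0, (∀ x y : EuclideanSpace ℝ (Fin d), 2 * (r 0 - r ‖x - y‖) ≤ (A * ‖x - y‖ ^ θ) ^ 2) →
      ∀ (a : EuclideanSpace ℝ (Fin d)), ∀ ρ > 0, ∀ m,
        Integrable (fun ω => Finset.univ.sup' Finset.univ_nonempty
          fun z : Fin d → Fin (2 ^ m) => X (cubePoint a ρ m z) ω - X a ω) Q ∧
        ∫ ω, Finset.univ.sup' Finset.univ_nonempty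
          (fun z : Fin d → Fin (2 ^ m) => X (cubePoint a ρ m z) ω - X a ω) ∂Q ≤ S * A * ρ ^ θ := by
  -- the contribution of the links from level `k` to level `k + 1`, for `A = ρ = 1`; `√d + 1` rather
  -- than `√d` keeps it positive when `d = 0`
  set w : ℕ → ℝ := fun k =>
    ((√d + 1) / 2 ^ (k + 1)) ^ θ * ((k + 1) * (d * Real.log 2) + 1 / 2) with hw
  have hw0 : ∀ k, 0 < w k := fun k => by
    have := Real.log_pos one_lt_two
    positivity
  have hsum : Summable w := by
    set q : ℝ := (1 / 2 : ℝ) ^ θ with hq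
    have hq0 : 0 < q := by positivity
    have hq1 : q < 1 := Real.rpow_lt_one (by norm_num) (by norm_num) hθ
    have hqn : ‖q‖ < 1 := by rwa [Real.norm_of_nonneg hq0.le]
    have h1 : ∀ k, w k = (√d + 1) ^ θ * q * ((d * Real.log 2) * ((k : ℝ) ^ 1 * q ^ k) +
        (d * Real.log 2 + 1 / 2) * q ^ k) := fun k => by
      have : ((√d + 1) / 2 ^ (k + 1)) ^ θ = (√d + 1) ^ θ * q * q ^ k := by
        have h2 : (1 / 2 ^ (k + 1) : ℝ) ^ θ = q ^ (k + 1) := by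
          rw [hq, ← Real.rpow_natCast (_ ^ θ), ← Real.rpow_mul (by norm_num), mul_comm θ,
            Real.rpow_mul (by norm_num), Real.rpow_natCast, one_div_pow]
        rw [div_eq_mul_one_div, Real.mul_rpow (by positivity) (by positivity), h2]
        ring
      simp only [hw, this]; ring
    rw [funext h1]
    exact (((summable_pow_mul_geometric_of_norm_lt_one 1 hqn).mul_left _).add
      ((summable_geometric_of_norm_lt_one hqn).mul_left _)).mul_left _
  refine ⟨∑' k, w k, hsum.tsum_pos (fun k => (hw0 k).le) 0 (hw0 0), ?_⟩
  intro Ω _ Q X r hX A hA hinc a ρ hρ m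
  have := hX.gaussian.isProbabilityMeasure
  have main : Integrable (fun ω => Finset.univ.sup' Finset.univ_nonempty
          fun z : Fin d → Fin (2 ^ m) => X (cubePoint a ρ m z) ω - X a ω) Q ∧
        ∫ ω, Finset.univ.sup' Finset.univ_nonempty
          (fun z : Fin d → Fin (2 ^ m) => X (cubePoint a ρ m z) ω - X a ω) ∂Q ≤
            A * ρ ^ θ * ∑ k ∈ Finset.range m, w k := by
    induction m with
    | zero => simp [cubePoint_zero]
    | succ m ih =>
      obtain ⟨ih1, ih2⟩ := ih
      set σ : NNReal := Real.toNNReal (A * ((√d + 1) * (ρ / 2 ^ (m + 1))) ^ θ) with hσ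
      have hσ0 : 0 < σ := Real.toNNReal_pos.2 (by positivity)
      have hσv : (σ : ℝ) = A * ((√d + 1) * (ρ / 2 ^ (m + 1))) ^ θ :=
        Real.coe_toNNReal _ (by positivity)
      obtain ⟨h1, h2⟩ := integral_sup'_le (Q := Q) (J := Fin d → Fin (2 ^ (m + 1))) hσ0
        (X := fun z ω => X (cubePoint a ρ (m + 1) z) ω - X (cubePoint a ρ m (cubeParent z)) ω)
        fun z => by
          refine (hX.gaussian.hasGaussianLaw_fun_sub).hasSubgaussianMGF
            (hX.integral_sub_eq_zero _ _) ?_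
          rw [hX.integral_sub_sq]
          refine (hinc _ _).trans ?_
          rw [NNReal.coe_pow, hσv]
          gcongr
          exact (norm_cubePoint_sub_cubeParent_le a hρ.le m z).trans (by gcongr; linarith)
      have hle : ∀ ω, Finset.univ.sup' Finset.univ_nonempty
          (fun z : Fin d → Fin (2 ^ (m + 1)) => X (cubePoint a ρ (m + 1) z) ω - X a ω) ≤
          Finset.univ.sup' Finset.univ_nonempty
          (fun z : Fin d → Fin (2 ^ m) => X (cubePoint a ρ m z) ω - X a ω) +
          Finset.univ.sup' Finset.univ_nonempty (fun z : Fin d → Fin (2 ^ (m + 1)) =>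
            X (cubePoint a ρ (m + 1) z) ω - X (cubePoint a ρ m (cubeParent z)) ω) := fun ω => by
        refine Finset.sup'_le _ _ fun z _ => ?_
        have e1 := Finset.le_sup' (fun z : Fin d → Fin (2 ^ m) =>
          X (cubePoint a ρ m z) ω - X a ω) (Finset.mem_univ (cubeParent z))
        have e2 := Finset.le_sup' (fun z : Fin d → Fin (2 ^ (m + 1)) =>
            X (cubePoint a ρ (m + 1) z) ω - X (cubePoint a ρ m (cubeParent z)) ω)
            (Finset.mem_univ z)
        linarith
      have hint : Integrable (fun ω => Finset.univ.sup' Finset.univ_nonempty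
          fun z : Fin d → Fin (2 ^ (m + 1)) => X (cubePoint a ρ (m + 1) z) ω - X a ω) Q := by
        have hsub : ∀ z : Fin d → Fin (2 ^ (m + 1)), HasSubgaussianMGF
            (fun ω => X (cubePoint a ρ (m + 1) z) ω - X a ω)
            (Real.toNNReal (A * (√d * ρ) ^ θ + 1) ^ 2) Q := fun z => by
          refine (hX.gaussian.hasGaussianLaw_fun_sub).hasSubgaussianMGF
            (hX.integral_sub_eq_zero _ _) ?_
          rw [hX.integral_sub_sq]
          refine (hinc _ _).trans ?_
          rw [NNReal.coe_pow, Real.coe_toNNReal _ (by positivity)]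
          have h3 := norm_cubePoint_sub_le a hρ.le (m + 1) z
          have h4 : A * ‖cubePoint a ρ (m + 1) z - a‖ ^ θ ≤ A * (√d * ρ) ^ θ := by gcongr
          gcongr
          linarith
        exact (integral_sup'_le (Q := Q) (Real.toNNReal_pos.2 (by positivity)) hsub).1
      refine ⟨hint, ?_⟩
      refine (integral_mono hint (ih1.add h1) hle).trans ?_
      rw [integral_add' ih1 h1, Finset.sum_range_succ, mul_add]
      refine add_le_add ih2 (h2.trans_eq ?_)
      have hcard : Real.log (Fintype.card (Fin d → Fin (2 ^ (m + 1))))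
          = (m + 1) * (d * Real.log 2) := by
        simp only [Fintype.card_fun, Fintype.card_fin]
        push_cast
        rw [Real.log_pow, Real.log_pow]; push_cast; ring
      rw [hcard, hσv, show (√d + 1) * (ρ / 2 ^ (m + 1)) = ρ * ((√d + 1) / 2 ^ (m + 1)) by ring,
        Real.mul_rpow hρ.le (by positivity)]
      simp only [hw]; ring
  refine ⟨main.1, main.2.trans ?_⟩
  have h5 := hsum.sum_le_tsum (Finset.range m) fun k _ => (hw0 k).le
  calc A * ρ ^ θ * ∑ k ∈ Finset.range m, w k ≤ A * ρ ^ θ * ∑' k, w k := by gcongr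
    _ = _ := by ring

end Cube

/-! ### Positive definite functions -/

section PositiveDefinite

variable {d : ℕ}

/-- A continuous, even, real positive definite function, i.e. the covariance function of a
mean-square continuous stationary field. -/
structure IsPosDefFun (K : EuclideanSpace ℝ (Fin d) → ℝ) : Prop where
  continuous : Continuous K
  even : ∀ z, K (-z) = K z
  nonneg : ∀ (S : Finset (EuclideanSpace ℝ (Fin d))) (a : EuclideanSpace ℝ (Fin d) → ℝ),
    0 ≤ ∑ x ∈ S, ∑ y ∈ S, a x * a y * K (x - y)

variable {K : EuclideanSpace ℝ (Fin d) → ℝ}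

lemma IsPosDefFun.abs_le (hK : IsPosDefFun K) (z : EuclideanSpace ℝ (Fin d)) : |K z| ≤ K 0 := by
  rcases eq_or_ne z 0 with rfl | hz
  · have := hK.nonneg {0} 1
    simp at this
    exact (abs_of_nonneg this).le
  have h1 := hK.nonneg {z, 0} 1
  have h2 := hK.nonneg {z, 0} (fun x => if x = 0 then -1 else 1)
  rw [Finset.sum_pair hz, Finset.sum_pair hz, Finset.sum_pair hz] at h1 h2
  simp [hz, hK.even] at h1 h2
  rw [_root_.abs_le]
  constructor <;> linarith

lemma SimpleFunc.integral_comp_eq_sum {α : Type*} [MeasurableSpace α] {π : Measure α}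
    [IsFiniteMeasure π] {β : Type*} (q : SimpleFunc α β) (F : β → ℝ) :
    ∫ x, F (q x) ∂π = ∑ e ∈ q.range, π.real (q ⁻¹' {e}) * F e := by
  classical
  have h1 : ∀ x, F (q x) = ∑ e ∈ q.range, (q ⁻¹' {e}).indicator (fun _ => F e) x := fun x => by
    rw [Finset.sum_eq_single (q x)]
    · simp
    · intro b _ hb
      rw [Set.indicator_of_notMem]
      simpa using hb.symm
    · intro h; exact absurd (q.mem_range_self x) h
  simp_rw [h1]
  rw [integral_finsetSum]
  · refine Finset.sum_congr rfl fun e _ => ?_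
    rw [integral_indicator_const _ (q.measurableSet_fiber e), smul_eq_mul]
  · exact fun e _ => (integrable_const _).indicator (q.measurableSet_fiber e)

/-- Positive definiteness passes from finite sums to integrals. -/
lemma IsPosDefFun.integral_integral_nonneg (hK : IsPosDefFun K)
    (π : Measure (EuclideanSpace ℝ (Fin d))) [IsFiniteMeasure π]
    {h : EuclideanSpace ℝ (Fin d) → ℝ} (hc : Continuous h) (hB : ∀ x, |h x| ≤ 1) :
    0 ≤ ∫ x, ∫ y, h x * h y * K (x - y) ∂π ∂π := by
  let q : ℕ → SimpleFunc (EuclideanSpace ℝ (Fin d)) (EuclideanSpace ℝ (Fin d)) :=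
    SimpleFunc.approxOn id measurable_id Set.univ 0 trivial
  have hq : ∀ x, Tendsto (fun n => q n x) atTop (𝓝 x) := fun x =>
    SimpleFunc.tendsto_approxOn measurable_id _ (by simp)
  have hbd : ∀ x y, |h x * h y * K (x - y)| ≤ K 0 := fun x y => by
    rw [abs_mul, abs_mul]
    calc |h x| * |h y| * |K (x - y)| ≤ 1 * 1 * K 0 := by
          gcongr
          · exact hB x
          · exact hB y
          · exact hK.abs_le _
      _ = K 0 := by ring
  have hcont : Continuous fun r : EuclideanSpace ℝ (Fin d) × EuclideanSpace ℝ (Fin d) =>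
      h r.1 * h r.2 * K (r.1 - r.2) := by
    have := hK.continuous
    fun_prop
  have hm : ∀ n x, AEStronglyMeasurable
      (fun y => h (q n x) * h (q n y) * K (q n x - q n y)) π := fun n x =>
    (hcont.measurable.comp (measurable_const.prodMk (q n).measurable)).aestronglyMeasurable
  have hlim : Tendsto (fun n => ∫ x, ∫ y, h (q n x) * h (q n y) * K (q n x - q n y) ∂π ∂π) atTop
      (𝓝 (∫ x, ∫ y, h x * h y * K (x - y) ∂π ∂π)) := by
    refine tendsto_integral_of_dominated_convergence (fun _ => ∫ _, K 0 ∂π) (fun n => ?_)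
      (integrable_const _) (fun n => ae_of_all _ fun x => ?_) (ae_of_all _ fun x => ?_)
    · have h2 : StronglyMeasurable fun r : EuclideanSpace ℝ (Fin d) × EuclideanSpace ℝ (Fin d) =>
          h (q n r.1) * h (q n r.2) * K (q n r.1 - q n r.2) :=
        (hcont.measurable.comp (((q n).measurable.comp measurable_fst).prodMk
          ((q n).measurable.comp measurable_snd))).stronglyMeasurable
      exact h2.integral_prod_right.aestronglyMeasurable
    · exact norm_integral_le_of_norm_le (integrable_const _) (ae_of_all _ fun y => hbd _ _)
    · refine tendsto_integral_of_dominated_convergence (fun _ => K 0) (fun n => hm n x)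
        (integrable_const _) (fun n => ae_of_all _ fun y => hbd _ _) (ae_of_all _ fun y => ?_)
      exact (hcont.tendsto (x, y)).comp ((hq x).prodMk_nhds (hq y))
  refine ge_of_tendsto' hlim fun n => ?_
  have h3 : ∀ x, ∫ y, h (q n x) * h (q n y) * K (q n x - q n y) ∂π
      = (fun e => ∑ e' ∈ (q n).range, π.real (q n ⁻¹' {e'}) * (h e * h e' * K (e - e'))) (q n x) :=
    fun x => SimpleFunc.integral_comp_eq_sum (q n) fun e' => h (q n x) * h e' * K (q n x - e')
  simp_rw [h3]
  rw [SimpleFunc.integral_comp_eq_sum (q n)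
    (fun e => ∑ e' ∈ (q n).range, π.real (q n ⁻¹' {e'}) * (h e * h e' * K (e - e')))]
  refine (hK.nonneg (q n).range fun e => π.real (q n ⁻¹' {e}) * h e).trans_eq ?_
  refine Finset.sum_congr rfl fun e _ => ?_
  rw [Finset.mul_sum]
  exact Finset.sum_congr rfl fun e' _ => by ring

/-! ### The Gaussian-regularized spectral density -/

local notation "⟪" x ", " y "⟫" => inner ℝ x y

lemma integrable_exp_neg_mul_sq_norm {b : ℝ} (hb : 0 < b) :
    Integrable fun z : EuclideanSpace ℝ (Fin d) => Real.exp (-b * ‖z‖ ^ 2) := by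
  have h := (GaussianFourier.integrable_cexp_neg_mul_sq_norm_add (b := b) (by simpa) 0
    (0 : EuclideanSpace ℝ (Fin d))).norm
  refine h.congr (ae_of_all _ fun z => ?_)
  simp only [Complex.norm_exp]
  congr 1
  simp [← Complex.ofReal_pow]

lemma integral_cos_inner_mul_exp {b : ℝ} (hb : 0 < b) (w : EuclideanSpace ℝ (Fin d)) :
    ∫ z : EuclideanSpace ℝ (Fin d), Real.cos ⟪z, w⟫ * Real.exp (-b * ‖z‖ ^ 2)
      = (Real.pi / b) ^ (d / 2 : ℝ) * Real.exp (-‖w‖ ^ 2 / (4 * b)) := by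
  have h1 := GaussianFourier.integral_cexp_neg_mul_sq_norm_add (b := b) (by simpa) Complex.I w
  have h2 := GaussianFourier.integrable_cexp_neg_mul_sq_norm_add (b := b) (by simpa) Complex.I w
  have h3 : ∀ z : EuclideanSpace ℝ (Fin d), Real.cos ⟪z, w⟫ * Real.exp (-b * ‖z‖ ^ 2)
      = RCLike.re (Complex.exp (-b * ‖z‖ ^ 2 + Complex.I * ⟪w, z⟫)) := fun z => by
    change _ = (Complex.exp _).re
    rw [real_inner_comm, Complex.exp_re, mul_comm]
    simp [← Complex.ofReal_pow]
  simp_rw [h3]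
  rw [integral_re h2, h1]
  have h4 : ((Real.pi : ℂ) / b) ^ ((Module.finrank ℝ (EuclideanSpace ℝ (Fin d)) : ℂ) / 2)
      = (((Real.pi / b) ^ (d / 2 : ℝ) : ℝ) : ℂ) := by
    rw [Complex.ofReal_cpow (by positivity)]
    push_cast
    simp
  rw [h4, Complex.I_sq, show (-1 * (‖w‖ : ℂ) ^ 2 / (4 * b)) = ((-‖w‖ ^ 2 / (4 * b) : ℝ) : ℂ) by
    push_cast; ring, ← Complex.ofReal_exp, ← Complex.ofReal_mul]
  exact Complex.ofReal_re _

/-- The Fourier transform of `K` multiplied by a Gaussian: a nonnegative substitute for the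
spectral density of `K`. -/
noncomputable def regSpectral (K : EuclideanSpace ℝ (Fin d) → ℝ) (ε : ℝ)
    (ξ : EuclideanSpace ℝ (Fin d)) : ℝ :=
  ∫ z, K z * Real.exp (-ε * ‖z‖ ^ 2) * Real.cos ⟪ξ, z⟫

lemma IsPosDefFun.integrable_mul_exp (hK : IsPosDefFun K) {ε : ℝ} (hε : 0 < ε) :
    Integrable fun z => K z * Real.exp (-ε * ‖z‖ ^ 2) :=
  (integrable_exp_neg_mul_sq_norm hε).bdd_mul (c := K 0) hK.continuous.aestronglyMeasurable
    (ae_of_all _ hK.abs_le)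

lemma IsPosDefFun.abs_regSpectral_le (hK : IsPosDefFun K) {ε : ℝ} (hε : 0 < ε)
    (ξ : EuclideanSpace ℝ (Fin d)) :
    |regSpectral K ε ξ| ≤ ∫ z, |K z * Real.exp (-ε * ‖z‖ ^ 2)| := by
  rw [regSpectral, ← Real.norm_eq_abs]
  refine norm_integral_le_of_norm_le (hK.integrable_mul_exp hε).abs (ae_of_all _ fun z => ?_)
  rw [norm_mul, Real.norm_eq_abs, Real.norm_eq_abs]
  exact mul_le_of_le_one_right (abs_nonneg _) (Real.abs_cos_le_one _)

lemma IsPosDefFun.continuous_regSpectral (hK : IsPosDefFun K) {ε : ℝ} (hε : 0 < ε) :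
    Continuous (regSpectral K ε) := by
  have hc := hK.continuous
  refine continuous_of_dominated
    (F := fun ξ z => K z * Real.exp (-ε * ‖z‖ ^ 2) * Real.cos ⟪ξ, z⟫)
    (bound := fun z => |K z * Real.exp (-ε * ‖z‖ ^ 2)|)
    (fun ξ => (by fun_prop : Continuous _).aestronglyMeasurable) (fun ξ => ae_of_all _ fun z => ?_)
    (hK.integrable_mul_exp hε).abs (ae_of_all _ fun z => by fun_prop)
  rw [norm_mul, Real.norm_eq_abs, Real.norm_eq_abs]
  exact mul_le_of_le_one_right (abs_nonneg _) (Real.abs_cos_le_one _)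

/-- The parallelogram identity turns the energy of `exp (-2 ε |x|²) dx` twisted by a character into
a multiple of the regularized spectral density. -/
lemma IsPosDefFun.regSpectral_nonneg (hK : IsPosDefFun K) {ε : ℝ} (hε : 0 < ε)
    (ξ : EuclideanSpace ℝ (Fin d)) : 0 ≤ regSpectral K ε ξ := by
  have hc := hK.continuous
  set g : EuclideanSpace ℝ (Fin d) → ℝ := fun x => Real.exp (-(2 * ε) * ‖x‖ ^ 2) with hg
  have hgi : Integrable g := integrable_exp_neg_mul_sq_norm (by positivity)
  have hgc : Continuous g := by fun_prop
  have hg0 : ∀ x, 0 ≤ g x := fun x => (Real.exp_pos _).le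
  have hg1 : ∀ x, |g x| ≤ 1 := fun x => by
    rw [abs_of_nonneg (hg0 x), hg, Real.exp_le_one_iff]
    have : 0 ≤ 2 * ε * ‖x‖ ^ 2 := by positivity
    linarith
  set π : Measure (EuclideanSpace ℝ (Fin d)) := volume.withDensity fun x => ENNReal.ofReal (g x)
  have hfin : IsFiniteMeasure π := isFiniteMeasure_withDensity_ofReal hgi.2
  have hπ : ∀ F : EuclideanSpace ℝ (Fin d) → ℝ, ∫ x, F x ∂π = ∫ x, g x * F x := fun F => by
    rw [integral_withDensity_eq_integral_toReal_smul hgc.measurable.ennreal_ofReal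
      (ae_of_all _ fun _ => ENNReal.ofReal_lt_top)]
    simp [ENNReal.toReal_ofReal (hg0 _)]
  have h1 := hK.integral_integral_nonneg π (h := fun x => Real.cos ⟪ξ, x⟫) (by fun_prop)
    fun x => Real.abs_cos_le_one _
  have h2 := hK.integral_integral_nonneg π (h := fun x => Real.sin ⟪ξ, x⟫) (by fun_prop)
    fun x => Real.abs_sin_le_one _
  simp_rw [hπ] at h1 h2
  simp_rw [← integral_const_mul] at h1 h2
  have hbound : ∀ (F : EuclideanSpace ℝ (Fin d) × EuclideanSpace ℝ (Fin d) → ℝ), Continuous F →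
      (∀ r, |F r| ≤ g r.1 * g r.2 * K 0) → Integrable F (volume.prod volume) := fun F hF hb =>
    ((hgi.mul_prod hgi).mul_const (K 0)).mono' hF.aestronglyMeasurable (ae_of_all _ hb)
  have htrig : ∀ (x y : EuclideanSpace ℝ (Fin d)) (a b : ℝ), |a| ≤ 1 → |b| ≤ 1 →
      |g x * (g y * (a * b * K (x - y)))| ≤ g x * g y * K 0 := fun x y a b ha hb => by
    rw [abs_mul, abs_mul, abs_mul, abs_mul, abs_of_nonneg (hg0 x), abs_of_nonneg (hg0 y),
      mul_assoc (g x)]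
    have := hK.abs_le (x - y)
    refine mul_le_mul_of_nonneg_left (mul_le_mul_of_nonneg_left ?_ (hg0 y)) (hg0 x)
    calc |a| * |b| * |K (x - y)| ≤ 1 * 1 * K 0 := by gcongr
      _ = K 0 := by ring
  have i1 := hbound (fun r => g r.1 * (g r.2 * (Real.cos ⟪ξ, r.1⟫ * Real.cos ⟪ξ, r.2⟫ *
    K (r.1 - r.2)))) (by fun_prop) fun r => htrig _ _ _ _ (Real.abs_cos_le_one _)
      (Real.abs_cos_le_one _)
  have i2 := hbound (fun r => g r.1 * (g r.2 * (Real.sin ⟪ξ, r.1⟫ * Real.sin ⟪ξ, r.2⟫ *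
    K (r.1 - r.2)))) (by fun_prop) fun r => htrig _ _ _ _ (Real.abs_sin_le_one _)
      (Real.abs_sin_le_one _)
  rw [← integral_prod _ i1] at h1
  rw [← integral_prod _ i2] at h2
  have h3 := add_nonneg h1 h2
  have i3 := i1.add i2
  simp only [Pi.add_def] at i3
  rw [← integral_add i1 i2, integral_prod _ i3] at h3
  have h4 : ∀ x y : EuclideanSpace ℝ (Fin d),
      g x * (g y * (Real.cos ⟪ξ, x⟫ * Real.cos ⟪ξ, y⟫ * K (x - y))) +
        g x * (g y * (Real.sin ⟪ξ, x⟫ * Real.sin ⟪ξ, y⟫ * K (x - y))) =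
      g x * g (x - (x - y)) * Real.cos ⟪ξ, x - y⟫ * K (x - y) := fun x y => by
    rw [inner_sub_right, Real.cos_sub, sub_sub_cancel]; ring
  simp_rw [h4] at h3
  have h5 : ∀ x : EuclideanSpace ℝ (Fin d),
      ∫ y, g x * g (x - (x - y)) * Real.cos ⟪ξ, x - y⟫ * K (x - y)
        = ∫ z, g x * g (x - z) * Real.cos ⟪ξ, z⟫ * K z := fun x =>
    integral_sub_left_eq_self (fun z => g x * g (x - z) * Real.cos ⟪ξ, z⟫ * K z) volume x
  simp_rw [h5] at h3
  -- `|x|² + |x - z|² = 2 |x - z / 2|² + |z|² / 2`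
  have hpar : ∀ x z : EuclideanSpace ℝ (Fin d), g x * g (x - z)
      = Real.exp (-ε * ‖z‖ ^ 2) * Real.exp (-(4 * ε) * ‖x - (2⁻¹ : ℝ) • z‖ ^ 2) := fun x z => by
    simp only [hg]
    rw [← Real.exp_add, ← Real.exp_add, norm_sub_sq_real, norm_sub_sq_real, norm_smul,
      inner_smul_right]
    congr 1
    simp only [norm_inv, Real.norm_ofNat]
    ring
  have i4 : Integrable (fun r : EuclideanSpace ℝ (Fin d) × EuclideanSpace ℝ (Fin d) =>
      g r.1 * g (r.1 - r.2) * Real.cos ⟪ξ, r.2⟫ * K r.2) (volume.prod volume) := by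
    refine (((integrable_exp_neg_mul_sq_norm hε).mul_prod
      (integrable_exp_neg_mul_sq_norm (half_pos hε))).mul_const (K 0)).mono'
      (by fun_prop : Continuous _).aestronglyMeasurable (ae_of_all _ fun r => ?_)
    obtain ⟨x, z⟩ := r
    have h6 : g x * g (x - z) ≤ Real.exp (-ε * ‖x‖ ^ 2) * Real.exp (-(ε / 2) * ‖z‖ ^ 2) := by
      simp only [hg]
      rw [← Real.exp_add, ← Real.exp_add, Real.exp_le_exp]
      have h7 : ‖z‖ ≤ ‖x‖ + ‖x - z‖ := by
        have := norm_sub_le x (x - z)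
        rwa [sub_sub_cancel] at this
      have h8 : ‖z‖ ^ 2 ≤ 2 * ‖x‖ ^ 2 + 2 * ‖x - z‖ ^ 2 := by
        nlinarith [sq_nonneg (‖x‖ - ‖x - z‖), norm_nonneg z, norm_nonneg x, norm_nonneg (x - z)]
      nlinarith [sq_nonneg ‖x - z‖]
    rw [norm_mul, norm_mul, Real.norm_of_nonneg (mul_nonneg (hg0 _) (hg0 _))]
    have h9 := Real.abs_cos_le_one ⟪ξ, z⟫
    have h10 := hK.abs_le z
    calc g x * g (x - z) * ‖Real.cos ⟪ξ, z⟫‖ * ‖K z‖ ≤ g x * g (x - z) * 1 * K 0 := by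
          have := mul_nonneg (hg0 x) (hg0 (x - z))
          gcongr <;> assumption
      _ ≤ _ := by
          rw [mul_one]
          exact mul_le_mul_of_nonneg_right h6 ((abs_nonneg _).trans h10)
  rw [integral_integral_swap i4] at h3
  have h6 : ∀ z : EuclideanSpace ℝ (Fin d), ∫ x, g x * g (x - z) * Real.cos ⟪ξ, z⟫ * K z
      = (∫ x : EuclideanSpace ℝ (Fin d), Real.exp (-(4 * ε) * ‖x‖ ^ 2)) *
        (K z * Real.exp (-ε * ‖z‖ ^ 2) * Real.cos ⟪ξ, z⟫) := fun z => by
    rw [← integral_sub_right_eq_self (fun x => Real.exp (-(4 * ε) * ‖x‖ ^ 2)) ((2⁻¹ : ℝ) • z),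
      ← integral_mul_const]
    congr 1
    ext x
    rw [hpar]; ring
  simp_rw [h6] at h3
  rw [integral_const_mul, GaussianFourier.integral_rexp_neg_mul_sq_norm (by positivity)] at h3
  exact nonneg_of_mul_nonneg_right h3 (by positivity)

/-- Pairing of the regularized spectral density with a modulated Gaussian. -/
lemma IsPosDefFun.integral_regSpectral_mul (hK : IsPosDefFun K) {ε b : ℝ} (hε : 0 < ε) (hb : 0 < b)
    (w : EuclideanSpace ℝ (Fin d)) :
    ∫ ξ, regSpectral K ε ξ * (Real.cos ⟪ξ, w⟫ * Real.exp (-b * ‖ξ‖ ^ 2)) =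
      (Real.pi / b) ^ (d / 2 : ℝ) *
        ∫ z, K z * Real.exp (-ε * ‖z‖ ^ 2) * Real.exp (-‖z - w‖ ^ 2 / (4 * b)) := by
  have hc := hK.continuous
  set G : EuclideanSpace ℝ (Fin d) → ℝ := fun z => K z * Real.exp (-ε * ‖z‖ ^ 2) with hG
  have hGc : Continuous G := by fun_prop
  have hGi : Integrable G := hK.integrable_mul_exp hε
  have hbi := integrable_exp_neg_mul_sq_norm (d := d) hb
  have hexp1 : ∀ z w : EuclideanSpace ℝ (Fin d), |Real.exp (-‖z - w‖ ^ 2 / (4 * b))| ≤ 1 :=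
    fun z w => by
      rw [Real.abs_exp, Real.exp_le_one_iff, neg_div]
      have : 0 ≤ ‖z - w‖ ^ 2 / (4 * b) := by positivity
      linarith
  have i1 : Integrable (fun r : EuclideanSpace ℝ (Fin d) × EuclideanSpace ℝ (Fin d) =>
      G r.2 * Real.cos ⟪r.1, r.2⟫ * (Real.cos ⟪r.1, w⟫ * Real.exp (-b * ‖r.1‖ ^ 2)))
      (volume.prod volume) := by
    refine ((hbi.mul_prod hGi.abs)).mono'
      (by fun_prop : Continuous _).aestronglyMeasurable (ae_of_all _ fun r => ?_)
    simp only [norm_mul, Real.norm_eq_abs, Real.abs_exp]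
    have h1 := Real.abs_cos_le_one ⟪r.1, r.2⟫
    have h2 := Real.abs_cos_le_one ⟪r.1, w⟫
    calc |G r.2| * |Real.cos ⟪r.1, r.2⟫| * (|Real.cos ⟪r.1, w⟫| * Real.exp (-b * ‖r.1‖ ^ 2))
        ≤ |G r.2| * 1 * (1 * Real.exp (-b * ‖r.1‖ ^ 2)) := by gcongr
      _ = _ := by ring
  have i2 : ∀ w, Integrable (fun z => G z * Real.exp (-‖z - w‖ ^ 2 / (4 * b))) := fun w => by
    refine hGi.abs.mono' (by fun_prop : Continuous _).aestronglyMeasurable (ae_of_all _ fun z => ?_)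
    rw [norm_mul]
    exact mul_le_of_le_one_right (abs_nonneg _) (hexp1 z w)
  have hGev : ∀ z, G (-z) = G z := fun z => by simp [hG, hK.even]
  have hsym : ∫ z, G z * Real.exp (-‖z + w‖ ^ 2 / (4 * b))
      = ∫ z, G z * Real.exp (-‖z - w‖ ^ 2 / (4 * b)) := by
    rw [← integral_neg_eq_self (fun z => G z * Real.exp (-‖z - w‖ ^ 2 / (4 * b)))]
    congr 1
    ext z
    rw [hGev, ← norm_neg (-z - w)]
    congr 4
    simp [add_comm]
  calc ∫ ξ, regSpectral K ε ξ * (Real.cos ⟪ξ, w⟫ * Real.exp (-b * ‖ξ‖ ^ 2))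
      = ∫ ξ, ∫ z, G z * Real.cos ⟪ξ, z⟫ * (Real.cos ⟪ξ, w⟫ * Real.exp (-b * ‖ξ‖ ^ 2)) := by
        congr 1; ext ξ; rw [integral_mul_const]; rfl
    _ = ∫ z, ∫ ξ, G z * Real.cos ⟪ξ, z⟫ * (Real.cos ⟪ξ, w⟫ * Real.exp (-b * ‖ξ‖ ^ 2)) :=
        integral_integral_swap i1
    _ = ∫ z, (Real.pi / b) ^ (d / 2 : ℝ) * (2⁻¹ * (G z * Real.exp (-‖z + w‖ ^ 2 / (4 * b)) +
          G z * Real.exp (-‖z - w‖ ^ 2 / (4 * b)))) := by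
        congr 1
        ext z
        have h1 : ∀ ξ : EuclideanSpace ℝ (Fin d),
            G z * Real.cos ⟪ξ, z⟫ * (Real.cos ⟪ξ, w⟫ * Real.exp (-b * ‖ξ‖ ^ 2))
            = 2⁻¹ * G z * (Real.cos ⟪ξ, z + w⟫ * Real.exp (-b * ‖ξ‖ ^ 2)) +
              2⁻¹ * G z * (Real.cos ⟪ξ, z - w⟫ * Real.exp (-b * ‖ξ‖ ^ 2)) := fun ξ => by
          rw [inner_add_right, inner_sub_right, Real.cos_add, Real.cos_sub]; ring
        have h2 : ∀ v, Integrable fun ξ : EuclideanSpace ℝ (Fin d) =>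
            Real.cos ⟪ξ, v⟫ * Real.exp (-b * ‖ξ‖ ^ 2) := fun v =>
          hbi.bdd_mul (c := 1) (by fun_prop : Continuous _).aestronglyMeasurable
            (ae_of_all _ fun ξ => Real.abs_cos_le_one _)
        simp_rw [h1]
        rw [integral_add ((h2 _).const_mul _) ((h2 _).const_mul _), integral_const_mul,
          integral_const_mul, integral_cos_inner_mul_exp hb, integral_cos_inner_mul_exp hb]
        ring
    _ = _ := by
        have i3 := i2 (-w)
        simp only [sub_neg_eq_add] at i3
        rw [integral_const_mul, integral_const_mul, integral_add i3 (i2 w), hsym]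
        ring

end PositiveDefinite

/-! ### Energies of measures on a ball -/

section SpectralWeight

/-- The radial profile, as a function of `τ = s² |ξ|² / 4` and up to a constant, of the Fourier
transform of `exp (-|z / s|²) (1 - exp (-|z / s|²)) ^ N`. -/
noncomputable def spectralWeight (d N : ℕ) (τ : ℝ) : ℝ :=
  ∑ j ∈ Finset.range (N + 1),
    (-1) ^ j * N.choose j * (1 + j : ℝ) ^ (-(d / 2 : ℝ)) * Real.exp (-τ / (1 + j))

lemma abs_spectralWeight_le (d N : ℕ) {τ : ℝ} (hτ : 0 ≤ τ) : |spectralWeight d N τ| ≤ 2 ^ N := by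
  have h2 : (2 : ℝ) ^ N = ∑ j ∈ Finset.range (N + 1), (N.choose j : ℝ) := by
    exact_mod_cast (Nat.sum_range_choose N).symm
  rw [h2]
  refine (Finset.abs_sum_le_sum_abs _ _).trans (Finset.sum_le_sum fun j _ => ?_)
  rw [abs_mul, abs_mul, abs_mul, abs_pow, abs_neg, abs_one, one_pow, one_mul, Real.abs_exp,
    Nat.abs_cast, abs_of_nonneg (by positivity), mul_assoc]
  refine mul_le_of_le_one_right (Nat.cast_nonneg _) ?_
  have h3 : (1 + j : ℝ) ^ (-(d / 2 : ℝ)) ≤ 1 :=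
    Real.rpow_le_one_of_one_le_of_nonpos (by simp) (by simp; positivity)
  have h4 : Real.exp (-τ / (1 + j)) ≤ 1 := by
    rw [Real.exp_le_one_iff, neg_div]; simp; positivity
  exact mul_le_one₀ h3 (Real.exp_pos _).le h4

/-- For odd `N` the widest Gaussian, which dominates at infinity, enters with a negative sign. -/
lemma exists_spectralWeight_nonpos (d : ℕ) {N : ℕ} (hN : Odd N) :
    ∃ τ₀ ≥ 1, ∀ τ ≥ τ₀, spectralWeight d N τ ≤ 0 := by
  have hlim : Tendsto (fun τ => Real.exp (τ / (1 + N)) * spectralWeight d N τ) atTop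
      (𝓝 (∑ j ∈ Finset.range (N + 1), if j = N then -(1 + N : ℝ) ^ (-(d / 2 : ℝ)) else 0)) := by
    simp_rw [spectralWeight, Finset.mul_sum]
    refine tendsto_finsetSum _ fun j hj => ?_
    split_ifs with h
    · subst h
      refine tendsto_const_nhds.congr fun τ => ?_
      rw [hN.neg_one_pow, Nat.choose_self, neg_div, Real.exp_neg]
      field_simp
      simp
    · have hjN : (j : ℝ) < N := by
        have := Finset.mem_range.1 hj
        exact_mod_cast (by omega : j < N)
      have h1 : ∀ τ : ℝ, Real.exp (τ / (1 + N)) * ((-1) ^ j * N.choose j *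
          (1 + j : ℝ) ^ (-(d / 2 : ℝ)) * Real.exp (-τ / (1 + j))) =
          (-1) ^ j * N.choose j * (1 + j : ℝ) ^ (-(d / 2 : ℝ)) *
            Real.exp (-((1 / (1 + j) - 1 / (1 + N)) * τ)) := fun τ => by
        rw [mul_left_comm, ← Real.exp_add]
        congr 2
        ring
      simp_rw [h1]
      rw [← mul_zero ((-1 : ℝ) ^ j * N.choose j * (1 + j : ℝ) ^ (-(d / 2 : ℝ)))]
      refine Tendsto.const_mul _ (Real.tendsto_exp_neg_atTop_nhds_zero.comp ?_)
      refine tendsto_id.const_mul_atTop ?_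
      rw [sub_pos]
      exact one_div_lt_one_div_of_lt (by positivity) (by linarith)
  have hneg : ∑ j ∈ Finset.range (N + 1),
      (if j = N then -(1 + N : ℝ) ^ (-(d / 2 : ℝ)) else 0) < 0 := by
    rw [Finset.sum_ite_eq' _ N, if_pos (by simp)]
    exact neg_neg_of_pos (by positivity)
  obtain ⟨τ₀, hτ₀⟩ := eventually_atTop.1 (hlim.eventually (gt_mem_nhds hneg))
  refine ⟨max τ₀ 1, le_max_right _ _, fun τ hτ => ?_⟩
  have := hτ₀ τ ((le_max_left _ _).trans hτ)
  by_contra h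
  push Not at h
  exact absurd (mul_pos (Real.exp_pos (τ / (1 + N))) h) (not_lt.2 this.le)

end SpectralWeight

section Energy

variable {d : ℕ} {K : EuclideanSpace ℝ (Fin d) → ℝ}

local notation "⟪" x ", " y "⟫" => inner ℝ x y

/-- The test function: nonnegative, and vanishing to order `2 N` at the origin. -/
noncomputable def annularBump (N : ℕ) (z : EuclideanSpace ℝ (Fin d)) : ℝ :=
  Real.exp (-‖z‖ ^ 2) * (1 - Real.exp (-‖z‖ ^ 2)) ^ N

lemma annularBump_eq_sum (N : ℕ) (z : EuclideanSpace ℝ (Fin d)) :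
    annularBump N z = ∑ j ∈ Finset.range (N + 1),
      (-1) ^ j * N.choose j * Real.exp (-(1 + j) * ‖z‖ ^ 2) := by
  rw [annularBump, sub_eq_neg_add, add_pow, Finset.mul_sum]
  refine Finset.sum_congr rfl fun j _ => ?_
  rw [one_pow, mul_one, neg_pow, ← Real.exp_nat_mul,
    show (-(1 + j : ℝ) * ‖z‖ ^ 2) = -‖z‖ ^ 2 + j * -‖z‖ ^ 2 by ring, Real.exp_add]
  ring

lemma one_sub_exp_mem (z : EuclideanSpace ℝ (Fin d)) :
    1 - Real.exp (-‖z‖ ^ 2) ∈ Set.Icc (0 : ℝ) 1 := by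
  have : Real.exp (-‖z‖ ^ 2) ≤ 1 := by rw [Real.exp_le_one_iff]; simp
  exact ⟨by linarith, by linarith [Real.exp_pos (-‖z‖ ^ 2)]⟩

lemma annularBump_nonneg (N : ℕ) (z : EuclideanSpace ℝ (Fin d)) : 0 ≤ annularBump N z :=
  mul_nonneg (Real.exp_pos _).le (pow_nonneg (one_sub_exp_mem z).1 _)

lemma annularBump_le (N : ℕ) (z : EuclideanSpace ℝ (Fin d)) :
    annularBump N z ≤ Real.exp (-1 * ‖z‖ ^ 2) := by
  rw [annularBump, neg_one_mul]
  exact mul_le_of_le_one_right (Real.exp_pos _).le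
    (pow_le_one₀ (one_sub_exp_mem z).1 (one_sub_exp_mem z).2)

lemma continuous_annularBump (N : ℕ) :
    Continuous (annularBump N : EuclideanSpace ℝ (Fin d) → ℝ) := by
  unfold annularBump; fun_prop

lemma integrable_annularBump (N : ℕ) :
    Integrable (annularBump N : EuclideanSpace ℝ (Fin d) → ℝ) :=
  (integrable_exp_neg_mul_sq_norm one_pos).mono' (continuous_annularBump N).aestronglyMeasurable
    (ae_of_all _ fun z => by
      rw [Real.norm_of_nonneg (annularBump_nonneg N z)]; exact annularBump_le N z)

lemma IsPosDefFun.integrable_regSpectral_mul (hK : IsPosDefFun K) {ε b : ℝ} (hε : 0 < ε)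
    (hb : 0 < b) {φ : EuclideanSpace ℝ (Fin d) → ℝ} (hφ : Continuous φ) {B : ℝ}
    (hB : ∀ ξ, |φ ξ| ≤ B) :
    Integrable fun ξ => regSpectral K ε ξ * (φ ξ * Real.exp (-b * ‖ξ‖ ^ 2)) :=
  ((integrable_exp_neg_mul_sq_norm hb).bdd_mul (c := B) hφ.aestronglyMeasurable
    (ae_of_all _ hB)).bdd_mul (hK.continuous_regSpectral hε).aestronglyMeasurable
    (ae_of_all _ (hK.abs_regSpectral_le hε))

lemma IsPosDefFun.integral_regSpectral_mul_spectralWeight (hK : IsPosDefFun K) {ε s : ℝ}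
    (hε : 0 < ε) (hs : 0 < s) (N : ℕ) :
    Integrable (fun ξ => regSpectral K ε ξ * spectralWeight d N (s ^ 2 / 4 * ‖ξ‖ ^ 2)) ∧
    ∫ ξ, regSpectral K ε ξ * spectralWeight d N (s ^ 2 / 4 * ‖ξ‖ ^ 2) =
      (4 * Real.pi / s ^ 2) ^ (d / 2 : ℝ) *
        ∫ z, K z * Real.exp (-ε * ‖z‖ ^ 2) * annularBump N (s⁻¹ • z) := by
  set b : ℕ → ℝ := fun j => s ^ 2 / (4 * (1 + j)) with hb
  have hb0 : ∀ j, 0 < b j := fun j => by positivity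
  have h1 : ∀ ξ : EuclideanSpace ℝ (Fin d),
      regSpectral K ε ξ * spectralWeight d N (s ^ 2 / 4 * ‖ξ‖ ^ 2) =
      ∑ j ∈ Finset.range (N + 1), ((-1) ^ j * N.choose j * (1 + j : ℝ) ^ (-(d / 2 : ℝ))) *
        (regSpectral K ε ξ * (Real.cos ⟪ξ, (0 : EuclideanSpace ℝ (Fin d))⟫ *
          Real.exp (-(b j) * ‖ξ‖ ^ 2))) := fun ξ => by
    rw [spectralWeight, Finset.mul_sum]
    refine Finset.sum_congr rfl fun j _ => ?_
    rw [inner_zero_right, Real.cos_zero, one_mul,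
      show -(s ^ 2 / 4 * ‖ξ‖ ^ 2) / (1 + (j : ℝ)) = -(b j) * ‖ξ‖ ^ 2 by simp only [hb]; field_simp]
    ring
  have h2 : ∀ j, Integrable fun ξ : EuclideanSpace ℝ (Fin d) => regSpectral K ε ξ *
      (Real.cos ⟪ξ, (0 : EuclideanSpace ℝ (Fin d))⟫ * Real.exp (-(b j) * ‖ξ‖ ^ 2)) := fun j =>
    hK.integrable_regSpectral_mul hε (hb0 j) (by fun_prop) fun ξ => Real.abs_cos_le_one _
  have h3 : ∀ (j : ℕ) (z : EuclideanSpace ℝ (Fin d)), Real.exp (-‖z - 0‖ ^ 2 / (4 * b j))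
      = Real.exp (-(1 + j) * ‖s⁻¹ • z‖ ^ 2) := fun j z => by
    rw [sub_zero, norm_smul, norm_inv, Real.norm_of_nonneg hs.le]
    congr 1
    simp only [hb]
    field_simp
  simp_rw [h1]
  refine ⟨integrable_finsetSum _ fun j _ => (h2 j).const_mul _, ?_⟩
  rw [integral_finsetSum _ fun j _ => (h2 j).const_mul _]
  simp_rw [integral_const_mul, hK.integral_regSpectral_mul hε (hb0 _), h3, annularBump_eq_sum,
    Finset.mul_sum]
  have h4 : ∀ j : ℕ, Integrable fun z : EuclideanSpace ℝ (Fin d) =>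
      K z * Real.exp (-ε * ‖z‖ ^ 2) *
        ((-1) ^ j * N.choose j * Real.exp (-(1 + j) * ‖s⁻¹ • z‖ ^ 2)) := fun j => by
    refine (hK.integrable_mul_exp hε).mul_bdd (c := N.choose j)
      (by fun_prop : Continuous _).aestronglyMeasurable (ae_of_all _ fun z => ?_)
    rw [norm_mul, norm_mul, norm_pow, norm_neg, norm_one, one_pow, one_mul, Real.norm_of_nonneg
      (Nat.cast_nonneg _), Real.norm_of_nonneg (Real.exp_pos _).le]
    refine mul_le_of_le_one_right (Nat.cast_nonneg _) ?_
    rw [Real.exp_le_one_iff, neg_mul]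
    simp only [Left.neg_nonpos_iff]
    positivity
  rw [integral_finsetSum _ fun j _ => h4 j, Finset.mul_sum]
  refine Finset.sum_congr rfl fun j _ => ?_
  have h5 : ∀ z : EuclideanSpace ℝ (Fin d), K z * Real.exp (-ε * ‖z‖ ^ 2) *
        ((-1) ^ j * N.choose j * Real.exp (-(1 + j) * ‖s⁻¹ • z‖ ^ 2)) =
      ((-1) ^ j * N.choose j) * (K z * Real.exp (-ε * ‖z‖ ^ 2) *
        Real.exp (-(1 + j) * ‖s⁻¹ • z‖ ^ 2)) := fun z => by ring
  simp_rw [h5]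
  rw [integral_const_mul]
  have h6 : (Real.pi / b j) ^ (d / 2 : ℝ)
      = (4 * Real.pi / s ^ 2) ^ (d / 2 : ℝ) * (1 + j : ℝ) ^ (d / 2 : ℝ) := by
    rw [← Real.mul_rpow (by positivity) (by positivity)]
    congr 1
    simp only [hb]
    field_simp
  have h7 : (1 + j : ℝ) ^ (-(d / 2 : ℝ)) * (1 + j : ℝ) ^ (d / 2 : ℝ) = 1 := by
    rw [← Real.rpow_add (by positivity)]; simp
  rw [h6]
  linear_combination ((-1) ^ j * N.choose j * (4 * Real.pi / s ^ 2) ^ (d / 2 : ℝ) *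
    ∫ z, K z * Real.exp (-ε * ‖z‖ ^ 2) * Real.exp (-(1 + j) * ‖s⁻¹ • z‖ ^ 2)) * h7

end Energy

section EnergyBound

variable {d : ℕ} {K : EuclideanSpace ℝ (Fin d) → ℝ}

local notation "⟪" x ", " y "⟫" => inner ℝ x y

/-- The squared modulus of the Fourier transform of `μ`. -/
noncomputable def fourierSq (μ : Measure (EuclideanSpace ℝ (Fin d)))
    (ξ : EuclideanSpace ℝ (Fin d)) : ℝ :=
  ∫ r, Real.cos ⟪ξ, r.1 - r.2⟫ ∂(μ.prod μ)

section FourierSq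

variable (μ : Measure (EuclideanSpace ℝ (Fin d))) [IsFiniteMeasure μ]

lemma fourierSq_nonneg (ξ : EuclideanSpace ℝ (Fin d)) : 0 ≤ fourierSq μ ξ := by
  have hint : ∀ φ : EuclideanSpace ℝ (Fin d) × EuclideanSpace ℝ (Fin d) → ℝ, Continuous φ →
      (∀ x, |φ x| ≤ 1) → Integrable φ (μ.prod μ) := fun φ hφ hb =>
    (integrable_const (1 : ℝ)).mono' hφ.aestronglyMeasurable (ae_of_all _ hb)
  have h1 : fourierSq μ ξ
      = (∫ x, Real.cos ⟪ξ, x⟫ ∂μ) * (∫ x, Real.cos ⟪ξ, x⟫ ∂μ) +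
        (∫ x, Real.sin ⟪ξ, x⟫ ∂μ) * (∫ x, Real.sin ⟪ξ, x⟫ ∂μ) := by
    rw [fourierSq, ← integral_prod_mul, ← integral_prod_mul, ← integral_add]
    · congr 1; ext r; rw [inner_sub_right, Real.cos_sub]
    · exact hint _ (by fun_prop) fun r => by
        rw [abs_mul]
        exact mul_le_one₀ (Real.abs_cos_le_one _) (abs_nonneg _) (Real.abs_cos_le_one _)
    · exact hint _ (by fun_prop) fun r => by
        rw [abs_mul]
        exact mul_le_one₀ (Real.abs_sin_le_one _) (abs_nonneg _) (Real.abs_sin_le_one _)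
  rw [h1]
  exact add_nonneg (mul_self_nonneg _) (mul_self_nonneg _)

lemma integrable_cos_inner_sub (ξ : EuclideanSpace ℝ (Fin d)) :
    Integrable (fun r : EuclideanSpace ℝ (Fin d) × EuclideanSpace ℝ (Fin d) =>
      Real.cos ⟪ξ, r.1 - r.2⟫) (μ.prod μ) :=
  (integrable_const (1 : ℝ)).mono' (by fun_prop : Continuous _).aestronglyMeasurable
    (ae_of_all _ fun _ => Real.abs_cos_le_one _)

lemma abs_fourierSq_le (ξ : EuclideanSpace ℝ (Fin d)) :
    |fourierSq μ ξ| ≤ (μ.prod μ).real Set.univ := by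
  rw [fourierSq, ← Real.norm_eq_abs]
  refine (norm_integral_le_of_norm_le (integrable_const (1 : ℝ))
    (ae_of_all _ fun r => Real.abs_cos_le_one _)).trans_eq (by simp)

lemma continuous_fourierSq : Continuous (fourierSq μ) :=
  continuous_of_dominated
    (F := fun ξ (r : EuclideanSpace ℝ (Fin d) × EuclideanSpace ℝ (Fin d)) =>
      Real.cos ⟪ξ, r.1 - r.2⟫) (bound := fun _ => 1)
    (fun ξ => (by fun_prop : Continuous _).aestronglyMeasurable)
    (fun ξ => ae_of_all _ fun _ => Real.abs_cos_le_one _) (integrable_const _)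
    (ae_of_all _ fun r => by fun_prop)

variable {μ}

lemma half_le_fourierSq {z₀ : EuclideanSpace ℝ (Fin d)} {ρ : ℝ}
    (hμ : μ (Metric.closedBall z₀ ρ)ᶜ = 0) {ξ : EuclideanSpace ℝ (Fin d)}
    (hξ : ‖ξ‖ * (2 * ρ) ≤ 1) : μ.real Set.univ ^ 2 / 2 ≤ fourierSq μ ξ := by
  have h1 : ∀ᵐ x ∂μ, x ∈ Metric.closedBall z₀ ρ := by
    rw [ae_iff]; exact hμ
  have h2 : ∀ᵐ r ∂(μ.prod μ), r.1 ∈ Metric.closedBall z₀ ρ ∧ r.2 ∈ Metric.closedBall z₀ ρ :=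
    (Measure.quasiMeasurePreserving_fst.ae h1).and (Measure.quasiMeasurePreserving_snd.ae h1)
  have h3 : ∫ _r, (1 / 2 : ℝ) ∂(μ.prod μ) ≤ fourierSq μ ξ := by
    refine integral_mono_ae (integrable_const _) (integrable_cos_inner_sub μ ξ) ?_
    filter_upwards [h2] with r hr
    have h4 : ‖r.1 - r.2‖ ≤ 2 * ρ := by
      have h5 := dist_triangle_right r.1 r.2 z₀
      rw [← dist_eq_norm]
      linarith [Metric.mem_closedBall.1 hr.1, Metric.mem_closedBall.1 hr.2]
    have h5 : |⟪ξ, r.1 - r.2⟫| ≤ 1 := by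
      refine (abs_real_inner_le_norm _ _).trans (le_trans ?_ hξ)
      gcongr
    have h6 := Real.one_sub_sq_div_two_le_cos (x := ⟪ξ, r.1 - r.2⟫)
    have h7 : ⟪ξ, r.1 - r.2⟫ ^ 2 ≤ 1 := by rw [← sq_abs]; exact pow_le_one₀ (abs_nonneg _) h5
    linarith
  refine le_trans (le_of_eq ?_) h3
  rw [integral_const, ← Set.univ_prod_univ, measureReal_prod_prod, smul_eq_mul]
  ring

end FourierSq

/-- A Gaussian average of `K` around `w`, written on the spectral side's normalization. -/
noncomputable def gaussSmooth (K : EuclideanSpace ℝ (Fin d) → ℝ) (δ : ℝ)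
    (w : EuclideanSpace ℝ (Fin d)) : ℝ :=
  (4 * Real.pi) ^ (d / 2 : ℝ) * ∫ v, K (w + (2 * √δ) • v) *
    Real.exp (-δ * ‖w + (2 * √δ) • v‖ ^ 2) * Real.exp (-1 * ‖v‖ ^ 2)

lemma integral_eq_pow_mul_integral_smul {R : ℝ} (hR : 0 < R) (f : EuclideanSpace ℝ (Fin d) → ℝ) :
    ∫ z, f z = R ^ d * ∫ v, f (R • v) := by
  rw [Measure.integral_comp_smul]
  simp only [finrank_euclideanSpace, Fintype.card_fin, smul_eq_mul]
  rw [abs_of_pos (by positivity)]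
  field_simp

lemma rpow_div_sq_mul_pow {a R : ℝ} (ha : 0 ≤ a) (hR : 0 < R) :
    (a / R ^ 2) ^ (d / 2 : ℝ) * R ^ d = a ^ (d / 2 : ℝ) := by
  have h1 : R ^ d = (R ^ 2) ^ (d / 2 : ℝ) := by
    rw [← Real.rpow_natCast, ← Real.rpow_natCast, ← Real.rpow_mul hR.le]
    congr 1
    push_cast; ring
  rw [h1, ← Real.mul_rpow (by positivity) (by positivity)]
  congr 1
  field_simp

lemma IsPosDefFun.integral_regSpectral_eq_gaussSmooth (hK : IsPosDefFun K) {δ : ℝ} (hδ : 0 < δ)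
    (w : EuclideanSpace ℝ (Fin d)) :
    ∫ ξ, regSpectral K δ ξ * (Real.cos ⟪ξ, w⟫ * Real.exp (-δ * ‖ξ‖ ^ 2)) = gaussSmooth K δ w := by
  have hs : 0 < √δ := Real.sqrt_pos.2 hδ
  have hs2 : √δ ^ 2 = δ := Real.sq_sqrt hδ.le
  rw [hK.integral_regSpectral_mul hδ hδ, gaussSmooth,
    ← integral_add_left_eq_self _ w,
    integral_eq_pow_mul_integral_smul (R := 2 * √δ) (by positivity),
    ← mul_assoc]
  congr 1
  · rw [← rpow_div_sq_mul_pow (R := 2 * √δ) (a := 4 * Real.pi) (by positivity) (by positivity)]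
    congr 2
    rw [mul_pow, hs2]
    field_simp
    norm_num
  · congr 1
    ext v
    rw [add_sub_cancel_left, norm_smul, mul_pow, Real.norm_of_nonneg (by positivity), mul_pow, hs2]
    congr 2
    field_simp
    ring

lemma IsPosDefFun.abs_gaussSmooth_le (hK : IsPosDefFun K) {δ : ℝ} (hδ : 0 < δ)
    (w : EuclideanSpace ℝ (Fin d)) : |gaussSmooth K δ w| ≤
      (4 * Real.pi) ^ (d / 2 : ℝ) *
        ∫ v : EuclideanSpace ℝ (Fin d), K 0 * Real.exp (-1 * ‖v‖ ^ 2) := by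
  rw [gaussSmooth, abs_mul, abs_of_nonneg (by positivity)]
  refine mul_le_mul_of_nonneg_left ?_ (by positivity)
  rw [← Real.norm_eq_abs]
  refine norm_integral_le_of_norm_le ((integrable_exp_neg_mul_sq_norm one_pos).const_mul _)
    (ae_of_all _ fun v => ?_)
  rw [norm_mul, norm_mul, Real.norm_of_nonneg (Real.exp_pos _).le,
    Real.norm_of_nonneg (Real.exp_pos _).le]
  gcongr
  refine (mul_le_of_le_one_right (norm_nonneg _) ?_).trans (hK.abs_le _)
  rw [Real.exp_le_one_iff, neg_mul, Left.neg_nonpos_iff]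
  positivity

lemma IsPosDefFun.tendsto_gaussSmooth (hK : IsPosDefFun K) {δ : ℕ → ℝ} (hδ : ∀ n, 0 < δ n)
    (hlim : Tendsto δ atTop (𝓝 0)) (w : EuclideanSpace ℝ (Fin d)) :
    Tendsto (fun n => gaussSmooth K (δ n) w) atTop
      (𝓝 ((4 * Real.pi) ^ (d / 2 : ℝ) * (K w * Real.pi ^ (d / 2 : ℝ)))) := by
  have hc := hK.continuous
  refine Tendsto.const_mul _ ?_
  have h1 : K w * Real.pi ^ (d / 2 : ℝ)
      = ∫ v : EuclideanSpace ℝ (Fin d), K w * 1 * Real.exp (-1 * ‖v‖ ^ 2) := by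
    rw [integral_const_mul, GaussianFourier.integral_rexp_neg_mul_sq_norm one_pos]
    simp
  rw [h1]
  refine tendsto_integral_of_dominated_convergence
    (fun v => K 0 * Real.exp (-1 * ‖v‖ ^ 2))
    (fun n => (by fun_prop : Continuous _).aestronglyMeasurable)
    ((integrable_exp_neg_mul_sq_norm one_pos).const_mul _) (fun n => ae_of_all _ fun v => ?_)
    (ae_of_all _ fun v => ?_)
  · rw [norm_mul, norm_mul, Real.norm_of_nonneg (Real.exp_pos _).le,
      Real.norm_of_nonneg (Real.exp_pos _).le]
    gcongr
    refine (mul_le_of_le_one_right (norm_nonneg _) ?_).trans (hK.abs_le _)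
    rw [Real.exp_le_one_iff, neg_mul, Left.neg_nonpos_iff]
    have := hδ n
    positivity
  · refine Tendsto.mul_const _ ?_
    have h2 : Tendsto (fun n => (δ n, √(δ n))) atTop (𝓝 (0, 0)) := by
      refine hlim.prodMk_nhds ?_
      simpa [Function.comp_def] using (Real.continuous_sqrt.tendsto 0).comp hlim
    have h3 : Continuous fun q : ℝ × ℝ => K (w + (2 * q.2) • v) *
        Real.exp (-q.1 * ‖w + (2 * q.2) • v‖ ^ 2) := by fun_prop
    have h4 := (h3.tendsto (0, 0)).comp h2
    simpa [Function.comp_def] using h4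

/-- Comparison, on the spectral side, of the energy of a measure on a ball with the average of `K`
against a positive bump at a comparable scale. -/
lemma IsPosDefFun.integral_annularBump_le (hK : IsPosDefFun K) {N : ℕ} {τ₀ : ℝ} (hτ₀ : 1 ≤ τ₀)
    (hN : ∀ τ ≥ τ₀, spectralWeight d N τ ≤ 0)
    (μ : Measure (EuclideanSpace ℝ (Fin d))) [IsFiniteMeasure μ] {z₀ : EuclideanSpace ℝ (Fin d)}
    {ρ : ℝ} (hρ : 0 < ρ) (hμ : μ (Metric.closedBall z₀ ρ)ᶜ = 0) :
    μ.real Set.univ ^ 2 * ∫ v, K ((4 * √τ₀ * ρ) • v) * annularBump N v ≤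
      2 * Real.exp 1 * 2 ^ N * Real.pi ^ (d / 2 : ℝ) * ∫ x, ∫ y, K (x - y) ∂μ ∂μ := by
  have hc := hK.continuous
  have hτ0 : 0 < τ₀ := by linarith
  have hsq : 0 < √τ₀ := Real.sqrt_pos.2 hτ0
  have hsq2 : √τ₀ ^ 2 = τ₀ := Real.sq_sqrt hτ0.le
  set s := 4 * √τ₀ * ρ with hs
  have hs0 : 0 < s := by positivity
  set m := μ.real Set.univ with hm
  set C := 2 * Real.exp 1 * 2 ^ N with hC
  -- where the weight may be positive, `|ξ|` is so small that all characters are nearly constant on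
  -- the ball, so that the Fourier transform of `μ` is comparable with the total mass
  have hpt : ∀ δ : ℝ, 0 < δ → δ ≤ ρ ^ 2 → ∀ ξ : EuclideanSpace ℝ (Fin d),
      m ^ 2 * spectralWeight d N (s ^ 2 / 4 * ‖ξ‖ ^ 2) ≤
        C * (fourierSq μ ξ * Real.exp (-δ * ‖ξ‖ ^ 2)) := by
    intro δ hδ hδρ ξ
    have hq := fourierSq_nonneg μ ξ
    rcases le_or_gt τ₀ (s ^ 2 / 4 * ‖ξ‖ ^ 2) with h | h
    · exact (mul_nonpos_of_nonneg_of_nonpos (sq_nonneg _) (hN _ h)).trans (by positivity)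
    · have h1 : s ^ 2 = 16 * τ₀ * ρ ^ 2 := by rw [hs, mul_pow, mul_pow, hsq2]; norm_num
      have h2 : (‖ξ‖ * (2 * ρ)) ^ 2 ≤ 1 := by
        rw [h1] at h
        have : τ₀ * (‖ξ‖ * (2 * ρ)) ^ 2 < τ₀ * 1 := by linarith
        exact (lt_of_mul_lt_mul_left this hτ0.le).le
      have h3 : ‖ξ‖ * (2 * ρ) ≤ 1 := by
        rw [sq_le_one_iff_abs_le_one] at h2
        exact (le_abs_self _).trans h2
      have h4 := half_le_fourierSq hμ h3
      have h5 := (_root_.abs_le.1 (abs_spectralWeight_le d N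
        (show 0 ≤ s ^ 2 / 4 * ‖ξ‖ ^ 2 by positivity))).2
      have h6 : Real.exp (-1) ≤ Real.exp (-δ * ‖ξ‖ ^ 2) := by
        rw [Real.exp_le_exp]
        have : δ * ‖ξ‖ ^ 2 ≤ ρ ^ 2 * ‖ξ‖ ^ 2 := by gcongr
        nlinarith
      calc m ^ 2 * spectralWeight d N (s ^ 2 / 4 * ‖ξ‖ ^ 2) ≤ m ^ 2 * 2 ^ N := by gcongr
        _ = C * (m ^ 2 / 2 * Real.exp (-1)) := by
            rw [hC, Real.exp_neg]; field_simp
        _ ≤ _ := by gcongr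
  have hmain : ∀ δ : ℝ, 0 < δ → δ ≤ ρ ^ 2 →
      m ^ 2 * ((4 * Real.pi / s ^ 2) ^ (d / 2 : ℝ) *
        ∫ z, K z * Real.exp (-δ * ‖z‖ ^ 2) * annularBump N (s⁻¹ • z)) ≤
      C * ∫ r, gaussSmooth K δ (r.1 - r.2) ∂(μ.prod μ) := by
    intro δ hδ hδρ
    obtain ⟨i1, e1⟩ := hK.integral_regSpectral_mul_spectralWeight hδ hs0 N
    have i2 := hK.integrable_regSpectral_mul hδ hδ (continuous_fourierSq μ) (abs_fourierSq_le μ)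
    have i3 : Integrable (fun q : EuclideanSpace ℝ (Fin d) ×
        (EuclideanSpace ℝ (Fin d) × EuclideanSpace ℝ (Fin d)) =>
        regSpectral K δ q.1 * (Real.cos ⟪q.1, q.2.1 - q.2.2⟫ * Real.exp (-δ * ‖q.1‖ ^ 2)))
        (volume.prod (μ.prod μ)) := by
      have hrc := hK.continuous_regSpectral hδ
      refine (((integrable_exp_neg_mul_sq_norm hδ).const_mul
        (∫ z, |K z * Real.exp (-δ * ‖z‖ ^ 2)|)).mul_prod (integrable_const (1 : ℝ))).mono'
        (by fun_prop : Continuous _).aestronglyMeasurable (ae_of_all _ fun q => ?_)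
      rw [norm_mul, norm_mul, Real.norm_of_nonneg (Real.exp_pos _).le, mul_one]
      have h1 := hK.abs_regSpectral_le hδ q.1
      have h2 := Real.abs_cos_le_one ⟪q.1, q.2.1 - q.2.2⟫
      exact mul_le_mul h1 (mul_le_of_le_one_left (Real.exp_pos _).le h2) (by positivity)
        ((abs_nonneg _).trans h1)
    rw [← e1, ← integral_const_mul]
    have h2 : ∫ r, gaussSmooth K δ (r.1 - r.2) ∂(μ.prod μ)
        = ∫ ξ, regSpectral K δ ξ * (fourierSq μ ξ * Real.exp (-δ * ‖ξ‖ ^ 2)) := by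
      simp_rw [← hK.integral_regSpectral_eq_gaussSmooth hδ]
      rw [← integral_integral_swap i3]
      congr 1
      ext ξ
      rw [integral_const_mul, integral_mul_const]
      rfl
    rw [h2, ← integral_const_mul]
    refine integral_mono (i1.const_mul _) (i2.const_mul _) fun ξ => ?_
    have h3 := mul_le_mul_of_nonneg_left (hpt δ hδ hδρ ξ) (hK.regSpectral_nonneg hδ ξ)
    simp only
    linarith
  -- remove the Gaussian regularization on both sides
  set δ : ℕ → ℝ := fun n => ρ ^ 2 * (1 / (n + 1 : ℝ)) with hδdef
  have hδ0 : ∀ n, 0 < δ n := fun n => by positivity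
  have hδρ : ∀ n, δ n ≤ ρ ^ 2 := fun n => by
    refine mul_le_of_le_one_right (by positivity) ?_
    rw [div_le_one (by positivity)]
    linarith [Nat.cast_nonneg (α := ℝ) n]
  have hδlim : Tendsto δ atTop (𝓝 0) := by
    have := (tendsto_one_div_add_atTop_nhds_zero_nat (𝕜 := ℝ)).const_mul (ρ ^ 2)
    rwa [mul_zero] at this
  have hL : Tendsto (fun n => m ^ 2 * ((4 * Real.pi / s ^ 2) ^ (d / 2 : ℝ) *
        ∫ z, K z * Real.exp (-(δ n) * ‖z‖ ^ 2) * annularBump N (s⁻¹ • z))) atTop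
      (𝓝 (m ^ 2 * ((4 * Real.pi / s ^ 2) ^ (d / 2 : ℝ) *
        ∫ z, K z * 1 * annularBump N (s⁻¹ • z)))) := by
    have hbc := continuous_annularBump (d := d) N
    refine Tendsto.const_mul _ (Tendsto.const_mul _ ?_)
    refine tendsto_integral_of_dominated_convergence
      (fun z => K 0 * annularBump N (s⁻¹ • z))
      (fun n => (by fun_prop : Continuous _).aestronglyMeasurable)
      (((integrable_annularBump N).comp_smul (inv_ne_zero hs0.ne')).const_mul _)
      (fun n => ae_of_all _ fun z => ?_) (ae_of_all _ fun z => ?_)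
    · rw [norm_mul, norm_mul, Real.norm_of_nonneg (annularBump_nonneg _ _),
        Real.norm_of_nonneg (Real.exp_pos _).le]
      refine mul_le_mul_of_nonneg_right ?_ (annularBump_nonneg _ _)
      refine (mul_le_of_le_one_right (norm_nonneg _) ?_).trans (hK.abs_le _)
      rw [Real.exp_le_one_iff, neg_mul, Left.neg_nonpos_iff]
      have := hδ0 n
      positivity
    · refine Tendsto.mul_const _ (Tendsto.const_mul _ ?_)
      have h4 : Continuous fun t : ℝ => Real.exp (-t * ‖z‖ ^ 2) := by fun_prop
      have h5 := (h4.tendsto 0).comp hδlim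
      simpa [Function.comp_def] using h5
  have hR : Tendsto (fun n => C * ∫ r, gaussSmooth K (δ n) (r.1 - r.2) ∂(μ.prod μ)) atTop
      (𝓝 (C * ∫ r, (4 * Real.pi) ^ (d / 2 : ℝ) * (K (r.1 - r.2) * Real.pi ^ (d / 2 : ℝ))
        ∂(μ.prod μ))) := by
    refine Tendsto.const_mul _ ?_
    refine tendsto_integral_of_dominated_convergence _ (fun n => ?_) (integrable_const _)
      (fun n => ae_of_all _ fun r => hK.abs_gaussSmooth_le (hδ0 n) _)
      (ae_of_all _ fun r => hK.tendsto_gaussSmooth hδ0 hδlim _)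
    have h6 : Continuous (gaussSmooth K (δ n)) := by
      unfold gaussSmooth
      refine continuous_const.mul (continuous_of_dominated
        (bound := fun v => K 0 * Real.exp (-1 * ‖v‖ ^ 2))
        (fun w => (by fun_prop : Continuous _).aestronglyMeasurable)
        (fun w => ae_of_all _ fun v => ?_)
        ((integrable_exp_neg_mul_sq_norm one_pos).const_mul _) (ae_of_all _ fun v => by fun_prop))
      rw [norm_mul, norm_mul, Real.norm_of_nonneg (Real.exp_pos _).le,
        Real.norm_of_nonneg (Real.exp_pos _).le]
      gcongr
      refine (mul_le_of_le_one_right (norm_nonneg _) ?_).trans (hK.abs_le _)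
      rw [Real.exp_le_one_iff, neg_mul, Left.neg_nonpos_iff]
      have := hδ0 n
      positivity
    exact (h6.comp (by fun_prop)).aestronglyMeasurable
  have hfin := le_of_tendsto_of_tendsto' hL hR fun n => hmain (δ n) (hδ0 n) (hδρ n)
  have i4 : Integrable (fun r : EuclideanSpace ℝ (Fin d) × EuclideanSpace ℝ (Fin d) =>
      K (r.1 - r.2)) (μ.prod μ) :=
    (integrable_const (K 0)).mono' (by fun_prop : Continuous _).aestronglyMeasurable
      (ae_of_all _ fun r => hK.abs_le _)
  rw [integral_const_mul, integral_mul_const, integral_prod _ i4,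
    integral_eq_pow_mul_integral_smul hs0, ← mul_assoc (_ ^ (d / 2 : ℝ)),
    rpow_div_sq_mul_pow (by positivity) hs0] at hfin
  simp_rw [mul_one, inv_smul_smul₀ hs0.ne'] at hfin
  have hpos : 0 < (4 * Real.pi) ^ (d / 2 : ℝ) := by have := Real.pi_pos; positivity
  refine le_of_mul_le_mul_left ?_ hpos
  calc (4 * Real.pi) ^ (d / 2 : ℝ) * (m ^ 2 * ∫ v, K (s • v) * annularBump N v)
      = m ^ 2 * ((4 * Real.pi) ^ (d / 2 : ℝ) * ∫ v, K (s • v) * annularBump N v) := by ring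
    _ ≤ _ := hfin
    _ = _ := by ring

end EnergyBound

/-! ### Energies for a regularly varying covariance -/

section PowerComparison

variable {k : ℝ → ℝ} {α : ℝ}

lemma RegularlyVarying.rpow_isLittleO (hk : RegularlyVarying k α) {β : ℝ} (hβ : α < β) :
    (fun x => x ^ (-β)) =o[atTop] k := by
  obtain ⟨C, hC, X, hX, h⟩ := hk.exists_potter (half_pos (sub_pos.2 hβ))
  have hkX := (h X le_rfl).1
  set θ := (β - α) / 2 with hθ
  have h1 : (fun x => x ^ (-(α + θ))) =O[atTop] k := by
    refine IsBigO.of_bound (C * X ^ (-(α + θ)) / k X) ?_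
    filter_upwards [eventually_ge_atTop X] with x hx
    have hx0 : 0 < x := hX.trans_le hx
    have h2 := ((h X le_rfl).2 x hx).2
    have h3 := (h x hx).1
    rw [Real.norm_of_nonneg (by positivity), Real.norm_of_nonneg h3.le, Real.rpow_neg hx0.le,
      Real.rpow_neg hX.le]
    rw [Real.div_rpow hx0.le hX.le] at h2
    have h4 : 0 < x ^ (α + θ) := by positivity
    have h5 : 0 < X ^ (α + θ) := by positivity
    field_simp
    field_simp at h2
    linarith
  refine IsLittleO.trans_isBigO ?_ h1
  refine isLittleO_of_tendsto' ?_ ?_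
  · filter_upwards [eventually_gt_atTop 0] with x hx h
    exact absurd h (Real.rpow_pos_of_pos hx _).ne'
  · refine (tendsto_rpow_neg_atTop (half_pos (sub_pos.2 hβ))).congr' ?_
    filter_upwards [eventually_gt_atTop 0] with x hx
    rw [← Real.rpow_sub hx, hθ]
    congr 1
    ring

lemma RegularlyVarying.isBigO_rpow (hk : RegularlyVarying k α) {β : ℝ} (hβ : β < α) :
    k =O[atTop] (fun x => x ^ (-β)) := by
  obtain ⟨C, hC, X, hX, h⟩ := hk.exists_potter (sub_pos.2 hβ)
  refine IsBigO.of_bound (C * X ^ β * k X) ?_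
  filter_upwards [eventually_ge_atTop X] with x hx
  have hx0 : 0 < x := hX.trans_le hx
  have h2 := ((h X le_rfl).2 x hx).1
  have h3 := (h x hx).1
  rw [Real.norm_of_nonneg h3.le, Real.norm_of_nonneg (by positivity)]
  refine h2.trans_eq ?_
  rw [show -α + (α - β) = -β by ring, Real.div_rpow hx0.le hX.le, Real.rpow_neg hX.le]
  field_simp

end PowerComparison

section RadialEnergy

variable {d : ℕ} {k : ℝ → ℝ} {α : ℝ}

/-- The average of the covariance against the bump at scale `s` has at least the order of its value
at distance `s`: the unknown values near the origin are damped by the zero of the bump. -/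
lemma RegularlyVarying.exists_le_integral_annularBump (hd : 1 ≤ d) (hk : RegularlyVarying k α)
    (hα : 0 ≤ α) (hK : IsPosDefFun fun z : EuclideanSpace ℝ (Fin d) => k ‖z‖) {N : ℕ}
    (hN : α < 2 * N) :
    ∃ c > 0, ∃ R > 0, ∀ s ≥ R, c * k s ≤
      ∫ v : EuclideanSpace ℝ (Fin d), k ‖s • v‖ * annularBump N v := by
  obtain ⟨X₀, hX₀, hpos⟩ := hk.exists_pos
  obtain ⟨c₁, hc₁, X₁, hX₁, hcomp⟩ := hk.exists_comparable hα (A := 2) one_le_two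
  have hk0 : ∀ z : EuclideanSpace ℝ (Fin d), |k ‖z‖| ≤ k 0 := fun z => by
    have := hK.abs_le z
    simpa using this
  have hk00 : 0 ≤ k 0 := (abs_nonneg _).trans (hk0 0)
  set A : Set (EuclideanSpace ℝ (Fin d)) := {v | 1 < ‖v‖ ∧ ‖v‖ < 2} with hA
  have hAo : IsOpen A :=
    (isOpen_lt continuous_const continuous_norm).inter (isOpen_lt continuous_norm continuous_const)
  have hAne : A.Nonempty := by
    refine ⟨EuclideanSpace.single ⟨0, hd⟩ (3 / 2 : ℝ), ?_⟩
    simp only [hA, Set.mem_ofPred_eq, PiLp.norm_single, Real.norm_eq_abs]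
    rw [abs_of_pos (by norm_num)]
    constructor <;> norm_num
  have hbi := integrable_annularBump (d := d) N
  have hbc := continuous_annularBump (d := d) N
  set I := ∫ v in A, annularBump N v with hI
  have hI0 : 0 < I := by
    rw [hI, setIntegral_pos_iff_support_of_nonneg_ae
      (ae_of_all _ fun v => annularBump_nonneg N v) hbi.integrableOn]
    refine lt_of_lt_of_le (hAo.measure_pos volume hAne) (measure_mono fun v hv => ⟨?_, hv⟩)
    rw [Function.mem_support]
    have hv1 : 0 < 1 - Real.exp (-‖v‖ ^ 2) := by
      rw [sub_pos, Real.exp_lt_one_iff]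
      have := hv.1
      simp only [Left.neg_neg_iff]; positivity
    exact (mul_pos (Real.exp_pos _) (pow_pos hv1 N)).ne'
  set J := ∫ v : EuclideanSpace ℝ (Fin d), Real.exp (-1 * ‖v‖ ^ 2) with hJ
  have hJ0 : 0 ≤ J := integral_nonneg fun v => (Real.exp_pos _).le
  have hlit := (hk.rpow_isLittleO hN).bound
    (show 0 < c₁ * I / 2 / (k 0 * X₀ ^ (2 * N) * J + 1) by positivity)
  obtain ⟨R, hR⟩ := eventually_atTop.1 hlit
  refine ⟨c₁ * I / 2, by positivity, max R (max (X₀ + 1) X₁),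
    lt_max_of_lt_right (lt_max_of_lt_right hX₁), fun s hs => ?_⟩
  have hsX₀ : X₀ < s := by
    linarith [(le_max_left (X₀ + 1) X₁).trans ((le_max_right R _).trans hs)]
  have hsX₁ : X₁ ≤ s := (le_max_right (X₀ + 1) X₁).trans ((le_max_right R _).trans hs)
  have hs0 : 0 < s := hX₀.trans hsX₀
  have hks := hpos s hsX₀.le
  -- `|s v| < X₀` is the region where nothing is known beyond `|k| ≤ k 0`; there the bump is at
  -- most `(X₀ / s) ^ (2 N)`, which is negligible against `k s`
  have hpt : ∀ v : EuclideanSpace ℝ (Fin d),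
      c₁ * k s * A.indicator (annularBump N) v -
        k 0 * (X₀ / s) ^ (2 * N) * Real.exp (-1 * ‖v‖ ^ 2) ≤ k ‖s • v‖ * annularBump N v := by
    intro v
    have hb := annularBump_nonneg N v
    have hE : 0 ≤ k 0 * (X₀ / s) ^ (2 * N) * Real.exp (-1 * ‖v‖ ^ 2) := by positivity
    have hns : ‖s • v‖ = s * ‖v‖ := by rw [norm_smul, Real.norm_of_nonneg hs0.le]
    rcases lt_or_ge ‖v‖ (X₀ / s) with hv | hv
    · have hvA : v ∉ A := fun h => by
        have : X₀ / s < 1 := by rw [div_lt_one hs0]; exact hsX₀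
        linarith [h.1]
      rw [Set.indicator_of_notMem hvA, mul_zero, zero_sub]
      have h1 : annularBump N v ≤ (X₀ / s) ^ (2 * N) * Real.exp (-1 * ‖v‖ ^ 2) := by
        rw [annularBump, neg_one_mul, mul_comm, pow_mul]
        have h2 : 1 - Real.exp (-‖v‖ ^ 2) ≤ (X₀ / s) ^ 2 := by
          have h3 := Real.add_one_le_exp (-‖v‖ ^ 2)
          have h4 : ‖v‖ ^ 2 ≤ (X₀ / s) ^ 2 := by gcongr
          linarith
        have h5 := (one_sub_exp_mem v).1
        gcongr
      have h6 := (_root_.abs_le.1 (hk0 (s • v))).1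
      calc -(k 0 * (X₀ / s) ^ (2 * N) * Real.exp (-1 * ‖v‖ ^ 2))
          ≤ -(k 0 * annularBump N v) := by
            rw [neg_le_neg_iff, mul_assoc]; gcongr
        _ = -k 0 * annularBump N v := by ring
        _ ≤ _ := by gcongr
    · have h1 : X₀ ≤ s * ‖v‖ := by rwa [div_le_iff₀' hs0] at hv
      have hkv := hpos _ h1
      rw [hns]
      by_cases hvA : v ∈ A
      · rw [Set.indicator_of_mem hvA]
        have h2 := hcomp s hsX₁ (s * ‖v‖) (by nlinarith [hvA.1]) (by nlinarith [hvA.2])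
        have h3 : c₁ * k s * annularBump N v ≤ k (s * ‖v‖) * annularBump N v := by gcongr
        linarith
      · rw [Set.indicator_of_notMem hvA, mul_zero, zero_sub]
        have : 0 ≤ k (s * ‖v‖) * annularBump N v := by positivity
        linarith
  have hc := hK.continuous
  have i1 : Integrable fun v : EuclideanSpace ℝ (Fin d) => k ‖s • v‖ * annularBump N v :=
    hbi.bdd_mul (c := k 0) (hc.comp (continuous_const_smul s)).aestronglyMeasurable
      (ae_of_all _ fun v => hk0 _)
  have i2 : Integrable fun v : EuclideanSpace ℝ (Fin d) =>
      c₁ * k s * A.indicator (annularBump N) v :=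
    (hbi.indicator hAo.measurableSet).const_mul _
  have i3 : Integrable fun v : EuclideanSpace ℝ (Fin d) =>
      k 0 * (X₀ / s) ^ (2 * N) * Real.exp (-1 * ‖v‖ ^ 2) :=
    (integrable_exp_neg_mul_sq_norm one_pos).const_mul _
  have h1 := integral_mono (i2.sub i3) i1 hpt
  refine le_trans ?_ h1
  rw [integral_sub' i2 i3, integral_const_mul, integral_const_mul, integral_indicator
    hAo.measurableSet]
  have h2 := hR s ((le_max_left _ _).trans hs)
  rw [Real.norm_of_nonneg (by positivity), Real.norm_of_nonneg hks.le] at h2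
  have h3 : (X₀ / s) ^ (2 * N) = X₀ ^ (2 * N) * s ^ (-(2 * N : ℝ)) := by
    rw [div_pow, Real.rpow_neg hs0.le, div_eq_mul_inv]
    congr 2
    rw [← Real.rpow_natCast]; push_cast; rfl
  have h4 : k 0 * (X₀ / s) ^ (2 * N) * J ≤ c₁ * I / 2 * k s := by
    have hD : 0 < k 0 * X₀ ^ (2 * N) * J + 1 := by positivity
    calc k 0 * (X₀ / s) ^ (2 * N) * J = (k 0 * X₀ ^ (2 * N) * J) * s ^ (-(2 * N : ℝ)) := by
          rw [h3]; ring
      _ ≤ (k 0 * X₀ ^ (2 * N) * J + 1) * (c₁ * I / 2 / (k 0 * X₀ ^ (2 * N) * J + 1) * k s) := by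
          gcongr; linarith
      _ = _ := by field_simp
  linarith

/-- The energy of a measure carried by a large ball is bounded below by the covariance at the scale
of the radius. -/
theorem RegularlyVarying.exists_energy_ge (hd : 1 ≤ d) (hk : RegularlyVarying k α)
    (hα : 0 ≤ α) (hK : IsPosDefFun fun z : EuclideanSpace ℝ (Fin d) => k ‖z‖) :
    ∃ c > 0, ∃ R > 0, ∀ ρ ≥ R, ∀ (z₀ : EuclideanSpace ℝ (Fin d))
      (μ : Measure (EuclideanSpace ℝ (Fin d))) [IsFiniteMeasure μ],
      μ (Metric.closedBall z₀ ρ)ᶜ = 0 →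
        c * k ρ * μ.real Set.univ ^ 2 ≤ ∫ x, ∫ y, k ‖x - y‖ ∂μ ∂μ := by
  set N : ℕ := 2 * ⌈α⌉₊ + 1 with hNdef
  have hNodd : Odd N := ⟨⌈α⌉₊, rfl⟩
  have hNα : α < 2 * N := by
    have := Nat.le_ceil α
    rw [hNdef]; push_cast; linarith
  obtain ⟨τ₀, hτ₀, hτ⟩ := exists_spectralWeight_nonpos d hNodd
  obtain ⟨c, hc, R, hR, hbump⟩ := hk.exists_le_integral_annularBump hd hα hK hNα
  have hA : 1 ≤ 4 * √τ₀ := by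
    have : 1 ≤ √τ₀ := Real.one_le_sqrt.2 hτ₀
    linarith
  obtain ⟨c', hc', R', hR', hcomp⟩ := hk.exists_comparable hα hA
  have hpi := Real.pi_pos
  set C := 2 * Real.exp 1 * 2 ^ N * Real.pi ^ (d / 2 : ℝ) with hC
  have hC0 : 0 < C := by positivity
  refine ⟨c * c' / C, by positivity, max R R', lt_max_of_lt_left hR, fun ρ hρ z₀ μ _ hμ => ?_⟩
  have hρR : R ≤ ρ := (le_max_left _ _).trans hρ
  have hρ0 : 0 < ρ := hR.trans_le hρR
  have h1 := hK.integral_annularBump_le hτ₀ hτ μ hρ0 hμ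
  have h2 := hbump (4 * √τ₀ * ρ) (by nlinarith)
  have h3 := hcomp ρ ((le_max_right _ _).trans hρ) (4 * √τ₀ * ρ) (by nlinarith) le_rfl
  have h4 : μ.real Set.univ ^ 2 * (c * (c' * k ρ)) ≤ C * ∫ x, ∫ y, k ‖x - y‖ ∂μ ∂μ := by
    refine le_trans ?_ h1
    refine mul_le_mul_of_nonneg_left (le_trans ?_ h2) (sq_nonneg _)
    gcongr
  rw [div_mul_eq_mul_div, div_mul_eq_mul_div, div_le_iff₀ hC0]
  linarith

/-- For a slowly varying covariance, the uniform measure on a segment of length `x` has energy at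
most of order `k x`. -/
lemma RegularlyVarying.exists_segment_energy_le (hd : 1 ≤ d) (hk : RegularlyVarying k 0)
    (hK : IsPosDefFun fun z : EuclideanSpace ℝ (Fin d) => k ‖z‖) :
    ∃ C > 0, ∃ X > 0, ∀ x ≥ X, ∃ μ : Measure (EuclideanSpace ℝ (Fin d)), IsProbabilityMeasure μ ∧
      μ (Metric.closedBall 0 x)ᶜ = 0 ∧ ∫ y, ∫ z, k ‖y - z‖ ∂μ ∂μ ≤ C * k x := by
  obtain ⟨C, hC, X, hX, hpot⟩ := hk.exists_potter (θ := 1 / 2) (by norm_num)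
  have hk0 : ∀ t : ℝ, 0 ≤ t → |k t| ≤ k 0 := fun t ht => by
    have := hK.abs_le (EuclideanSpace.single ⟨0, hd⟩ t)
    simpa [abs_of_nonneg ht] using this
  have hk00 : 0 ≤ k 0 := (abs_nonneg _).trans (hk0 0 le_rfl)
  have hlit := (hk.rpow_isLittleO (β := 1 / 2) (by norm_num)).bound
    (show 0 < 1 / (k 0 * X ^ (1 / 2 : ℝ) + 1) by positivity)
  obtain ⟨R, hR⟩ := eventually_atTop.1 hlit
  -- the majorant `|t| ^ (-1/2)` on `[-1, 1]`, which is integrable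
  set ψ : ℝ → ℝ := (Set.Ioc (0 : ℝ) 1).indicator fun t => t ^ (-(1 / 2) : ℝ) with hψ
  have hψ0 : ∀ t, 0 ≤ ψ t := fun t =>
    Set.indicator_nonneg (fun t ht => Real.rpow_nonneg ht.1.le _) t
  have hψi : Integrable ψ := by
    rw [hψ, integrable_indicator_iff measurableSet_Ioc,
      ← intervalIntegrable_iff_integrableOn_Ioc_of_le zero_le_one]
    exact intervalIntegral.intervalIntegrable_rpow' (by norm_num)
  set Ψ : ℝ → ℝ := fun t => ψ t + ψ (-t) with hΨ
  have hΨi : Integrable Ψ := hψi.add hψi.comp_neg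
  have hΨ0 : ∀ t, 0 ≤ Ψ t := fun t => add_nonneg (hψ0 _) (hψ0 _)
  have hΨv : ∀ t, t ≠ 0 → |t| ≤ 1 → |t| ^ (-(1 / 2) : ℝ) ≤ Ψ t := fun t h0 h1 => by
    rcases lt_or_gt_of_ne h0 with h | h
    · rw [abs_of_neg h] at h1 ⊢
      have : ψ (-t) = (-t) ^ (-(1 / 2) : ℝ) := Set.indicator_of_mem
        (show -t ∈ Set.Ioc (0 : ℝ) 1 from ⟨by linarith, h1⟩) _
      rw [← this]
      exact le_add_of_nonneg_left (hψ0 t)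
    · rw [abs_of_pos h] at h1 ⊢
      have : ψ t = t ^ (-(1 / 2) : ℝ) := Set.indicator_of_mem
        (show t ∈ Set.Ioc (0 : ℝ) 1 from ⟨h, h1⟩) _
      rw [← this]
      exact le_add_of_nonneg_right (hψ0 _)
  set S := ∫ t, Ψ t with hS
  have hS0 : 0 ≤ S := integral_nonneg hΨ0
  refine ⟨(C + 1) * S + 1, by positivity, max X R, lt_max_of_lt_left hX, fun x hx => ?_⟩
  have hxX : X ≤ x := (le_max_left _ _).trans hx
  have hx0 : 0 < x := hX.trans_le hxX
  have hkx := (hpot x hxX).1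
  -- Potter's bound, extended to small arguments by `|k| ≤ k 0` and `x ^ (-1/2) = o(k x)`
  have hkey : ∀ t, 0 < t → t ≤ 1 → k (x * t) ≤ (C + 1) * k x * t ^ (-(1 / 2) : ℝ) := by
    intro t ht ht1
    have htp : 0 < t ^ (-(1 / 2) : ℝ) := by positivity
    rcases le_or_gt X (x * t) with h | h
    · have h1 := ((hpot (x * t) h).2 x (by nlinarith)).2
      rw [show x / (x * t) = t⁻¹ by field_simp, zero_add, Real.inv_rpow ht.le,
        ← Real.rpow_neg ht.le] at h1
      calc k (x * t) ≤ C * t ^ (-(1 / 2) : ℝ) * k x := h1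
        _ ≤ (C + 1) * t ^ (-(1 / 2) : ℝ) * k x := by gcongr; linarith
        _ = _ := by ring
    · have h1 := (le_abs_self _).trans (hk0 (x * t) (by positivity))
      have h2 := hR x ((le_max_right _ _).trans hx)
      rw [Real.norm_of_nonneg (by positivity), Real.norm_of_nonneg hkx.le] at h2
      have h3 : t < X / x := by rwa [lt_div_iff₀' hx0]
      have h4 : (X / x) ^ (-(1 / 2) : ℝ) ≤ t ^ (-(1 / 2) : ℝ) :=
        Real.rpow_le_rpow_of_nonpos ht h3.le (by norm_num)
      have h5 : (X / x) ^ (-(1 / 2) : ℝ) * (X ^ (1 / 2 : ℝ) * x ^ (-(1 / 2) : ℝ)) = 1 := by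
        rw [Real.div_rpow hX.le hx0.le, Real.rpow_neg hX.le]
        have h6 : 0 < x ^ (-(1 / 2) : ℝ) := by positivity
        have h7 : 0 < X ^ (1 / 2 : ℝ) := by positivity
        field_simp
      have h8 : k 0 ≤ k x * (X / x) ^ (-(1 / 2) : ℝ) := by
        have h9 : 0 < (X / x) ^ (-(1 / 2) : ℝ) := by positivity
        calc k 0 = (k 0 * X ^ (1 / 2 : ℝ)) * x ^ (-(1 / 2) : ℝ) * (X / x) ^ (-(1 / 2) : ℝ) := by
              linear_combination (-k 0) * h5
          _ ≤ (k 0 * X ^ (1 / 2 : ℝ) + 1) * (1 / (k 0 * X ^ (1 / 2 : ℝ) + 1) * k x) *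
                (X / x) ^ (-(1 / 2) : ℝ) := by gcongr; linarith
          _ = _ := by field_simp
      calc k (x * t) ≤ k x * (X / x) ^ (-(1 / 2) : ℝ) := h1.trans h8
        _ ≤ k x * t ^ (-(1 / 2) : ℝ) := by gcongr
        _ ≤ (C + 1) * k x * t ^ (-(1 / 2) : ℝ) := by
            gcongr
            exact le_mul_of_one_le_left hkx.le (by linarith)
  set e : EuclideanSpace ℝ (Fin d) := EuclideanSpace.single ⟨0, hd⟩ 1 with he
  have hnorm : ‖e‖ = 1 := by simp [he]
  set φ : ℝ → EuclideanSpace ℝ (Fin d) := fun t => (x * t) • e with hφ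
  have hφc : Continuous φ := by fun_prop
  have hφn : ∀ a b, ‖φ a - φ b‖ = x * |a - b| := fun a b => by
    simp only [hφ]
    rw [← sub_smul, norm_smul, hnorm, mul_one, ← mul_sub, norm_mul, Real.norm_of_nonneg hx0.le,
      Real.norm_eq_abs]
  have hc := hK.continuous
  have hνp : IsProbabilityMeasure (volume.restrict (Set.Icc (0 : ℝ) 1)) :=
    ⟨by simp⟩
  refine ⟨(volume.restrict (Set.Icc (0 : ℝ) 1)).map φ,
    Measure.isProbabilityMeasure_map hφc.aemeasurable, ?_, ?_⟩
  · rw [Measure.map_apply hφc.measurable Metric.isClosed_closedBall.measurableSet.compl,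
      Measure.restrict_apply (hφc.measurable Metric.isClosed_closedBall.measurableSet.compl)]
    convert! measure_empty (μ := volume)
    ext t
    simp only [Set.mem_inter_iff, Set.mem_preimage, Set.mem_compl_iff, mem_closedBall_zero_iff,
      Set.mem_empty_iff_false, iff_false, not_and, hφ, norm_smul, hnorm, mul_one, norm_mul,
      Real.norm_of_nonneg hx0.le]
    rintro h1 ⟨h2, h3⟩
    rw [Real.norm_of_nonneg h2] at h1
    exact h1 (mul_le_of_le_one_right hx0.le h3)
  · have hinner : ∀ y : EuclideanSpace ℝ (Fin d),
        ∫ z, k ‖y - z‖ ∂((volume.restrict (Set.Icc (0 : ℝ) 1)).map φ)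
        = ∫ b in Set.Icc (0 : ℝ) 1, k ‖y - φ b‖ := fun y =>
      integral_map hφc.aemeasurable
        (hc.comp (by fun_prop : Continuous fun z => y - z)).aestronglyMeasurable
    simp_rw [hinner]
    have hcont : Continuous fun y : EuclideanSpace ℝ (Fin d) =>
        ∫ b in Set.Icc (0 : ℝ) 1, k ‖y - φ b‖ :=
      continuous_of_dominated (F := fun y b => k ‖y - φ b‖) (bound := fun _ => k 0)
        (fun y => (hc.comp (by fun_prop : Continuous fun b => y - φ b)).aestronglyMeasurable)
        (fun y => ae_of_all _ fun b => by
          rw [Real.norm_eq_abs]; exact hk0 _ (norm_nonneg _)) (integrable_const _)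
        (ae_of_all _ fun b => hc.comp (by fun_prop : Continuous fun y => y - φ b))
    rw [integral_map hφc.aemeasurable hcont.aestronglyMeasurable]
    simp_rw [hφn]
    have hin : ∀ a ∈ Set.Icc (0 : ℝ) 1,
        ∫ b in Set.Icc (0 : ℝ) 1, k (x * |a - b|) ≤ (C + 1) * k x * S := by
      intro a ha
      have i1 : Integrable fun b => (C + 1) * k x * Ψ (a - b) := (hΨi.comp_sub_left a).const_mul _
      have i2 : IntegrableOn (fun b => k (x * |a - b|)) (Set.Icc (0 : ℝ) 1) := by
        have h1 : Continuous fun b => k ‖φ a - φ b‖ :=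
          hc.comp (by fun_prop : Continuous fun b => φ a - φ b)
        simp_rw [hφn] at h1
        exact h1.integrableOn_Icc
      calc ∫ b in Set.Icc (0 : ℝ) 1, k (x * |a - b|)
          ≤ ∫ b in Set.Icc (0 : ℝ) 1, (C + 1) * k x * Ψ (a - b) := by
            refine integral_mono_ae i2 i1.integrableOn ?_
            have h1 : ∀ᵐ b : ℝ, b ≠ a := by
              simp [ae_iff]
            rw [Filter.EventuallyLE, ae_restrict_iff' measurableSet_Icc]
            filter_upwards [h1] with b hb hb01
            have h2 : a - b ≠ 0 := sub_ne_zero.2 hb.symm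
            have h3 : |a - b| ≤ 1 := by
              rw [_root_.abs_le]; constructor <;> linarith [ha.1, ha.2, hb01.1, hb01.2]
            calc k (x * |a - b|) ≤ (C + 1) * k x * |a - b| ^ (-(1 / 2) : ℝ) :=
                  hkey _ (abs_pos.2 h2) h3
              _ ≤ _ := by
                  have := hΨv _ h2 h3
                  gcongr
        _ ≤ ∫ b, (C + 1) * k x * Ψ (a - b) :=
            setIntegral_le_integral i1 (ae_of_all _ fun b =>
              mul_nonneg (by positivity) (hΨ0 _))
        _ = (C + 1) * k x * S := by
            rw [integral_const_mul, integral_sub_left_eq_self Ψ volume a]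
    have h5 : ∫ a in Set.Icc (0 : ℝ) 1, ∫ b in Set.Icc (0 : ℝ) 1, k (x * |a - b|)
        ≤ ∫ _a in Set.Icc (0 : ℝ) 1, (C + 1) * k x * S := by
      refine setIntegral_mono_on ?_ (integrable_const _) measurableSet_Icc hin
      have h6 := (hcont.comp hφc).integrableOn_Icc (μ := volume) (a := 0) (b := 1)
      simpa [Function.comp_def, hφn] using h6
    refine h5.trans ?_
    simp only [integral_const, MeasurableSet.univ, measureReal_restrict_apply, Set.univ_inter,
      Real.volume_real_Icc, sub_zero, smul_eq_mul]
    rw [max_eq_left zero_le_one, one_mul]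
    linarith

/-- A regularly varying covariance is almost decreasing. When the index is `0` this rests on
positive definiteness: the ball of radius `y` carries the segment of length `x`. -/
theorem RegularlyVarying.exists_almost_antitone (hd : 1 ≤ d) (hk : RegularlyVarying k α)
    (hα : 0 ≤ α) (hK : IsPosDefFun fun z : EuclideanSpace ℝ (Fin d) => k ‖z‖) :
    ∃ C > 0, ∃ X > 0, ∀ x ≥ X, ∀ y ≥ x, k y ≤ C * k x := by
  rcases hα.eq_or_lt with h | h
  · subst h
    obtain ⟨c, hc, R, hR, hge⟩ := hk.exists_energy_ge hd le_rfl hK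
    obtain ⟨C, hC, X, hX, hle⟩ := hk.exists_segment_energy_le hd hK
    refine ⟨C / c, by positivity, max R X, lt_max_of_lt_left hR, fun x hx y hy => ?_⟩
    obtain ⟨μ, hμ, hμ0, hμE⟩ := hle x ((le_max_right _ _).trans hx)
    have h1 := hge y ((le_max_left _ _).trans (hx.le.trans hy)) 0 μ
      (measure_mono_null (Set.compl_subset_compl.2 (Metric.closedBall_subset_closedBall hy)) hμ0)
    rw [probReal_univ, one_pow, mul_one] at h1
    rw [div_mul_eq_mul_div, le_div_iff₀ hc]
    linarith
  · obtain ⟨C, hC, X, hX, hpot⟩ := hk.exists_potter h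
    refine ⟨C, hC, X, hX, fun x hx y hy => ?_⟩
    have := ((hpot x hx).2 y hy).1
    simpa using this

end RadialEnergy

section FieldCovariance

variable {d : ℕ} {k : ℝ → ℝ} {α : ℝ} {Ω : Type*} [MeasurableSpace Ω] {P : Measure Ω}
  {f : EuclideanSpace ℝ (Fin d) → Ω → ℝ}

lemma IsIsotropicGaussianField.isPosDefFun (hf : IsIsotropicGaussianField f P k)
    (hk : ContinuousOn k (Set.Ici 0)) :
    IsPosDefFun fun z : EuclideanSpace ℝ (Fin d) => k ‖z‖ where
  continuous := hk.comp_continuous continuous_norm fun z => norm_nonneg z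
  even z := by simp only [norm_neg]
  nonneg S a := by
    have h1 : ∀ x y, Integrable (fun ω => (a x * f x ω) * (a y * f y ω)) P := fun x y =>
      ((hf.memLp x).const_mul (a x)).integrable_mul ((hf.memLp y).const_mul (a y))
    have h2 : 0 ≤ ∫ ω, (∑ x ∈ S, a x * f x ω) ^ 2 ∂P := integral_nonneg fun ω => sq_nonneg _
    simp_rw [sq, Finset.sum_mul_sum] at h2
    rw [integral_finsetSum _ fun x _ => integrable_finsetSum _ fun y _ => h1 x y] at h2
    refine h2.trans_eq (Finset.sum_congr rfl fun x _ => ?_)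
    rw [integral_finsetSum _ fun y _ => h1 x y]
    refine Finset.sum_congr rfl fun y _ => ?_
    rw [← hf.covariance x y, ← integral_const_mul]
    congr 1
    ext ω
    ring

/-- A scale at which the covariance is much larger than at `L` is at most `L`. -/
lemma RegularlyVarying.eventually_le_of_isLittleO (hd : 1 ≤ d) (hk : RegularlyVarying k α)
    (hα : 0 ≤ α) (hK : IsPosDefFun fun z : EuclideanSpace ℝ (Fin d) => k ‖z‖) {s : ℝ → ℝ}
    (hks : k =o[atTop] fun L => k (s L)) : ∀ᶠ L in atTop, s L ≤ L := by
  obtain ⟨C, hC, X, hX, h⟩ := hk.exists_almost_antitone hd hα hK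
  obtain ⟨X', hX', hpos⟩ := hk.exists_pos
  filter_upwards [hks.bound (show 0 < 1 / (2 * C) by positivity), eventually_ge_atTop X,
    eventually_ge_atTop X'] with L h1 h2 h3
  by_contra hlt
  push Not at hlt
  have h4 := h L h2 (s L) hlt.le
  have h5 := hpos L h3
  rw [Real.norm_of_nonneg h5.le, Real.norm_of_nonneg (hpos _ (h3.trans hlt.le)).le] at h1
  have h6 : 1 / (2 * C) * k (s L) ≤ 1 / (2 * C) * (C * k L) := by gcongr
  have h7 : 1 / (2 * C) * (C * k L) = k L / 2 := by field_simp
  linarith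

lemma tendsto_zero_of_isLittleO (hd : 1 ≤ d)
    (hK : IsPosDefFun fun z : EuclideanSpace ℝ (Fin d) => k ‖z‖) {s : ℝ → ℝ}
    (hs : Tendsto s atTop atTop)
    (hks : k =o[atTop] fun L => k (s L)) : Tendsto k atTop (𝓝 0) := by
  rw [← isLittleO_one_iff ℝ]
  refine hks.trans_isBigO (IsBigO.of_bound (k 0) ?_)
  filter_upwards [hs.eventually_ge_atTop 0] with L hL
  have := hK.abs_le (EuclideanSpace.single ⟨0, hd⟩ (s L))
  simpa [abs_of_nonneg hL] using this

end FieldCovariance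

/-! ### The probability of simultaneous exceedance -/

section Exceedance

lemma ProbabilityTheory.HasSubgaussianMGF.mono {Ω : Type*} [MeasurableSpace Ω] {Q : Measure Ω}
    {X : Ω → ℝ} {v w : NNReal} (h : HasSubgaussianMGF X v Q) (hvw : v ≤ w) :
    HasSubgaussianMGF X w Q :=
  ⟨h.integrable_exp_mul, fun t => (h.mgf_le t).trans (by gcongr)⟩

variable {d : ℕ} {Ω : Type*} [MeasurableSpace Ω] {Q : Measure Ω}
  {g : EuclideanSpace ℝ (Fin d) → Ω → ℝ} {r : ℝ → ℝ}

/-- The probability that a continuous field exceeds `u` somewhere in every `D i`, where `D i` lies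
in the cube with corner `a i` and side `ρ`. The weighted sum of the maxima over the cubes splits
into the weighted sum of the corner values, of variance at most `VA`, and the weighted sum of the
maxima of the increments, which has mean at most `M` and fluctuates with variance proxy
`π ^ 2 / 4 * VR`. -/
theorem IsIsotropicGaussianField.measure_forall_exists_ge_le
    (hg : IsIsotropicGaussianField g Q r) (hcont : ∀ᵐ ω ∂Q, Continuous fun x => g x ω)
    {ι : Type*} [Fintype ι] {D : ι → Set (EuclideanSpace ℝ (Fin d))}
    {a : ι → EuclideanSpace ℝ (Fin d)} {ρ : ℝ} (hρ : 0 < ρ)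
    (hD : ∀ i, ∀ x ∈ D i, ∀ l, a i l ≤ x l ∧ x l ≤ a i l + ρ)
    {p : ι → ℝ} (hp : ∀ i, 0 ≤ p i) (hp1 : ∑ i, p i = 1) {M : ℝ}
    (hM : ∀ i m, Integrable (fun ω => Finset.univ.sup' Finset.univ_nonempty
        fun z : Fin d → Fin (2 ^ m) => g (cubePoint (a i) ρ m z) ω - g (a i) ω) Q ∧
      ∫ ω, Finset.univ.sup' Finset.univ_nonempty
        (fun z : Fin d → Fin (2 ^ m) => g (cubePoint (a i) ρ m z) ω - g (a i) ω) ∂Q ≤ M)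
    {b : ι → ι → ℝ}
    (hb : ∀ i j x y, ‖x - a i‖ ≤ √d * ρ → ‖y - a j‖ ≤ √d * ρ →
      r ‖x - y‖ - r ‖x - a j‖ - r ‖a i - y‖ + r ‖a i - a j‖ ≤ b i j)
    {VA VR : NNReal} (hVA : ∑ i, ∑ j, p i * p j * r ‖a i - a j‖ ≤ VA)
    (hVR : ∑ i, ∑ j, p i * p j * b i j ≤ VR) {u u₁ : ℝ} (h0 : 0 ≤ u₁) (hu : M + u₁ < u) :
    Q {ω | ∀ i, ∃ x ∈ D i, u ≤ g x ω} ≤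
      ENNReal.ofReal (Real.exp (-u₁ ^ 2 / (2 * (√VA + √(Real.pi ^ 2 / 4 * VR)) ^ 2))) := by
  have := hg.gaussian.isProbabilityMeasure
  obtain ⟨η, hη, hηu⟩ : ∃ η > 0, M + η + u₁ + η = u := ⟨(u - M - u₁) / 2, by linarith, by ring⟩
  set W : ℝ := (√VA + √(Real.pi ^ 2 / 4 * VR)) ^ 2 with hW
  -- a smooth majorant of the weighted sum of maxima at level `m`
  set β : ℕ → ℝ := fun m => (Real.log (Fintype.card (Fin d → Fin (2 ^ m))) + 1) / η with hβ
  have hlog : ∀ m, 0 ≤ Real.log (Fintype.card (Fin d → Fin (2 ^ m))) := fun m =>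
    Real.log_nonneg (by exact_mod_cast Nat.one_le_iff_ne_zero.2 Fintype.card_ne_zero)
  have hβ0 : ∀ m, 0 < β m := fun m => div_pos (by linarith [hlog m]) hη
  have hlogβ : ∀ m, Real.log (Fintype.card (Fin d → Fin (2 ^ m))) / β m ≤ η := fun m => by
    rw [div_le_iff₀ (hβ0 m), hβ]
    simp only
    rw [mul_div_cancel₀ _ hη.ne']
    linarith
  set A : Ω → ℝ := fun ω => ∑ i, p i * g (a i) ω with hA
  set F : ℕ → Ω → ℝ := fun m ω => ∑ i, p i * logSumExp (β m)
    (fun z : Fin d → Fin (2 ^ m) => g (cubePoint (a i) ρ m z) ω - g (a i) ω) with hF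
  have hAsub : HasSubgaussianMGF A VA Q := by
    have hAg : HasGaussianLaw A Q := by
      have h1 := (hg.gaussian.comp_right a).smul p
      have h2 := h1.hasGaussianLaw_fun_sum (I := Finset.univ)
      simpa [hA] using h2
    refine hAg.hasSubgaussianMGF ?_ (le_trans ?_ hVA)
    · simp only [hA]
      rw [integral_finsetSum _ fun i _ => ((hg.memLp (a i)).integrable one_le_two).const_mul (p i)]
      simp [integral_const_mul, hg.centred]
    · exact integral_sq_sum_le (fun i => hg.memLp (a i)) hp fun i j => (hg.covariance _ _).le
  have hFsub : ∀ m, HasSubgaussianMGF (fun ω => F m ω - ∫ ω', F m ω' ∂Q)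
      (Real.toNNReal (Real.pi ^ 2 / 4) * VR) Q := fun m => by
    have h1 : IsGaussianProcess (fun (j : ι × (Fin d → Fin (2 ^ m))) ω =>
        g (cubePoint (a j.1) ρ m j.2) ω - g (a j.1) ω) Q := by
      refine hg.gaussian.of_isGaussianProcess fun j => ?_
      refine ⟨{cubePoint (a j.1) ρ m j.2, a j.1},
        ContinuousLinearMap.proj (R := ℝ) ⟨cubePoint (a j.1) ρ m j.2, by simp⟩ -
          ContinuousLinearMap.proj (R := ℝ) ⟨a j.1, by simp⟩, fun ω => ?_⟩
      simp
    let L : (↥(Finset.univ : Finset (ι × (Fin d → Fin (2 ^ m)))) → ℝ) →L[ℝ]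
        (ι × (Fin d → Fin (2 ^ m)) → ℝ) := ContinuousLinearMap.pi fun j =>
      ContinuousLinearMap.proj (R := ℝ) (⟨j, Finset.mem_univ j⟩ : (Finset.univ : Finset _))
    have h3 : HasGaussianLaw (fun ω (j : ι × (Fin d → Fin (2 ^ m))) =>
        g (cubePoint (a j.1) ρ m j.2) ω - g (a j.1) ω) Q :=
      (h1.hasGaussianLaw Finset.univ).map L
    have h2 := hasSubgaussianMGF_sum_logSumExp (Y := fun (j : ι × (Fin d → Fin (2 ^ m))) ω =>
      g (cubePoint (a j.1) ρ m j.2) ω - g (a j.1) ω) (p := p) (b := b) (Q := Q)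
      h3 (fun j => hg.integral_sub_eq_zero _ _) hp
      (fun j j' => ?_) (hβ0 m)
    · refine h2.mono ?_
      gcongr
      exact Real.toNNReal_le_iff_le_coe.2 hVR
    · rw [hg.integral_sub_mul_sub]
      exact hb _ _ _ _ (norm_cubePoint_sub_le _ hρ.le _ _) (norm_cubePoint_sub_le _ hρ.le _ _)
  have hFmean : ∀ m, ∫ ω, F m ω ∂Q ≤ M + η := fun m => by
    have hFi : Integrable (F m) Q := by
      have := (hFsub m).integrable.add (integrable_const (∫ ω', F m ω' ∂Q))
      refine this.congr (ae_of_all _ fun ω => ?_)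
      simp
    have hGi : Integrable (fun ω => ∑ i, p i * (Finset.univ.sup' Finset.univ_nonempty
        (fun z : Fin d → Fin (2 ^ m) => g (cubePoint (a i) ρ m z) ω - g (a i) ω) + η)) Q :=
      integrable_finsetSum _ fun i _ => (((hM i m).1).add (integrable_const η)).const_mul (p i)
    refine (integral_mono hFi hGi fun ω => ?_).trans ?_
    · refine Finset.sum_le_sum fun i _ => mul_le_mul_of_nonneg_left ?_ (hp i)
      have h1 := fun z => Finset.le_sup' (fun z : Fin d → Fin (2 ^ m) =>
        g (cubePoint (a i) ρ m z) ω - g (a i) ω) (Finset.mem_univ z)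
      exact (logSumExp_le (hβ0 m) h1).trans (add_le_add_right (hlogβ m) _)
    · have h1 : ∀ i ∈ (Finset.univ : Finset ι), Integrable (fun ω => p i *
          (Finset.univ.sup' Finset.univ_nonempty
            (fun z : Fin d → Fin (2 ^ m) => g (cubePoint (a i) ρ m z) ω - g (a i) ω) + η)) Q :=
        fun i _ => (((hM i m).1).add (integrable_const η)).const_mul (p i)
      rw [integral_finsetSum _ h1]
      calc ∑ i, ∫ ω, p i * (Finset.univ.sup' Finset.univ_nonempty
              (fun z : Fin d → Fin (2 ^ m) => g (cubePoint (a i) ρ m z) ω - g (a i) ω) + η) ∂Q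
          ≤ ∑ i, p i * (M + η) := by
            refine Finset.sum_le_sum fun i _ => ?_
            rw [integral_const_mul, integral_add (hM i m).1 (integrable_const η)]
            refine mul_le_mul_of_nonneg_left ?_ (hp i)
            simpa using (hM i m).2
        _ = M + η := by rw [← Finset.sum_mul, hp1, one_mul]
  have hbound : ∀ m, Q {ω | u - η ≤ A ω + F m ω} ≤
      ENNReal.ofReal (Real.exp (-u₁ ^ 2 / (2 * W))) := fun m => by
    have h1 := (hAsub.add (hFsub m)).measure_ge_le h0
    have hWc :
        (((VA.sqrt + (Real.toNNReal (Real.pi ^ 2 / 4) * VR).sqrt) ^ 2 : NNReal) : ℝ) = W := by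
      push_cast
      rw [Real.coe_toNNReal _ (by positivity)]
    rw [hWc] at h1
    refine (measure_mono fun ω hω => ?_).trans (ENNReal.le_ofReal_iff_toReal_le
      (measure_ne_top Q _) (Real.exp_pos _).le |>.2 h1)
    simp only [Set.mem_ofPred_eq] at hω ⊢
    linarith [hFmean m]
  set T : ℕ → Set Ω := fun N => ⋂ m ≥ N, {ω | u - η ≤ A ω + F m ω} with hT
  have hTm : Monotone T := fun N N' hNN' => by
    refine Set.subset_iInter₂ fun m hm => Set.iInter₂_subset m (le_trans hNN' hm)
  -- by continuity an exceedance of `u` is seen, up to `η`, at all sufficiently fine levels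
  have hsub : {ω | ∀ i, ∃ x ∈ D i, u ≤ g x ω} ≤ᵐ[Q] ⋃ N, T N := by
    filter_upwards [hcont] with ω hω hev
    have hev' : ∀ i, ∃ x ∈ D i, u ≤ g x ω := hev
    choose x hxD hxu using hev'
    choose z hz using fun i => fun m => exists_cubePoint_near hρ (hD i (x i) (hxD i)) m
    have hlim : ∀ i, Tendsto (fun m => cubePoint (a i) ρ m (z i m)) atTop (𝓝 (x i)) := fun i => by
      rw [tendsto_iff_norm_sub_tendsto_zero]
      refine squeeze_zero (fun m => norm_nonneg _)
        (fun m => (norm_sub_rev _ _).trans_le (hz i m)) ?_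
      have : Tendsto (fun m : ℕ => √d * ρ * (1 / 2 : ℝ) ^ m) atTop (𝓝 (√d * ρ * 0)) :=
        (tendsto_pow_atTop_nhds_zero_of_lt_one (by norm_num) (by norm_num)).const_mul _
      rw [mul_zero] at this
      refine this.congr fun m => ?_
      rw [one_div, inv_pow]; ring
    have hev2 : ∀ᶠ m in atTop, ∀ i, u - η < g (cubePoint (a i) ρ m (z i m)) ω :=
      eventually_all.2 fun i => ((hω.tendsto (x i)).comp (hlim i)).eventually_const_lt
        (by linarith [hxu i])
    obtain ⟨N, hN⟩ := eventually_atTop.1 hev2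
    refine Set.mem_iUnion.2 ⟨N, Set.mem_iInter₂.2 fun m hm => ?_⟩
    show u - η ≤ A ω + F m ω
    calc u - η = ∑ i, p i * (u - η) := by rw [← Finset.sum_mul, hp1, one_mul]
      _ ≤ ∑ i, (p i * g (a i) ω + p i * logSumExp (β m)
          (fun z : Fin d → Fin (2 ^ m) => g (cubePoint (a i) ρ m z) ω - g (a i) ω)) := by
        refine Finset.sum_le_sum fun i _ => ?_
        rw [← mul_add]
        refine mul_le_mul_of_nonneg_left ?_ (hp i)
        have h1 := le_logSumExp (hβ0 m) (fun z : Fin d → Fin (2 ^ m) =>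
          g (cubePoint (a i) ρ m z) ω - g (a i) ω) (z i m)
        linarith [hN m hm i]
      _ = A ω + F m ω := Finset.sum_add_distrib
  refine (measure_mono_ae hsub).trans ?_
  rw [hTm.measure_iUnion]
  exact iSup_le fun N => (measure_mono (Set.iInter₂_subset N le_rfl)).trans (hbound N)

end Exceedance

/-! ### Consequences of a local-global decomposition -/

section Decomposition

variable {d : ℕ}

lemma IsIsotropicGaussianField.abs_profile_le (hd : 1 ≤ d) {Ω : Type*} [MeasurableSpace Ω]
    {Q : Measure Ω} {X : EuclideanSpace ℝ (Fin d) → Ω → ℝ} {r : ℝ → ℝ}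
    (hX : IsIsotropicGaussianField X Q r) {t : ℝ} (ht : 0 ≤ t) : |r t| ≤ r 0 := by
  set x : EuclideanSpace ℝ (Fin d) := EuclideanSpace.single ⟨0, hd⟩ t with hx
  have hxt : ‖x - 0‖ = t := by simp [hx, abs_of_nonneg ht]
  have h1 : 0 ≤ ∫ ω, (X x ω - X 0 ω) ^ 2 ∂Q := integral_nonneg fun ω => sq_nonneg _
  have h2 : 0 ≤ ∫ ω, (X x ω + X 0 ω) ^ 2 ∂Q := integral_nonneg fun ω => sq_nonneg _
  rw [hX.integral_sub_sq, hxt] at h1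
  have h : ∀ a b, Integrable (fun ω => X a ω * X b ω) Q := fun a b =>
    (hX.memLp a).integrable_mul (hX.memLp b)
  have h3 : ∫ ω, (X x ω + X 0 ω) ^ 2 ∂Q = 2 * (r 0 + r t) := by
    calc ∫ ω, (X x ω + X 0 ω) ^ 2 ∂Q
        = ∫ ω, ((X x ω * X x ω + X 0 ω * X 0 ω) + 2 * (X x ω * X 0 ω)) ∂Q := by
          congr 1; ext ω; ring
      _ = 2 * (r 0 + r t) := by
          have h4 : Integrable (fun ω => X x ω * X x ω + X 0 ω * X 0 ω) Q := (h x x).add (h 0 0)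
          rw [integral_add h4 ((h x 0).const_mul 2),
            integral_add (h x x) (h 0 0), integral_const_mul, hX.covariance, hX.covariance,
            hX.covariance, hxt]
          simp; ring
  rw [h3] at h2
  exact _root_.abs_le.2 ⟨by linarith, by linarith⟩

variable {Ω : Type*} [MeasurableSpace Ω] {P : Measure Ω}
  {f : EuclideanSpace ℝ (Fin d) → Ω → ℝ} {k : ℝ → ℝ} {α : ℝ}
  {Ω' : ℝ → Type*} [∀ L, MeasurableSpace (Ω' L)] {Q : ∀ L, Measure (Ω' L)}
  {fL gL : ∀ L, EuclideanSpace ℝ (Fin d) → Ω' L → ℝ}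

/-- Chaining with the increments interpolated between the bounds coming from the variance and from
the derivative. -/
lemma IsLocalGlobalDecomposition.eventually_integral_sup'_le (hd : 1 ≤ d)
    (hdec : IsLocalGlobalDecomposition f P k Q fL gL) {G v : ℝ → ℝ} {θ : ℝ} (hθ : 0 < θ)
    (hθ1 : θ < 1) (hG : ∀ᶠ L in atTop, 0 < G L ∧ ∫ ω, gL L 0 ω ^ 2 ∂(Q L) ≤ G L)
    (hv : ∀ᶠ L in atTop, 0 < v L ∧ maxPartialVar (gL L) (Q L) ≤ v L)
    (hlim : Tendsto (fun L => (4 * G L) ^ ((1 - θ) / 2) * v L ^ (θ / 2) * (2 * L) ^ θ) atTop (𝓝 0))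
    {ε : ℝ} (hε : 0 < ε) :
    ∀ᶠ L in atTop, ∀ (a : EuclideanSpace ℝ (Fin d)) (m : ℕ),
      Integrable (fun ω => Finset.univ.sup' Finset.univ_nonempty
        fun z : Fin d → Fin (2 ^ m) => gL L (cubePoint a (2 * L) m z) ω - gL L a ω) (Q L) ∧
      ∫ ω, Finset.univ.sup' Finset.univ_nonempty
        (fun z : Fin d → Fin (2 ^ m) => gL L (cubePoint a (2 * L) m z) ω - gL L a ω) ∂(Q L) ≤
          ε := by
  obtain ⟨S, hS, hchain⟩ := exists_chaining_const d hθ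
  have hlim' := hlim.const_mul S
  rw [mul_zero] at hlim'
  filter_upwards [hG, hv, hlim'.eventually_le_const hε, eventually_ge_atTop 1] with
    L hGL hvL h1 hL a m
  obtain ⟨r, hr⟩ := hdec.global_isotropic L hL
  have hL0 : 0 < L := by linarith
  have hr0 : r 0 ≤ G L := by rw [← hr.integral_sq 0]; exact hGL.2
  have hinc : ∀ x y : EuclideanSpace ℝ (Fin d), 2 * (r 0 - r ‖x - y‖) ≤
      ((4 * G L) ^ ((1 - θ) / 2) * v L ^ (θ / 2) * ‖x - y‖ ^ θ) ^ 2 := fun x y => by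
    set w := 2 * (r 0 - r ‖x - y‖) with hw
    have hrabs := _root_.abs_le.1 (hr.abs_profile_le hd (norm_nonneg (x - y)))
    have hw0 : 0 ≤ w := by linarith [hrabs.2]
    have hw1 : w ≤ 4 * G L := by linarith [hrabs.1]
    have hw2 : w ≤ v L * ‖x - y‖ ^ 2 :=
      (hr.increment_le hd (hdec.global_C1 L hL) x y).trans (by gcongr; exact hvL.2)
    have hG0 := hGL.1
    have hv0 := hvL.1
    calc w = w ^ (1 - θ) * w ^ θ := by
          rcases hw0.eq_or_lt with h | h
          · rw [← h, Real.zero_rpow hθ.ne', mul_zero]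
          · rw [← Real.rpow_add h]; simp
      _ ≤ (4 * G L) ^ (1 - θ) * (v L * ‖x - y‖ ^ 2) ^ θ := by
          gcongr
      _ = _ := by
          have e1 : ((4 * G L) ^ ((1 - θ) / 2)) ^ 2 = (4 * G L) ^ (1 - θ) := by
            rw [← Real.rpow_natCast, ← Real.rpow_mul (by positivity)]; norm_num
          have e2 : (v L ^ (θ / 2)) ^ 2 = v L ^ θ := by
            rw [← Real.rpow_natCast, ← Real.rpow_mul (by positivity)]; norm_num
          have e3 : (‖x - y‖ ^ 2) ^ θ = (‖x - y‖ ^ θ) ^ 2 := by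
            rw [← Real.rpow_natCast, ← Real.rpow_natCast, ← Real.rpow_mul (norm_nonneg _),
              ← Real.rpow_mul (norm_nonneg _), mul_comm]
          rw [mul_pow, mul_pow, e1, e2, Real.mul_rpow hv0.le (by positivity), e3, mul_assoc]
  have h2 := hchain hr _ (by have := hGL.1; have := hvL.1; positivity) hinc a (2 * L)
    (by positivity) m
  exact ⟨h2.1, h2.2.trans (by linarith [h1])⟩

/-- A slowly varying `k` tending to `0` satisfies `|1 / k L| = L ^ o(1)`: the hypothesis under which
the derivative of the global field is assumed to decay at a rate. -/
lemma RegularlyVarying.exists_abs_one_div_eq_rpow (hk : RegularlyVarying k 0)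
    (hk0 : Tendsto k atTop (𝓝 0)) :
    ∃ e : ℝ → ℝ, Tendsto e atTop (𝓝 0) ∧ ∀ᶠ L in atTop, |1 / k L| = L ^ e L := by
  obtain ⟨X, hX, hpos⟩ := hk.exists_pos
  refine ⟨fun L => -Real.log (k L) / Real.log L, ?_, ?_⟩
  · rw [Metric.tendsto_atTop']
    intro ε hε
    have h1 := (hk.rpow_isLittleO (half_pos hε)).bound one_pos
    obtain ⟨N, hN⟩ := eventually_atTop.1
      (h1.and ((hk0.eventually_le_const one_pos).and ((eventually_ge_atTop X).and
        (eventually_gt_atTop 1))))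
    refine ⟨N, fun L hL => ?_⟩
    obtain ⟨h1, h2, h3, h4⟩ := hN L hL.le
    have hkL := hpos L h3
    have hL0 : 0 < L := by linarith
    rw [Real.norm_of_nonneg (by positivity), Real.norm_of_nonneg hkL.le, one_mul] at h1
    have h5 := Real.log_le_log (by positivity) h1
    rw [Real.log_rpow hL0] at h5
    have h6 := Real.log_nonpos hkL.le h2
    have h7 := Real.log_pos h4
    rw [Real.dist_eq, sub_zero, abs_of_nonneg (div_nonneg (by linarith) h7.le), div_lt_iff₀ h7]
    nlinarith
  · filter_upwards [eventually_ge_atTop X, eventually_gt_atTop 1] with L h1 h2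
    have hkL := hpos L h1
    have h7 := Real.log_pos h2
    rw [abs_of_pos (by positivity), Real.rpow_def_of_pos (by linarith),
      mul_div_cancel₀ _ h7.ne', Real.exp_neg, Real.exp_log hkL, one_div]

/-- The expected maximum of the increments of the global field over a cube of side `2 L` vanishes
as `L → ∞`. -/
theorem IsLocalGlobalDecomposition.eventually_integral_sup'_sub_le (hd : 1 ≤ d)
    (hk : RegularlyVarying k α) (hα : 0 ≤ α) (hk0 : Tendsto k atTop (𝓝 0))
    (hdec : IsLocalGlobalDecomposition f P k Q fL gL) {ε : ℝ} (hε : 0 < ε) :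
    ∀ᶠ L in atTop, ∀ (a : EuclideanSpace ℝ (Fin d)) (m : ℕ),
      Integrable (fun ω => Finset.univ.sup' Finset.univ_nonempty
        fun z : Fin d → Fin (2 ^ m) => gL L (cubePoint a (2 * L) m z) ω - gL L a ω) (Q L) ∧
      ∫ ω, Finset.univ.sup' Finset.univ_nonempty
        (fun z : Fin d → Fin (2 ^ m) => gL L (cubePoint a (2 * L) m z) ω - gL L a ω) ∂(Q L) ≤
          ε := by
  obtain ⟨X, hX, hpos⟩ := hk.exists_pos
  obtain ⟨C, hC, hCb⟩ := hdec.global_var.exists_pos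
  have hCb' := hCb.bound
  -- for `α > 0` the variance decays polynomially, and the Hölder exponent `θ` is taken so small
  -- that this decay wins over `L ^ θ`; for `α = 0` the rate of decay of the derivative makes the bound a
  -- multiple of `k L ^ (1 / 2)`
  rcases hα.eq_or_lt with rfl | hα0
  · obtain ⟨C', hC', hCb2⟩ :=
      (hdec.global_deriv_slow (hk.exists_abs_one_div_eq_rpow hk0)).exists_pos
    refine hdec.eventually_integral_sup'_le hd (G := fun L => C * k L)
      (v := fun L => C' * (L ^ (-2 : ℝ) * k L)) (θ := 1 / 2) (by norm_num) (by norm_num) ?_ ?_ ?_ hε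
    · filter_upwards [hCb', eventually_ge_atTop X] with L h1 h2
      have := hpos L h2
      rw [Real.norm_of_nonneg this.le] at h1
      exact ⟨by positivity, (le_abs_self _).trans h1⟩
    · filter_upwards [hCb2.bound, eventually_ge_atTop X] with L h1 h2
      have := hpos L h2
      have hL0 : 0 < L := hX.trans_le h2
      rw [Real.norm_of_nonneg (show 0 ≤ L ^ (-2 : ℝ) * k L by positivity)] at h1
      exact ⟨by positivity, (le_abs_self _).trans h1⟩
    · have h1 : Tendsto (fun L => (4 * C) ^ (1 / 4 : ℝ) * C' ^ (1 / 4 : ℝ) * 2 ^ (1 / 2 : ℝ) *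
          k L ^ (1 / 2 : ℝ)) atTop (𝓝 ((4 * C) ^ (1 / 4 : ℝ) * C' ^ (1 / 4 : ℝ) * 2 ^ (1 / 2 : ℝ) *
          0 ^ (1 / 2 : ℝ))) := (hk0.rpow_const (Or.inr (by norm_num))).const_mul _
      rw [Real.zero_rpow (by norm_num), mul_zero] at h1
      refine h1.congr' ?_
      filter_upwards [eventually_ge_atTop X] with L h2
      have := hpos L h2
      have hL0 : 0 < L := hX.trans_le h2
      rw [show ((1 - 1 / 2) / 2 : ℝ) = 1 / 4 by norm_num, show (1 / 2 / 2 : ℝ) = 1 / 4 by norm_num,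
        ← mul_assoc 4, Real.mul_rpow (by positivity) this.le, Real.mul_rpow hC'.le (by positivity),
        Real.mul_rpow (by positivity) this.le, Real.mul_rpow (by norm_num) hL0.le,
        ← Real.rpow_mul hL0.le]
      have e1 : k L ^ (1 / 2 : ℝ) = k L ^ (1 / 4 : ℝ) * k L ^ (1 / 4 : ℝ) := by
        rw [← Real.rpow_add this]; norm_num
      have e2 : L ^ (-2 * (1 / 4) : ℝ) * L ^ (1 / 2 : ℝ) = 1 := by
        rw [← Real.rpow_add hL0]; norm_num
      rw [e1]
      linear_combination (-(4 * C) ^ (1 / 4 : ℝ) * C' ^ (1 / 4 : ℝ) * 2 ^ (1 / 2 : ℝ) *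
        k L ^ (1 / 4 : ℝ) * k L ^ (1 / 4 : ℝ)) * e2
  · obtain ⟨C', hC', hCb2⟩ := (hdec.global_var.trans
      (hk.isBigO_rpow (half_lt_self hα0))).exists_pos
    set θ := min (1 / 2) (α / 16) with hθ
    have hθ0 : 0 < θ := lt_min (by norm_num) (by positivity)
    have hθ1 : θ ≤ 1 / 2 := min_le_left _ _
    have hθ2 : θ ≤ α / 16 := min_le_right _ _
    refine hdec.eventually_integral_sup'_le hd (G := fun L => C' * L ^ (-(α / 2)))
      (v := fun _ => 1) (θ := θ) hθ0 (by linarith) ?_ ?_ ?_ hε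
    · filter_upwards [hCb2.bound, eventually_gt_atTop 0] with L h1 hL0
      rw [Real.norm_of_nonneg (show 0 ≤ L ^ (-(α / 2)) by positivity)] at h1
      exact ⟨by positivity, (le_abs_self _).trans h1⟩
    · filter_upwards [hdec.global_deriv.eventually_le_const one_pos] with L h1
      exact ⟨one_pos, h1⟩
    · have h1 := (tendsto_rpow_neg_atTop
        (show 0 < α / 2 * ((1 - θ) / 2) - θ by nlinarith)).const_mul
        ((4 * C') ^ ((1 - θ) / 2) * 2 ^ θ)
      rw [mul_zero] at h1
      refine h1.congr' ?_
      filter_upwards [eventually_gt_atTop 0] with L hL0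
      rw [Real.one_rpow, mul_one, ← mul_assoc 4,
        Real.mul_rpow (x := 4 * C') (by positivity) (by positivity), ← Real.rpow_mul hL0.le,
        Real.mul_rpow (by norm_num) hL0.le,
        show -(α / 2 * ((1 - θ) / 2) - θ) = -(α / 2) * ((1 - θ) / 2) + θ by ring,
        Real.rpow_add hL0]
      ring

/-- At distances much larger than `L`, displacements of order `L` change neither the covariance of
the global field nor that of the original field, and both agree, up to a small relative error. -/
lemma IsLocalGlobalDecomposition.eventually_abs_profile_sub_le (hd : 1 ≤ d)
    (hk : RegularlyVarying k α) (hdec : IsLocalGlobalDecomposition f P k Q fL gL) {D : ℝ}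
    (hD : 0 ≤ D) {δ : ℝ} (hδ : 0 < δ) :
    ∀ᶠ M : ℝ in atTop, ∀ᶠ L : ℝ in atTop, ∀ r, IsIsotropicGaussianField (gL L) (Q L) r →
      ∀ t, M * L ≤ t → ∀ t', |t' - t| ≤ D * L →
        |r t' - k t| ≤ δ * k t ∧ |k t' - k t| ≤ δ * k t ∧ 0 < k t := by
  set δ₁ := min (δ / 3) 1 with hδ₁
  have hδ₁0 : 0 < δ₁ := lt_min (by positivity) one_pos
  have hδ₁1 : δ₁ ≤ 1 := min_le_right _ _
  have hδ₁3 : δ₁ ≤ δ / 3 := min_le_left _ _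
  obtain ⟨X, hX, hpos⟩ := hk.exists_pos
  obtain ⟨η, hη, X₁, hX₁, hratio⟩ := hk.exists_ratio_near_one hδ₁0
  obtain ⟨M₀, hM₀⟩ := ((hdec.global_cov.eventually_lt_const
    (show (0 : ℝ≥0∞) < ENNReal.ofReal δ₁ by simpa using hδ₁0)).and
      (eventually_ge_atTop 1)).exists
  have hcov := eventually_lt_of_limsup_lt hM₀.1
  -- `M ≥ 2 M₀` and `M ≥ 2 D` keep `t'` above `M₀ L`; `M ≥ D / η` makes `D L` at most `η t`
  filter_upwards [eventually_ge_atTop (2 * M₀), eventually_ge_atTop (2 * D),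
    eventually_ge_atTop (D / η)] with M hM1 hM2 hM3
  filter_upwards [hcov, eventually_ge_atTop 1, eventually_ge_atTop (2 * X),
    eventually_ge_atTop X₁] with L hL hL1 hLX hLX₁ r hr t ht t' ht'
  have hM01 : 1 ≤ M₀ := hM₀.2
  have hL0 : 0 < L := by linarith
  have hMt : 2 * L ≤ t := le_trans (by gcongr; linarith) ht
  have hDη : D * L ≤ η * t := by
    rw [div_le_iff₀ hη.1] at hM3
    nlinarith [hη.1]
  have hD2 : D * L ≤ t / 2 := by nlinarith
  have ht'2 : t / 2 ≤ t' := by linarith [(_root_.abs_le.1 ht').1]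
  have hk1 := hratio t (by linarith) t' (ht'.trans hDη)
  have hkt := hpos t (by linarith)
  have hkt' := hpos t' (by linarith)
  have hcov' : |r t' / k t' - 1| ≤ δ₁ := by
    have hnorm : ‖(EuclideanSpace.single ⟨0, hd⟩ t' : EuclideanSpace ℝ (Fin d))‖ = t' := by
      simp [abs_of_nonneg (show 0 ≤ t' by linarith)]
    have h1 := (le_iSup₂ (f := fun (x : EuclideanSpace ℝ (Fin d)) (_ : M₀ * L ≤ ‖x‖) =>
      ENNReal.ofReal |(∫ ω, gL L 0 ω * gL L x ω ∂(Q L)) / k ‖x‖ - 1|)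
      (EuclideanSpace.single ⟨0, hd⟩ t') (by rw [hnorm]; nlinarith)).trans_lt hL
    rw [hr.covariance, zero_sub, norm_neg, hnorm, ENNReal.ofReal_lt_ofReal_iff hδ₁0] at h1
    exact h1.le
  have h2 : |r t' - k t'| ≤ δ₁ * k t' := by
    have : r t' - k t' = (r t' / k t' - 1) * k t' := by field_simp
    rw [this, abs_mul, abs_of_pos hkt']
    gcongr
  refine ⟨?_, hk1.trans (by gcongr; linarith), hkt⟩
  have h3 : k t' ≤ 2 * k t := by nlinarith [(_root_.abs_le.1 hk1).2]
  calc |r t' - k t| ≤ |r t' - k t'| + |k t' - k t| := abs_sub_le _ _ _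
    _ ≤ δ₁ * (2 * k t) + δ₁ * k t := by
        refine add_le_add (h2.trans ?_) hk1
        gcongr
    _ ≤ δ * k t := by nlinarith

end Decomposition

/-! ### Exceedance probabilities in terms of energies -/

section EnergyComparison

variable {d : ℕ} {k : ℝ → ℝ}

/-- Splitting the energy of a probability measure carried by disjoint balls into self-energies and
mutual energies. -/
lemma IsPosDefFun.sum_le_energy (hK : IsPosDefFun fun z : EuclideanSpace ℝ (Fin d) => k ‖z‖)
    {ι : Type*} [Fintype ι] [DecidableEq ι] {c : ι → EuclideanSpace ℝ (Fin d)} {ρ e : ℝ}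
    (he : ∀ z₀, ∀ ν : Measure (EuclideanSpace ℝ (Fin d)), IsFiniteMeasure ν →
      ν (Metric.closedBall z₀ ρ)ᶜ = 0 → e * ν.real Set.univ ^ 2 ≤ ∫ x, ∫ y, k ‖x - y‖ ∂ν ∂ν)
    (hdisj : Pairwise fun i j => Disjoint (Metric.closedBall (c i) ρ) (Metric.closedBall (c j) ρ))
    {b : ι → ι → ℝ} (hb : ∀ i j, i ≠ j → ∀ x ∈ Metric.closedBall (c i) ρ,
      ∀ y ∈ Metric.closedBall (c j) ρ, b i j ≤ k ‖x - y‖)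
    {μ : Measure (EuclideanSpace ℝ (Fin d))} [IsProbabilityMeasure μ]
    (hμ : μ (⋃ i, Metric.closedBall (c i) ρ)ᶜ = 0) :
    ∑ i, μ.real (Metric.closedBall (c i) ρ) = 1 ∧
    ∑ i, ∑ j, μ.real (Metric.closedBall (c i) ρ) * μ.real (Metric.closedBall (c j) ρ) *
      (if i = j then e else b i j) ≤ ∫ x, ∫ y, k ‖x - y‖ ∂μ ∂μ := by
  set B : ι → Set (EuclideanSpace ℝ (Fin d)) := fun i => Metric.closedBall (c i) ρ with hB
  have hBm : ∀ i, MeasurableSet (B i) := fun i => Metric.isClosed_closedBall.measurableSet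
  have hcont : Continuous fun z : EuclideanSpace ℝ (Fin d) × EuclideanSpace ℝ (Fin d) =>
    k ‖z.1 - z.2‖ := hK.continuous.comp (continuous_fst.sub continuous_snd)
  have hprod : ∀ ν ν' : Measure (EuclideanSpace ℝ (Fin d)), IsFiniteMeasure ν →
      IsFiniteMeasure ν' → Integrable (fun z : EuclideanSpace ℝ (Fin d) ×
        EuclideanSpace ℝ (Fin d) => k ‖z.1 - z.2‖) (ν.prod ν') := fun ν ν' _ _ =>
    Integrable.of_bound hcont.aestronglyMeasurable (k 0)
      (ae_of_all _ fun z => by simpa using hK.abs_le (z.1 - z.2))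
  have hin : ∀ (ν : Measure (EuclideanSpace ℝ (Fin d))), IsFiniteMeasure ν → ∀ x,
      Integrable (fun y => k ‖x - y‖) ν := fun ν _ x =>
    Integrable.of_bound (hcont.comp (Continuous.prodMk_right x)).aestronglyMeasurable (k 0)
      (ae_of_all _ fun y => by simpa using hK.abs_le (x - y))
  have hout : ∀ (ν ν' : Measure (EuclideanSpace ℝ (Fin d))), IsFiniteMeasure ν →
      IsFiniteMeasure ν' → Integrable (fun x => ∫ y, k ‖x - y‖ ∂ν') ν := fun ν ν' h h' =>
    (hprod ν ν' h h').integral_prod_left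
  have hsum : μ = ∑ i, μ.restrict (B i) := by
    rw [← Measure.sum_fintype, ← Measure.restrict_iUnion hdisj hBm,
      Measure.restrict_eq_self_of_ae_mem]
    exact mem_ae_iff.2 hμ
  refine ⟨?_, ?_⟩
  · have h1 := measureReal_iUnion_fintype (μ := μ) hdisj hBm
    rw [← h1, measureReal_def, (prob_compl_eq_zero_iff (MeasurableSet.iUnion hBm)).1 hμ]
    simp
  · have h1 : ∫ x, ∫ y, k ‖x - y‖ ∂μ ∂μ = ∑ i, ∑ j, ∫ x in B i, ∫ y in B j, k ‖x - y‖ ∂μ ∂μ := by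
      have h2 : ∀ x, ∫ y, k ‖x - y‖ ∂μ = ∑ j, ∫ y in B j, k ‖x - y‖ ∂μ := fun x => by
        conv_lhs => rw [hsum]
        exact integral_finsetSum_measure fun j _ => hin _ inferInstance x
      have h3 : ∫ x, ∫ y, k ‖x - y‖ ∂μ ∂μ = ∫ x, ∫ y, k ‖x - y‖ ∂μ ∂(∑ i, μ.restrict (B i)) := by
        rw [← hsum]
      rw [h3, integral_finsetSum_measure fun i _ => hout _ _ inferInstance inferInstance]
      refine Finset.sum_congr rfl fun i _ => ?_
      simp_rw [h2]
      exact integral_finsetSum _ fun j _ => hout _ _ inferInstance inferInstance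
    rw [h1]
    refine Finset.sum_le_sum fun i _ => Finset.sum_le_sum fun j _ => ?_
    split_ifs with hij
    · subst hij
      have h2 := he (c i) (μ.restrict (B i)) inferInstance (by
        rw [Measure.restrict_apply (hBm i).compl, Set.compl_inter_self, measure_empty])
      rw [measureReal_restrict_apply_univ] at h2
      linarith
    · calc μ.real (B i) * μ.real (B j) * b i j = ∫ x in B i, ∫ y in B j, b i j ∂μ ∂μ := by
            rw [setIntegral_const, setIntegral_const, smul_eq_mul, smul_eq_mul, mul_assoc]
        _ ≤ _ := by
            refine setIntegral_mono_on (integrable_const _) (hout _ _ inferInstance inferInstance)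
              (hBm i) fun x hx => ?_
            exact setIntegral_mono_on (integrable_const _) (hin _ inferInstance x)
              (hBm j) fun y hy => hb i j hij x hx y hy

end EnergyComparison

section Comparison

variable {d : ℕ} {Ω : Type*} [MeasurableSpace Ω] {P : Measure Ω}
  {f : EuclideanSpace ℝ (Fin d) → Ω → ℝ} {k : ℝ → ℝ} {α : ℝ}
  {Ω' : ℝ → Type*} [∀ L, MeasurableSpace (Ω' L)] {Q : ∀ L, Measure (Ω' L)}
  {fL gL : ∀ L, EuclideanSpace ℝ (Fin d) → Ω' L → ℝ}

lemma exists_sqrt_add_sqrt_sq_le {ε : ℝ} (hε : 0 < ε) : ∃ δ ∈ Set.Ioo (0 : ℝ) 1,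
    (√((1 + δ) / (1 - δ)) + √(Real.pi ^ 2 / 4 * (4 * δ / (1 - δ)))) ^ 2 ≤ 1 + ε := by
  have h1 : ContinuousAt (fun δ : ℝ =>
      (√((1 + δ) / (1 - δ)) + √(Real.pi ^ 2 / 4 * (4 * δ / (1 - δ)))) ^ 2) 0 := by
    refine ContinuousAt.pow (ContinuousAt.add ?_ ?_) 2
    · exact (ContinuousAt.div (by fun_prop) (by fun_prop) (by norm_num)).sqrt
    · exact (continuousAt_const.mul (ContinuousAt.div (by fun_prop) (by fun_prop)
        (by norm_num))).sqrt
  have h2 := h1.tendsto.eventually_le_const (u := 1 + ε) (by simpa using hε)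
  obtain ⟨δ, h3, h4⟩ := ((h2.filter_mono (nhdsWithin_le_nhds (s := Set.Ioi 0))).and
    (Ioo_mem_nhdsGT one_pos)).exists
  exact ⟨δ, h4, h3⟩

set_option maxHeartbeats 1000000 in
/-- The exceedance probability is at most `exp (-u ^ 2 / (2 * E))` up to a small relative error in
the exponent, for the energy `E` of any probability measure on the union of the small balls: such
a measure only enters through the masses it gives to the balls. -/
theorem IsLocalGlobalDecomposition.eventually_exceedance_le (hd : 1 ≤ d)
    (hf : IsIsotropicGaussianField f P k) (hα : 0 ≤ α) (hk : RegularlyVarying k α)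
    (hdec : IsLocalGlobalDecomposition f P k Q fL gL) {u : ℝ} (hu : 0 < u) {s : ℝ → ℝ}
    (hs : Tendsto s atTop atTop) (hks : k =o[atTop] fun L => k (s L)) {ε : ℝ} (hε : 0 < ε)
    (hε1 : ε < 1) :
    ∀ᶠ M : ℝ in atTop, ∀ᶠ L : ℝ in atTop, ∀ (n : ℕ) (c : Fin n → EuclideanSpace ℝ (Fin d)),
      (∀ i j, i ≠ j → ∀ x ∈ Metric.closedBall (c i) L, ∀ y ∈ Metric.closedBall (c j) L,
        M * L < dist x y) →
      ∀ μ : Measure (EuclideanSpace ℝ (Fin d)), IsProbabilityMeasure μ →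
        μ (⋃ i, Metric.closedBall (c i) (s L))ᶜ = 0 →
        0 < kernelEnergy (fun x y => k ‖x - y‖) μ ∧
        Q L {ω | ∀ i, ∃ x ∈ Metric.closedBall (c i) L, u ≤ gL L x ω} ≤
          ENNReal.ofReal (Real.exp
            (-(u ^ 2 * (1 - ε) / 2 / kernelEnergy (fun x y => k ‖x - y‖) μ))) := by
  have hK := hf.isPosDefFun hk.1
  have hk0 := tendsto_zero_of_isLittleO hd hK hs hks
  obtain ⟨δ, ⟨hδ0, hδ1⟩, hδε⟩ := exists_sqrt_add_sqrt_sq_le (show 0 < ε / 3 by positivity)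
  set w := (√((1 + δ) / (1 - δ)) + √(Real.pi ^ 2 / 4 * (4 * δ / (1 - δ)))) ^ 2 with hw
  have h1δ : 0 < 1 - δ := by linarith
  have hw0 : 0 < w := by positivity
  obtain ⟨e, he, R, hR, henergy⟩ := hk.exists_energy_ge hd hα hK
  obtain ⟨X, hX, hpos⟩ := hk.exists_pos
  have hd1 : 1 ≤ √d := by
    rw [Real.one_le_sqrt]
    exact_mod_cast hd
  filter_upwards [hdec.eventually_abs_profile_sub_le hd hk (D := 4 * √d) (by positivity) hδ0,
    eventually_ge_atTop 0] with M hM hM0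
  filter_upwards [hM, hk.eventually_le_of_isLittleO hd hα hK hks, hs.eventually_ge_atTop R,
    hs.eventually_ge_atTop X, (hdec.global_var.trans_isLittleO hks).bound (mul_pos hδ0 he),
    hdec.eventually_integral_sup'_sub_le hd hk hα hk0 (show 0 < ε * u / 6 by positivity),
    eventually_ge_atTop 1] with L hcov hsL hsR hsX hvar hmax hL n c hsep μ hμp hμ
  have hL0 : 0 < L := by linarith
  obtain ⟨r, hr⟩ := hdec.global_isotropic L hL
  have hsep' : ∀ i j, i ≠ j → M * L ≤ ‖c i - c j‖ := fun i j hij => by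
    rw [← dist_eq_norm]
    exact (hsep i j hij _ (Metric.mem_closedBall_self hL0.le) _
      (Metric.mem_closedBall_self hL0.le)).le
  have hks0 : 0 < k (s L) := hpos _ hsX
  have hr0 : r 0 ≤ δ * (e * k (s L)) := by
    rw [Real.norm_of_nonneg hks0.le, mul_assoc] at hvar
    rw [← hr.integral_sq 0]
    exact (le_abs_self _).trans hvar
  have hdisj : Pairwise fun i j =>
      Disjoint (Metric.closedBall (c i) (s L)) (Metric.closedBall (c j) (s L)) := fun i j hij => by
    refine Set.disjoint_left.2 fun x hx hy => ?_
    have h := hsep i j hij x (Metric.closedBall_subset_closedBall hsL hx) x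
      (Metric.closedBall_subset_closedBall hsL hy)
    rw [dist_self] at h
    exact absurd h (not_lt.2 (by positivity))
  have hnorm : ∀ x y a b : EuclideanSpace ℝ (Fin d), ∀ t, ‖x - a‖ ≤ t → ‖y - b‖ ≤ t →
      |‖x - y‖ - ‖a - b‖| ≤ 2 * t := fun x y a b t hx hy => by
    refine (abs_norm_sub_norm_le _ _).trans ?_
    rw [show x - y - (a - b) = (x - a) - (y - b) by abel]
    exact (norm_sub_le _ _).trans (by linarith)
  obtain ⟨hp1, hE⟩ := hK.sum_le_energy (e := e * k (s L)) (c := c) (ρ := s L)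
    (b := fun i j => (1 - δ) * k ‖c i - c j‖) (fun z₀ ν hν h => henergy (s L) hsR z₀ ν h) hdisj
    (fun i j hij x hx y hy => by
      rw [Metric.mem_closedBall, dist_eq_norm] at hx hy
      have h1 := hcov r hr _ (hsep' i j hij) ‖x - y‖
        ((hnorm x y _ _ (s L) hx hy).trans (by nlinarith))
      linarith [(_root_.abs_le.1 h1.2.1).1]) hμ
  set p : Fin n → ℝ := fun i => μ.real (Metric.closedBall (c i) (s L)) with hp
  -- the energy of `μ` is at least `∑ p i p j q i j`; all covariances below are compared with `q`
  set q : Fin n → Fin n → ℝ := fun i j =>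
    if i = j then e * k (s L) else (1 - δ) * k ‖c i - c j‖ with hq
  have hE' : ∑ i, ∑ j, p i * p j * q i j ≤ kernelEnergy (fun x y => k ‖x - y‖) μ := hE
  set E := kernelEnergy (fun x y => k ‖x - y‖) μ with hEdef
  have hp0 : ∀ i, 0 ≤ p i := fun i => measureReal_nonneg
  have hkpos : ∀ i j, i ≠ j → 0 < k ‖c i - c j‖ := fun i j hij =>
    (hcov r hr _ (hsep' i j hij) ‖c i - c j‖ (by simp; positivity)).2.2
  have hq0 : ∀ i j, 0 < q i j := fun i j => by
    simp only [hq]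
    split_ifs with hij
    · positivity
    · exact mul_pos h1δ (hkpos i j hij)
  have hE0 : 0 < E := by
    refine lt_of_lt_of_le ?_ hE'
    obtain ⟨i, -, hi⟩ := Finset.exists_ne_zero_of_sum_ne_zero (hp1.trans_ne one_ne_zero)
    have hi' : 0 < p i := lt_of_le_of_ne (hp0 i) (Ne.symm hi)
    have hnn : ∀ i j, 0 ≤ p i * p j * q i j := fun i j =>
      mul_nonneg (mul_nonneg (hp0 i) (hp0 j)) (hq0 i j).le
    refine Finset.sum_pos' (fun i _ => Finset.sum_nonneg fun j _ => hnn i j)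
      ⟨i, Finset.mem_univ i, Finset.sum_pos' (fun j _ => hnn i j) ⟨i, Finset.mem_univ i, ?_⟩⟩
    exact mul_pos (mul_pos hi' hi') (hq0 i i)
  refine ⟨hE0, ?_⟩
  -- the cube with corner `a i` and side `2 L` contains the ball of index `i`
  set a : Fin n → EuclideanSpace ℝ (Fin d) := fun i => c i - WithLp.toLp 2 fun _ => L with ha
  have haa : ∀ i j, a i - a j = c i - c j := fun i j => by simp [ha]
  have hscale : ∀ C : ℝ, 0 ≤ C → ∑ i, ∑ j, p i * p j * (C * q i j) ≤ C * E := fun C hC => by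
    refine le_trans (le_of_eq ?_) (mul_le_mul_of_nonneg_left hE' hC)
    simp_rw [Finset.mul_sum]
    exact Finset.sum_congr rfl fun i _ => Finset.sum_congr rfl fun j _ => by ring
  have hsup := hr.measure_forall_exists_ge_le
    ((hdec.global_C1 L hL).mono fun ω hω => hω.continuous)
    (D := fun i => Metric.closedBall (c i) L) (a := a) (ρ := 2 * L) (by positivity)
    (fun i x hx l => by
      have h1 : |x l - c i l| ≤ L := by
        rw [Metric.mem_closedBall, dist_eq_norm] at hx
        exact (PiLp.norm_apply_le (x - c i) l).trans hx
      have h2 := _root_.abs_le.1 h1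
      simp only [ha, PiLp.sub_apply]
      constructor <;> linarith) hp0 hp1 (fun i m => hmax (a i) m)
    -- each of the four covariances in an increment is off by at most `δ k |c i - c j|`, or bounded
    -- by `r 0` on the diagonal
    (b := fun i j => 4 * δ / (1 - δ) * q i j)
    (fun i j x y hx hy => by
      have h1 : 4 * δ ≤ 4 * δ / (1 - δ) := by
        rw [le_div_iff₀ h1δ]; nlinarith
      by_cases hij : i = j
      · subst hij
        have hab := fun v : EuclideanSpace ℝ (Fin d) =>
          _root_.abs_le.1 (hr.abs_profile_le hd (norm_nonneg v))
        have h2 : 4 * δ * (e * k (s L)) ≤ 4 * δ / (1 - δ) * (e * k (s L)) := by gcongr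
        simp only [hq, if_true]
        linarith [(hab (x - y)).2, (hab (x - a i)).1, (hab (a i - y)).1, (hab (a i - a i)).2]
      · have hc : ∀ x' y' : EuclideanSpace ℝ (Fin d), ‖x' - a i‖ ≤ √d * (2 * L) →
            ‖y' - a j‖ ≤ √d * (2 * L) → |r ‖x' - y'‖ - k ‖c i - c j‖| ≤ δ * k ‖c i - c j‖ :=
          fun x' y' hx' hy' => (hcov r hr _ (hsep' i j hij) _
            (by rw [← haa]; exact (hnorm _ _ _ _ _ hx' hy').trans_eq (by ring))).1
        have hai : ‖a i - a i‖ ≤ √d * (2 * L) := by simp; positivity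
        have haj : ‖a j - a j‖ ≤ √d * (2 * L) := by simp; positivity
        have e1 := _root_.abs_le.1 (hc x y hx hy)
        have e2 := _root_.abs_le.1 (hc x (a j) hx haj)
        have e3 := _root_.abs_le.1 (hc (a i) y hai hy)
        have e4 := _root_.abs_le.1 (hc (a i) (a j) hai haj)
        have e5 : 4 * δ / (1 - δ) * q i j = 4 * δ * k ‖c i - c j‖ := by
          simp only [hq, if_neg hij]
          field_simp
        rw [e5]
        linarith [e1.2, e2.1, e3.1, e4.2])
    (VA := Real.toNNReal ((1 + δ) / (1 - δ) * E)) (VR := Real.toNNReal (4 * δ / (1 - δ) * E))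
    (by
      rw [Real.coe_toNNReal _ (by positivity)]
      refine le_trans ?_ (hscale _ (by positivity))
      refine Finset.sum_le_sum fun i _ => Finset.sum_le_sum fun j _ =>
        mul_le_mul_of_nonneg_left ?_ (mul_nonneg (hp0 i) (hp0 j))
      rw [haa]
      by_cases hij : i = j
      · subst hij
        simp only [hq, if_true, sub_self, norm_zero]
        have h3 : δ ≤ (1 + δ) / (1 - δ) := by rw [le_div_iff₀ h1δ]; nlinarith
        exact hr0.trans (by gcongr)
      · have h4 := (hcov r hr _ (hsep' i j hij) ‖c i - c j‖ (by simp; positivity)).1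
        have h5 : (1 + δ) / (1 - δ) * q i j = (1 + δ) * k ‖c i - c j‖ := by
          simp only [hq, if_neg hij]
          field_simp
        rw [h5]
        linarith [(_root_.abs_le.1 h4).2])
    (by
      rw [Real.coe_toNNReal _ (by positivity)]
      exact hscale _ (by positivity))
    (u := u) (u₁ := (1 - ε / 3) * u) (by nlinarith) (by nlinarith)
  refine hsup.trans (ENNReal.ofReal_le_ofReal (Real.exp_le_exp.2 ?_))
  have hW : (√(Real.toNNReal ((1 + δ) / (1 - δ) * E)) +
      √(Real.pi ^ 2 / 4 * Real.toNNReal (4 * δ / (1 - δ) * E))) ^ 2 = w * E := by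
    rw [Real.coe_toNNReal _ (by positivity), Real.coe_toNNReal _ (by positivity), ← mul_assoc,
      Real.sqrt_mul (by positivity), Real.sqrt_mul (by positivity), ← add_mul, mul_pow,
      Real.sq_sqrt hE0.le]
  rw [hW, neg_div, neg_le_neg_iff, div_div, div_le_div_iff₀ (by positivity) (by positivity)]
  -- `(1 - ε) (1 + ε / 3) ≤ (1 - ε / 3) ^ 2`
  have h6 : (1 - ε) * w ≤ (1 - ε / 3) ^ 2 := by nlinarith
  have h7 : 0 ≤ 2 * E * u ^ 2 := by positivity
  nlinarith [mul_le_mul_of_nonneg_left h6 h7]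

end Comparison

/-! ### Capacities -/

/-- A bound `q ≤ exp (-a / E)` for the energy `E` of every admissible measure amounts to a bound by
the capacity. -/
lemma mul_kernelCapacity_le_neg_log {E : Type*} [MeasurableSpace E] {K : E → E → ℝ} {D : Set E}
    {a : ℝ} (ha : 0 ≤ a) {q : ℝ≥0∞} (hq : q ≤ 1)
    (h : ∀ μ : Measure E, IsProbabilityMeasure μ → μ Dᶜ = 0 → 0 < kernelEnergy K μ ∧
      q ≤ ENNReal.ofReal (Real.exp (-(a / kernelEnergy K μ)))) :
    ((a : ℝ) : EReal) * (kernelCapacity K D : EReal) ≤ -ENNReal.log q := by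
  have hlog : 0 ≤ -ENNReal.log q := by
    rw [EReal.neg_nonneg]
    simpa using ENNReal.log_le_log hq
  rw [← EReal.coe_toENNReal hlog, show ((a : ℝ) : EReal) = (ENNReal.ofReal a : EReal) by
    rw [EReal.coe_ennreal_ofReal, max_eq_left ha], ← EReal.coe_ennreal_mul,
    EReal.coe_ennreal_le_coe_ennreal_iff, kernelCapacity, ENNReal.inv_iInf, ENNReal.mul_iSup]
  refine iSup_le fun μ => ?_
  rw [ENNReal.inv_iInf, ENNReal.mul_iSup]
  refine iSup_le fun hμ => ?_
  obtain ⟨h1, h2⟩ := h μ inferInstance hμ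
  rw [← ENNReal.ofReal_inv_of_pos h1, ← ENNReal.ofReal_mul ha, ← EReal.real_coe_toENNReal]
  refine EReal.toENNReal_le_toENNReal ?_
  rw [EReal.le_neg]
  refine (ENNReal.log_le_log h2).trans_eq ?_
  rw [ENNReal.log_ofReal_of_pos (Real.exp_pos _), Real.log_exp, div_eq_mul_inv]
  rfl

/-- If `p L M` is an upward closed predicate which holds at `1`, and every `ε ∈ (0, 1)` eventually
satisfies it, then values satisfying it can be chosen to tend to `0`: the infimum of the admissible
values, plus `1 / L` because the infimum itself need not be admissible. -/
lemma exists_tendsto_limsup_zero {p : ℝ → ℝ → ℝ → Prop}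
    (h1 : ∀ L M, p L M 1) (hmono : ∀ L M e e', e ≤ e' → p L M e → p L M e')
    (hev : ∀ ε ∈ Set.Ioo (0 : ℝ) 1, ∀ᶠ M in atTop, ∀ᶠ L in atTop, p L M ε) :
    ∃ γ : ℝ → ℝ → ℝ, Tendsto (fun M : ℝ => limsup (fun L : ℝ => (γ L M : EReal)) atTop) atTop
      (𝓝 0) ∧ ∀ L M : ℝ, 0 < L → p L M (γ L M) := by
  set A : ℝ → ℝ → Set ℝ := fun L M => {e | 0 ≤ e ∧ p L M e} with hA
  have hbdd : ∀ L M, BddBelow (A L M) := fun L M => ⟨0, fun e he => he.1⟩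
  have hne : ∀ L M, (A L M).Nonempty := fun L M => ⟨1, zero_le_one, h1 L M⟩
  refine ⟨fun L M => sInf (A L M) + 1 / L, ?_, fun L M hL => ?_⟩
  · have hnn : ∀ M, 0 ≤ limsup (fun L : ℝ => ((sInf (A L M) + 1 / L : ℝ) : EReal)) atTop := by
      intro M
      refine le_limsup_of_frequently_le (Eventually.frequently ?_)
      filter_upwards [eventually_gt_atTop 0] with L hL
      have : 0 ≤ sInf (A L M) := Real.sInf_nonneg fun e he => he.1
      exact_mod_cast (by positivity : 0 ≤ sInf (A L M) + 1 / L)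
    refine tendsto_order.2 ⟨fun b hb => Eventually.of_forall fun M => hb.trans_le (hnn M),
      fun b hb => ?_⟩
    obtain ⟨t, ht0, htb⟩ := EReal.lt_iff_exists_real_btwn.1 hb
    have ht0' : 0 < t := by exact_mod_cast ht0
    have hε : min (t / 2) (1 / 2) ∈ Set.Ioo (0 : ℝ) 1 :=
      ⟨by positivity, (min_le_right _ _).trans_lt (by norm_num)⟩
    filter_upwards [hev _ hε] with M hM
    refine lt_of_le_of_lt (limsup_le_of_le (h := ?_)) htb
    filter_upwards [hM, eventually_ge_atTop (2 / t), eventually_gt_atTop 0] with L hL hLt hL0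
    have h2 : sInf (A L M) ≤ min (t / 2) (1 / 2) := csInf_le (hbdd L M) ⟨hε.1.le, hL⟩
    have h3 : 1 / L ≤ t / 2 := by
      rw [div_le_iff₀ ht0'] at hLt
      rw [div_le_div_iff₀ hL0 two_pos]
      linarith
    have h4 := min_le_left (t / 2) (1 / 2)
    exact_mod_cast (by linarith : sInf (A L M) + 1 / L ≤ t)
  · obtain ⟨e, he, hlt⟩ := exists_lt_of_csInf_lt (hne L M)
      (show sInf (A L M) < sInf (A L M) + 1 / L by simpa using hL)
    exact hmono L M e _ hlt.le he.2

theorem theorem3p6 {d : ℕ} (hd : 1 ≤ d)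
    {Ω : Type*} [MeasurableSpace Ω] (P : Measure Ω) [IsProbabilityMeasure P]
    (f : EuclideanSpace ℝ (Fin d) → Ω → ℝ) (k : ℝ → ℝ)
    (hf : IsIsotropicGaussianField f P k) (hfC1 : IsC1Field f P)
    (α : ℝ) (hα : 0 ≤ α) (hk : RegularlyVarying k α)
    {Ω' : ℝ → Type*} [∀ L, MeasurableSpace (Ω' L)]
    (Q : ∀ L, Measure (Ω' L)) [∀ L, IsProbabilityMeasure (Q L)]
    (fL gL : ∀ L, EuclideanSpace ℝ (Fin d) → Ω' L → ℝ)
    (hdec : IsLocalGlobalDecomposition f P k Q fL gL)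
    (u : ℝ) (hu : 0 < u)
    (s : ℝ → ℝ) (hs : Tendsto s atTop atTop) (hks : k =o[atTop] fun L => k (s L)) :
    ∃ γ : ℝ → ℝ → ℝ,
      Tendsto (fun M : ℝ => limsup (fun L : ℝ => (γ L M : EReal)) atTop) atTop (𝓝 0) ∧
      ∀ L M : ℝ, 1 ≤ L → 1 ≤ M →
        ∀ (n : ℕ) (c : Fin n → EuclideanSpace ℝ (Fin d)),
          (∀ i j, i ≠ j → ∀ x ∈ Metric.closedBall (c i) L, ∀ y ∈ Metric.closedBall (c j) L,
            M * L < dist x y) →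
          ((u ^ 2 * (1 - γ L M) / 2 : ℝ) : EReal) *
              (kernelCapacity (fun x y : EuclideanSpace ℝ (Fin d) => k ‖x - y‖)
                (⋃ i, Metric.closedBall (c i) (s L)) : EReal)
            ≤ - ENNReal.log (Q L {ω | ∀ i, ∃ x ∈ Metric.closedBall (c i) L, u ≤ gL L x ω}) := by
  set q : ∀ L : ℝ, (n : ℕ) → (Fin n → EuclideanSpace ℝ (Fin d)) → ℝ≥0∞ := fun L n c =>
    Q L {ω | ∀ i, ∃ x ∈ Metric.closedBall (c i) L, u ≤ gL L x ω} with hq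
  have hcoef : ∀ (e e' : ℝ), e ≤ e' → ((u ^ 2 * (1 - e') / 2 : ℝ) : EReal) ≤
      ((u ^ 2 * (1 - e) / 2 : ℝ) : EReal) := fun e e' h => by
    exact_mod_cast (by gcongr : u ^ 2 * (1 - e') / 2 ≤ u ^ 2 * (1 - e) / 2)
  obtain ⟨γ, hγ, hp⟩ := exists_tendsto_limsup_zero
    (p := fun L M e => ∀ (n : ℕ) (c : Fin n → EuclideanSpace ℝ (Fin d)),
      (∀ i j, i ≠ j → ∀ x ∈ Metric.closedBall (c i) L, ∀ y ∈ Metric.closedBall (c j) L,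
        M * L < dist x y) →
      ((u ^ 2 * (1 - e) / 2 : ℝ) : EReal) *
          (kernelCapacity (fun x y : EuclideanSpace ℝ (Fin d) => k ‖x - y‖)
            (⋃ i, Metric.closedBall (c i) (s L)) : EReal) ≤ - ENNReal.log (q L n c))
    (fun L M n c _ => by
      -- at `e = 1` the left-hand side is `0`, by the convention `0 * ∞ = 0`
      have hlog : 0 ≤ -ENNReal.log (q L n c) := by
        rw [EReal.neg_nonneg]
        simpa using ENNReal.log_le_log (prob_le_one (μ := Q L))
      simpa using hlog)
    (fun L M e e' hee' h n c hsep =>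
      (mul_le_mul_of_nonneg_right (hcoef e e' hee') (EReal.coe_ennreal_nonneg _)).trans
        (h n c hsep))
    (fun ε hε => by
      filter_upwards [hdec.eventually_exceedance_le hd hf hα hk hu hs hks hε.1 hε.2] with M hM
      filter_upwards [hM] with L hL n c hsep
      have := hε.2
      exact mul_kernelCapacity_le_neg_log (by nlinarith [sq_nonneg u]) prob_le_one (hL n c hsep))
  exact ⟨γ, hγ, fun L M hL _ n c hsep => hp L M (by linarith) n c hsep⟩
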